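/- **Equivariant Hilbert Straightening Theorem.** *Conventions.* Let $Y$ be an affine space over a real vector space $Y_\bullet$ of dimension $n$, $1\le n<\infty$. For a norm $N$ on $Y_\bullet$ use the distance $N(y_1-y_2)$ on $Y$; for a positive definite quadratic form $h$ on $Y_\bullet$ put $\|v\|_h=\sqrt{h(v)}$. For a map $f$ between metric spaces let $\mathrm{Lip}(f)$ be its Lipschitz constant and $$\mathrm{Lip}_\infty(f)=\limsup_{dist(x_1,x_2)\to\infty}\frac{dist(f(x_1),f(x_2))}{dist(x_1,x_2)},\qquad \mathrm{coLip}_\infty(f)=\limsup_{diam(B)\to\infty}\frac{diam(f^{-1}(B))}{diam(B)},$$ where $B$ runs over the bounded subsets of the target. The map $f$ is an *isometry at infinity* if its image meets all balls of radius $R$ in the target for all $R\ge R_0$, for some $R_0<\infty$, and $\mathrm{Lip}_\infty(f)=\mathrm{coLip}_\infty(f)=1$. An *axial projector* of $(Y_\bullet,N)$ is a pair $p=(u_p,l_p)$ of a vector $u_p$ with $N(u_p)=1$ and a linear form $l_p$ with $l_p(u_p)=1$ and $|l_p|\le N$ (it represents the norm one projector $y\mapsto l_p(y)u_p$ onto the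 axis $\mathbb R u_p$); $\mathcal P$ is the space of axial projectors. An *axial partition of unity* is a Borel measure $\mu$ on $\mathcal P$ with $\int_{\mathcal P} l_p(y)u_p\,d\mu(p)=y$ for all $y\in Y_\bullet$. For a map $f$ from a metric space $X$ to $(Y_\bullet,N)$ let $$\|min.dil^*f\|=\inf_\mu\Big(\int_{\mathcal P}\mathrm{Lip}(l_p\circ f)^2d\mu(p)\Big)^{1/2},\qquad \|min.\widetilde{dil}^*f\|=\inf_{\mu,\tilde f}\Big(\int_{\mathcal P}\mathrm{Lip}(\tilde f_p)^2d\mu(p)\Big)^{1/2},$$ where $\mu$ runs over the axial partitions of unity and $\tilde f=(\tilde f_p)_{p\in\mathcal P}$ over the families of functions $\tilde f_p:X\to\mathbb R$ with $p\mapsto\tilde f_p(x)$ in $L_2(\mathcal P,\mu)$ for every $x$, with $p\mapsto \mathrm{Lip}(\tilde f_p)$ $\mu$-measurable, and with $\int_{\mathcal P}\tilde f_p(x)u_p\,d\mu(p)=f(x)$ for all $x\in X$. Put $Hilb(f)=\|min.dil^*f\|/\|min.dil^*id\|$ and $\widetilde{Hilb}(f)=\|min.\widetilde{dil}^*f\|/\|min.\widetilde{dil}^*id\|$,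 where $id$ is the identity map of $(Y_\bullet,N)$. For maps into $Y$ these constants are taken after choosing a point of $Y$ as origin (they do not depend on the choice). *John's form* of a norm $N$ on $Y_\bullet$ is a positive definite quadratic form $h$ with $\|\cdot\|_h\ge N$ for which the identity map $(Y_\bullet,N)\to(Y_\bullet,\|\cdot\|_h)$ has $Hilb\le 1$. A *Federer–Whitney norm* of a map $f_0$ from a metric space $X$ to $Y$ is a norm $N$ on $Y_\bullet$ for which $f_0:X\to (Y,N)$ is an isometry at infinity. A *Federer–Whitney–John form* of $f_0$ is a John form of a Federer–Whitney norm of $f_0$. *Theorem.* Let $\Gamma$ be a locally compact group acting continuously by isometries on a non-empty locally compact metric space $X$ and continuously by affine transformations on $Y$. Suppose that $Y/\Gamma$ is compact and that $\Gamma$ has a subgroup $\Pi$, with $\Gamma/\Pi$ compact, that acts on $Y$ by parallel translations. Let $f_0:X\to Y$ be a proper continuous $\Gamma$-equivariant map that is Lipschitz on the large scale, i.e. for some (equivalently, every) norm on $Y_\bullet$ there is a constant $C$ with $\|f_0(x)-f_0(x')\|\le C\,dist_X(x,x')+C$ for all $x,x'\in X$. Then $f_0$ has exactly one Federer–Whitney–John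 form $h_\diamond$. The corresponding Euclidean metric on $Y$ is $\Gamma$-invariant, and there is a $\Gamma$-equivariant Lipschitz map $f_\diamond:X\to (Y,h_\diamond)$ such that $$\sup_{x\in X}\|f_\diamond(x)-f_0(x)\|_{h_\diamond}<\infty,\qquad \widetilde{Hilb}(f_\diamond)=1,\qquad \mathrm{coLip}_\infty(f_\diamond)\le 1,$$ where $\widetilde{Hilb}$ and $\mathrm{coLip}_\infty$ are taken with respect to $h_\diamond$ on $Y$. -/

import Mathlib

open Filter Topology MeasureTheory
open scoped ENNReal

/-! Metric notions.  Distances are passed as explicit functions, because one and the same space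
carries several metrics: the Banach metrics and the Euclidean metrics on an affine space. -/

section Metric

variable {A B : Type*}

/-- The dilation `dist (f a₁) (f a₂) / dist a₁ a₂` of a map `f`, for `a₁ ≠ a₂`. -/
noncomputable def dil (dA : A → A → ℝ) (dB : B → B → ℝ) (f : A → B) (a₁ a₂ : A) : ℝ≥0∞ :=
  ENNReal.ofReal (dB (f a₁) (f a₂) / dA a₁ a₂)

/-- The Lipschitz constant `Lip f`, with values in `[0, ∞]`. -/
noncomputable def lipConst (dA : A → A → ℝ) (dB : B → B → ℝ) (f : A → B) : ℝ≥0∞ :=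
  ⨆ (a₁ : A) (a₂ : A) (_ : a₁ ≠ a₂), dil dA dB f a₁ a₂

/-- The Lipschitz constant at infinity: the upper limit of the dilation as `dist a₁ a₂ → ∞`. -/
noncomputable def lipAtInfty (dA : A → A → ℝ) (dB : B → B → ℝ) (f : A → B) : ℝ≥0∞ :=
  limsup (fun q : A × A => dil dA dB f q.1 q.2) (comap (fun q : A × A => dA q.1 q.2) atTop)

/-- The diameter of a set, with values in `[0, ∞]`. -/
noncomputable def setDiam (dA : A → A → ℝ) (S : Set A) : ℝ≥0∞ :=
  ⨆ (a₁ ∈ S) (a₂ ∈ S), ENNReal.ofReal (dA a₁ a₂)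

/-- The co-Lipschitz constant at infinity: the upper limit of `diam (f⁻¹ S) / diam S` over the
bounded sets `S` (those of finite diameter) as `diam S → ∞`. -/
noncomputable def coLipAtInfty (dA : A → A → ℝ) (dB : B → B → ℝ) (f : A → B) : ℝ≥0∞ :=
  limsup (fun S : Set B => setDiam dA (f ⁻¹' S) / setDiam dB S) (comap (setDiam dB) (𝓝[<] ⊤))

/-- `f` is an isometry at infinity: its image meets all balls of radius `R ≥ R₀`, and
`Lip_∞ f = coLip_∞ f = 1`. -/
def IsIsometryAtInfty (dA : A → A → ℝ) (dB : B → B → ℝ) (f : A → B) : Prop :=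
  (∃ R₀ : ℝ, ∀ R ≥ R₀, ∀ b : B, ∃ a : A, dB (f a) b ≤ R) ∧
    lipAtInfty dA dB f = 1 ∧ coLipAtInfty dA dB f = 1

end Metric

/-! Axial projectors and dilations for maps into a finite dimensional space `V`.  The norm of `V`
as a normed space only serves to provide the standard topology; the norm that enters the notions
is the explicit function `N : V → ℝ`. -/

section Dilation

variable {V : Type*} [NormedAddCommGroup V] [NormedSpace ℝ V]

/-- The distance associated with a norm. -/
def normDist {Y : Type*} [AddTorsor V Y] (N : V → ℝ) (y₁ y₂ : Y) : ℝ := N (y₁ -ᵥ y₂)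

/-- The Euclidean norm of a quadratic form. -/
noncomputable def formNorm (h : QuadraticForm ℝ V) (v : V) : ℝ := √(h v)

/-- Axial projectors `(a, p)` in `(V, N)`: the axis is `a t = t • u` with `N u = 1`, and the
projector is `p y = l y • u` with `l` linear, `l u = 1` (so `p` is a projector onto the axis) and
`|l y| ≤ N y` (so `Lip p = 1`).  We record the pair `(u, l)`; in the parameter of the axis,
`p` is the function `l`. -/
def AxialProjector (N : V → ℝ) : Type _ :=
  {q : V × (V →L[ℝ] ℝ) // N q.1 = 1 ∧ q.2 q.1 = 1 ∧ ∀ y, |q.2 y| ≤ N y}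

namespace AxialProjector

variable {N : V → ℝ}

/-- The unit vector `u = a 1` of the axis. -/
def vec (p : AxialProjector N) : V := p.1.1

/-- The linear form `l` with `p y = l y • u`. -/
def form (p : AxialProjector N) : V →L[ℝ] ℝ := p.1.2

instance : TopologicalSpace (AxialProjector N) :=
  inferInstanceAs (TopologicalSpace
    {q : V × (V →L[ℝ] ℝ) // N q.1 = 1 ∧ q.2 q.1 = 1 ∧ ∀ y, |q.2 y| ≤ N y})

instance : MeasurableSpace (AxialProjector N) := borel _

instance : BorelSpace (AxialProjector N) := ⟨rfl⟩

end AxialProjector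

/-- Axial partition of unity: a Borel measure on the axial projectors with `∫ p dμ = id`. -/
def IsPartitionOfUnity {N : V → ℝ} (μ : Measure (AxialProjector N)) : Prop :=
  ∀ y : V, Integrable (fun p => p.form y • p.vec) μ ∧ ∫ p, p.form y • p.vec ∂μ = y

variable {A : Type*}

/-- The `L₂`-dilation `(∫ Lip (p ∘ f)² dμ) ^ (1/2)` of a map `f : A → (V, N)`. -/
noncomputable def dilL2 (dA : A → A → ℝ) {N : V → ℝ} (μ : Measure (AxialProjector N))
    (f : A → V) : ℝ≥0∞ :=
  (∫⁻ p, lipConst dA dist (fun a => p.form (f a)) ^ 2 ∂μ) ^ (1 / 2 : ℝ)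

/-- `F` is a lift of `f`: a family of real functions `F p` on `A`, giving a map `A → L₂(μ)`, such
that `f a = ∫ (F p a) • u_p dμ(p)`. -/
structure IsLift (dA : A → A → ℝ) {N : V → ℝ} (μ : Measure (AxialProjector N)) (f : A → V)
    (F : AxialProjector N → A → ℝ) : Prop where
  memLp : ∀ a, MemLp (fun p => F p a) 2 μ
  aemeasurable_lip : AEMeasurable (fun p => lipConst dA dist (F p)) μ
  integrable : ∀ a, Integrable (fun p => F p a • p.vec) μ
  integral_eq : ∀ a, ∫ p, F p a • p.vec ∂μ = f a

/-- The `L̃₂`-dilation: the infimum of `(∫ Lip (F p)² dμ(p)) ^ (1/2)` over the lifts `F` of `f`. -/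
noncomputable def tildeDilL2 (dA : A → A → ℝ) {N : V → ℝ} (μ : Measure (AxialProjector N))
    (f : A → V) : ℝ≥0∞ :=
  ⨅ (F : AxialProjector N → A → ℝ) (_ : IsLift dA μ f F),
    (∫⁻ p, lipConst dA dist (F p) ^ 2 ∂μ) ^ (1 / 2 : ℝ)

/-- The minimal `L₂`-dilation over all axial partitions of unity in `(V, N)`. -/
noncomputable def minDilL2 (dA : A → A → ℝ) (N : V → ℝ) (f : A → V) : ℝ≥0∞ :=
  ⨅ (μ : Measure (AxialProjector N)) (_ : IsPartitionOfUnity μ), dilL2 dA μ f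

/-- The minimal `L̃₂`-dilation over all axial partitions of unity in `(V, N)`. -/
noncomputable def minTildeDilL2 (dA : A → A → ℝ) (N : V → ℝ) (f : A → V) : ℝ≥0∞ :=
  ⨅ (μ : Measure (AxialProjector N)) (_ : IsPartitionOfUnity μ), tildeDilL2 dA μ f

/-- The constant `Hilb f` of a map `f : A → (V, N)`. -/
noncomputable def hilb (dA : A → A → ℝ) (N : V → ℝ) (f : A → V) : ℝ≥0∞ :=
  minDilL2 dA N f / minDilL2 (normDist N) N (id : V → V)

/-- The constant `Hilb~ f` of a map `f : A → (V, N)`. -/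
noncomputable def tildeHilb (dA : A → A → ℝ) (N : V → ℝ) (f : A → V) : ℝ≥0∞ :=
  minTildeDilL2 dA N f / minTildeDilL2 (normDist N) N (id : V → V)

/-- John's Euclidean form of the norm `N`: `‖v‖_h ≥ N v` for all `v`, and the identity map
`(V, N) → (V, h)` has `Hilb ≤ 1`. -/
def IsJohnForm (N : V → ℝ) (h : QuadraticForm ℝ V) : Prop :=
  h.PosDef ∧ (∀ v, N v ≤ formNorm h v) ∧ hilb (normDist N) (formNorm h) (id : V → V) ≤ 1

/-- The Federer-Whitney descendant of the metric of `X` under `f : X → Y`: a norm for which `f` is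
an isometry at infinity. -/
def IsFedererWhitney {X Y : Type*} [MetricSpace X] [AddTorsor V Y] (f : X → Y)
    (N : Seminorm ℝ V) : Prop :=
  (∀ v, N v = 0 → v = 0) ∧ IsIsometryAtInfty dist (normDist N) f

/-- Federer-Whitney-John form of `f`: John's form of the Federer-Whitney norm. -/
def IsFedererWhitneyJohn {X Y : Type*} [MetricSpace X] [AddTorsor V Y] (f : X → Y)
    (h : QuadraticForm ℝ V) : Prop :=
  ∃ N : Seminorm ℝ V, IsFedererWhitney f N ∧ IsJohnForm N h

end Dilation

/-- A quasi-translational cocompact affine action of `Γ` on `Y`: `Γ` acts by affine maps, `Y / Γ`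
is compact, and some cocompact subgroup of `Γ` acts by parallel translations. -/
structure IsCocompactQuasiTranslational (Γ V Y : Type*) [Group Γ] [TopologicalSpace Γ]
    [NormedAddCommGroup V] [NormedSpace ℝ V] [MetricSpace Y] [NormedAddTorsor V Y]
    [MulAction Γ Y] : Prop where
  affine : ∀ γ : Γ, ∃ T : Y →ᵃ[ℝ] Y, ∀ y : Y, γ • y = T y
  cocompact : CompactSpace (Quotient (MulAction.orbitRel Γ Y))
  quasiTranslational : ∃ H : Subgroup Γ, CompactSpace (Γ ⧸ H) ∧
    ∀ γ ∈ H, ∃ v : V, ∀ y : Y, γ • y = v +ᵥ y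

/-! Translations coming from `Γ` move any point of `Y` to within a bounded distance of any other. By
properness, `dist x x'` is therefore determined by `f₀ x -ᵥ f₀ x'` up to an additive constant, so it
is a coarse norm on `V`. Its homogenization `N`, the stable norm, satisfies `N (f₀ x -ᵥ f₀ x') ≤
dist x x' + C`, and `dist x x' ≤ (1 + ε) * N (f₀ x -ᵥ f₀ x') + C_ε` for every `ε > 0`. These two
estimates (`IsAsymptoticIsometry`) make `N` the only norm for which `f₀` is an isometry at infinity,
and they show that the linear parts of `Γ` preserve `N`.

John's form is the form of the ellipsoid of maximal volume in the unit ball of `N`. Varying that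
ellipsoid writes the identity as a positive combination of orthogonal projectors onto contact
directions (`Seminorm.exists_contact_decomposition`). In a Euclidean space every axial projector is
orthogonal, so a partition of unity satisfies `∫ ⟪u, T u⟫ dμ = tr T`. For `T = id` this gives total
mass `n`. For `T = B B*`, with `B` the passage between two John forms, it forces `B` to be
orthogonal. Uniqueness makes the form `Γ`-invariant, and averaging over the compact group of
isometries preserving the contact set gives an invariant measure `m` there that still decomposes the
identity.

For a contact direction `z` the function `⟪z, e (f₀ x -ᵥ o)⟫` is 1-Lipschitz up to the additive
constant `C`, so its largest 1-Lipschitz minorant stays within `C` of it. The vector integral of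
these minorants over `m` is the map sought: it is equivariant, at bounded distance from `f₀`, and
the minorants form a lift of dilation at most `√n`.

No lift can do better, by a coarse divergence theorem (`IsLift.le_integral_lipConst`). Pair a lift
`F` with the position vector over a large ball. Reflecting in the hyperplane orthogonal to `u_p`
bounds the contribution of `F p` by its Lipschitz constant, whence `∫ Lip (F p) dμ ≥ n` and `∫ Lip
(F p)² dμ ≥ n`, the value attained by the identity. -/

/-! ### Homogenization of coarse norms -/

section StableNorm

variable {V : Type*} [NormedAddCommGroup V] [NormedSpace ℝ V]

/-- The slopes of the affine functions that bound `D` along the ray through `v`. -/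
def raySlopes (D : V → ℝ) (v : V) : Set ℝ := {a | ∃ B : ℝ, ∀ t : ℝ, 0 ≤ t → D (t • v) ≤ a * t + B}

/-- A function on `V` that is subadditive, symmetric, locally bounded and of linear growth, up to
an additive constant. -/
structure IsCoarseNorm (D : V → ℝ) (c C : ℝ) : Prop where
  pos : 0 < c
  add_le : ∀ v w, D (v + w) ≤ D v + D w + C
  neg_le : ∀ v, D (-v) ≤ D v + C
  le_of_norm_le : ∀ v, ‖v‖ ≤ 1 → D v ≤ C
  ge : ∀ v, c * ‖v‖ - C ≤ D v

namespace IsCoarseNorm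

variable {D : V → ℝ} {c C : ℝ}

omit [NormedSpace ℝ V] in
theorem const_nonneg (hD : IsCoarseNorm D c C) : 0 ≤ C := by
  have h1 := hD.ge 0
  have h2 := hD.le_of_norm_le 0 (by simp)
  simp at h1
  linarith

theorem natCast_smul_le (hD : IsCoarseNorm D c C) (k : ℕ) (v : V) :
    D ((k : ℝ) • v) ≤ k * (D v + C) + C := by
  induction k with
  | zero => simpa using hD.le_of_norm_le 0 (by simp)
  | succ k ih =>
    have := hD.add_le ((k : ℝ) • v) v
    push_cast
    rw [add_smul, one_smul]
    linarith

/-- Cut `v` into `⌈‖v‖⌉` equal pieces, each in the unit ball. -/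
theorem le_norm (hD : IsCoarseNorm D c C) (v : V) : D v ≤ 2 * C * ‖v‖ + 4 * C := by
  have hC := hD.const_nonneg
  obtain ⟨k, hk1, hk2⟩ : ∃ k : ℕ, ‖v‖ ≤ k ∧ (k : ℝ) ≤ ‖v‖ + 1 :=
    ⟨⌈‖v‖⌉₊, Nat.le_ceil _, (Nat.ceil_lt_add_one (norm_nonneg v)).le⟩
  rcases Nat.eq_zero_or_pos k with rfl | hk
  · have := hD.le_of_norm_le v (by simp at hk1; simp [hk1])
    nlinarith [norm_nonneg v]
  · have hk' : (0 : ℝ) < k := by exact_mod_cast hk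
    have h := hD.natCast_smul_le k ((k : ℝ)⁻¹ • v)
    rw [smul_smul, mul_inv_cancel₀ hk'.ne', one_smul] at h
    have h2 := hD.le_of_norm_le ((k : ℝ)⁻¹ • v) (by
      rw [norm_smul, norm_inv, Real.norm_of_nonneg hk'.le, inv_mul_le_iff₀ hk']
      simpa using hk1)
    nlinarith [mul_le_mul_of_nonneg_left h2 hk'.le]

theorem norm_mem_raySlopes (hD : IsCoarseNorm D c C) (v : V) : 2 * C * ‖v‖ ∈ raySlopes D v := by
  refine ⟨4 * C, fun t ht => ?_⟩
  have := hD.le_norm (t • v)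
  rw [norm_smul, Real.norm_of_nonneg ht] at this
  linarith

theorem le_of_mem_raySlopes (hD : IsCoarseNorm D c C) {v : V} {a : ℝ} (ha : a ∈ raySlopes D v) :
    c * ‖v‖ ≤ a := by
  obtain ⟨B, hB⟩ := ha
  by_contra! h
  have hd : 0 < c * ‖v‖ - a := by linarith
  set t := (|B| + |C| + 1) / (c * ‖v‖ - a) with ht
  have ht0 : 0 ≤ t := by positivity
  have h1 := hB t ht0
  have h2 := hD.ge (t • v)
  rw [norm_smul, Real.norm_of_nonneg ht0] at h2
  have h3 : t * (c * ‖v‖ - a) = |B| + |C| + 1 := by rw [ht]; field_simp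
  nlinarith [le_abs_self B, le_abs_self C]

theorem bddBelow_raySlopes (hD : IsCoarseNorm D c C) (v : V) : BddBelow (raySlopes D v) :=
  ⟨c * ‖v‖, fun _ ha => hD.le_of_mem_raySlopes ha⟩

theorem mem_raySlopes_mono {v : V} {a b : ℝ} (ha : a ∈ raySlopes D v) (hab : a ≤ b) :
    b ∈ raySlopes D v := by
  obtain ⟨B, hB⟩ := ha
  exact ⟨B, fun t ht => (hB t ht).trans (by nlinarith)⟩

theorem mem_raySlopes_of_lt (hD : IsCoarseNorm D c C) {v : V} {a : ℝ}
    (ha : sInf (raySlopes D v) < a) : a ∈ raySlopes D v := by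
  obtain ⟨b, hb, hba⟩ := (csInf_lt_iff (hD.bddBelow_raySlopes v) ⟨_, hD.norm_mem_raySlopes v⟩).1 ha
  exact mem_raySlopes_mono hb hba.le

/-- `D + C` is subadditive, so integer multiples of `v` grow with slope at most `D v + C`, and the
fractional part of `t` costs a bounded amount. As in Fekete's lemma, the stable norm thus exceeds
`D` by at most an additive constant, which later keeps the straightened map close to `f₀`. -/
theorem self_mem_raySlopes (hD : IsCoarseNorm D c C) (v : V) : D v + C ∈ raySlopes D v := by
  have hC := hD.const_nonneg
  refine ⟨2 * C * ‖v‖ + 6 * C + |D v + C|, fun t ht => ?_⟩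
  have h0 := Nat.floor_le ht
  have h1 := Nat.lt_floor_add_one t
  set k := ⌊t⌋₊
  have h2 := hD.natCast_smul_le k v
  have h3 := hD.le_norm ((t - k) • v)
  have h4 := hD.add_le ((k : ℝ) • v) ((t - k) • v)
  rw [← add_smul, add_sub_cancel] at h4
  rw [norm_smul, Real.norm_of_nonneg (by linarith)] at h3
  have h5 : (t - k) * ‖v‖ ≤ ‖v‖ := by nlinarith [norm_nonneg v]
  have h6 : (k - t) * (D v + C) ≤ |D v + C| := by
    have : -(D v + C) ≤ |D v + C| := neg_le_abs _
    nlinarith [abs_nonneg (D v + C)]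
  nlinarith

theorem add_mem_raySlopes (hD : IsCoarseNorm D c C) {v w : V} {a b : ℝ} (ha : a ∈ raySlopes D v)
    (hb : b ∈ raySlopes D w) : a + b ∈ raySlopes D (v + w) := by
  obtain ⟨A, hA⟩ := ha
  obtain ⟨B, hB⟩ := hb
  refine ⟨A + B + C, fun t ht => ?_⟩
  rw [smul_add]
  linarith [hD.add_le (t • v) (t • w), hA t ht, hB t ht]

theorem abs_smul_mem_raySlopes (hD : IsCoarseNorm D c C) {v : V} {a : ℝ} (ha : a ∈ raySlopes D v)
    (r : ℝ) : |r| * a ∈ raySlopes D (r • v) := by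
  obtain ⟨A, hA⟩ := ha
  have hC := hD.const_nonneg
  refine ⟨A + C, fun t ht => ?_⟩
  have key := hA (t * |r|) (by positivity)
  rcases le_total 0 r with hr | hr
  · rw [smul_smul]
    rw [abs_of_nonneg hr] at key ⊢
    linarith
  · have := hD.neg_le ((t * |r|) • v)
    rw [abs_of_nonpos hr] at this key ⊢
    rw [smul_smul]
    rw [← neg_smul, show -(t * -r) = t * r by ring] at this
    linarith

/-- The stable norm of a coarse norm. -/
noncomputable def stableNorm (hD : IsCoarseNorm D c C) : Seminorm ℝ V :=
  Seminorm.ofSMulLE (fun v => sInf (raySlopes D v))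
    (by
      refine le_antisymm ?_ ?_
      · exact (csInf_le (hD.bddBelow_raySlopes 0) (hD.norm_mem_raySlopes 0)).trans (by simp)
      · exact le_csInf ⟨_, hD.norm_mem_raySlopes 0⟩ fun a ha => by
          simpa using hD.le_of_mem_raySlopes ha)
    (fun v w => by
      refine le_of_forall_pos_le_add fun ε hε => ?_
      refine (csInf_le (hD.bddBelow_raySlopes _) (hD.add_mem_raySlopes
        (hD.mem_raySlopes_of_lt (lt_add_of_pos_right _ (half_pos hε)))
        (hD.mem_raySlopes_of_lt (lt_add_of_pos_right _ (half_pos hε))))).trans ?_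
      linarith)
    (fun r v => by
      refine le_of_forall_pos_le_add fun ε hε => ?_
      have hr : 0 < |r| + 1 := by positivity
      refine (csInf_le (hD.bddBelow_raySlopes _) (hD.abs_smul_mem_raySlopes
        (hD.mem_raySlopes_of_lt (lt_add_of_pos_right _ (div_pos hε hr))) r)).trans ?_
      rw [mul_add, Real.norm_eq_abs]
      gcongr
      rw [mul_div_assoc', div_le_iff₀ hr]
      nlinarith [abs_nonneg r])

theorem stableNorm_le (hD : IsCoarseNorm D c C) (v : V) : hD.stableNorm v ≤ D v + C :=
  csInf_le (hD.bddBelow_raySlopes v) (hD.self_mem_raySlopes v)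

theorem le_stableNorm (hD : IsCoarseNorm D c C) (v : V) : c * ‖v‖ ≤ hD.stableNorm v :=
  le_csInf ⟨_, hD.norm_mem_raySlopes v⟩ fun _ ha => hD.le_of_mem_raySlopes ha

theorem stableNorm_le_norm (hD : IsCoarseNorm D c C) (v : V) :
    hD.stableNorm v ≤ 2 * C * ‖v‖ :=
  csInf_le (hD.bddBelow_raySlopes v) (hD.norm_mem_raySlopes v)

/-- The constant `B` in a slope depends on the ray. Compactness of the unit sphere leaves finitely
many rays, at the price of the factor `1 + ε`. -/
theorem le_stableNorm_add [FiniteDimensional ℝ V] (hD : IsCoarseNorm D c C) {ε : ℝ} (hε : 0 < ε) :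
    ∃ B, ∀ v, D v ≤ (1 + ε) * hD.stableNorm v + B := by
  have hC := hD.const_nonneg
  have hc := hD.pos
  -- Three errors occur: `δ ‖v‖` from the slope, and `2 C δ ‖v‖` twice, from `D` and from the stable
  -- norm of `v - ‖v‖ • w`. Their sum is `ε c ‖v‖`, at most `ε` times the stable norm of `v`.
  set δ := ε * c / (4 * C + 1) with hδ
  have hδ0 : 0 < δ := by positivity
  obtain ⟨s, hs, hcov⟩ := Metric.totallyBounded_iff.1
    (isCompact_sphere (0 : V) 1).totallyBounded δ hδ0
  have hB : ∀ w : V, ∃ B, ∀ t : ℝ, 0 ≤ t → D (t • w) ≤ (hD.stableNorm w + δ) * t + B := fun w =>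
    hD.mem_raySlopes_of_lt (lt_add_of_pos_right _ hδ0)
  choose B hB using hB
  obtain ⟨M, hM⟩ := (hs.image B).bddAbove
  refine ⟨|M| + 5 * C, fun v => ?_⟩
  rcases eq_or_ne v 0 with rfl | hv
  · have := hD.le_of_norm_le 0 (by simp)
    simp only [map_zero]
    nlinarith [abs_nonneg M]
  have hv0 : 0 < ‖v‖ := norm_pos_iff.2 hv
  have hu : ‖v‖⁻¹ • v ∈ Metric.sphere (0 : V) 1 := by
    simp [norm_smul, hv0.ne']
  obtain ⟨w, hw, huw⟩ := Set.mem_iUnion₂.1 (hcov hu)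
  have h1 := hB w ‖v‖ hv0.le
  have h2 : B w ≤ |M| := (hM (Set.mem_image_of_mem _ hw)).trans (le_abs_self M)
  have huw' : ‖v - ‖v‖ • w‖ ≤ δ * ‖v‖ := by
    have : v - ‖v‖ • w = ‖v‖ • (‖v‖⁻¹ • v - w) := by
      rw [smul_sub, smul_smul, mul_inv_cancel₀ hv0.ne', one_smul]
    rw [this, norm_smul, norm_norm, mul_comm]
    rw [Metric.mem_ball, dist_eq_norm] at huw
    gcongr
  have h3 := hD.le_norm (v - ‖v‖ • w)
  have h4 := hD.add_le (‖v‖ • w) (v - ‖v‖ • w)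
  rw [add_sub_cancel] at h4
  have h5 : ‖v‖ * hD.stableNorm w ≤ hD.stableNorm v + 2 * C * (δ * ‖v‖) := by
    have e1 : ‖v‖ * hD.stableNorm w = hD.stableNorm (‖v‖ • w) := by
      rw [map_smul_eq_mul, norm_norm]
    have e2 : hD.stableNorm (‖v‖ • w) ≤ hD.stableNorm v + hD.stableNorm (v - ‖v‖ • w) := by
      have := map_sub_le_add hD.stableNorm v (v - ‖v‖ • w)
      simpa using this
    have e3 := hD.stableNorm_le_norm (v - ‖v‖ • w)
    have e4 : 2 * C * ‖v - ‖v‖ • w‖ ≤ 2 * C * (δ * ‖v‖) := by gcongr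
    linarith
  have h6 : 2 * C * ‖v - ‖v‖ • w‖ ≤ 2 * C * (δ * ‖v‖) := by gcongr
  have h7 : (4 * C + 1) * δ * ‖v‖ ≤ ε * hD.stableNorm v := by
    have : (4 * C + 1) * δ = ε * c := by rw [hδ]; field_simp
    rw [this, mul_assoc]
    exact mul_le_mul_of_nonneg_left (hD.le_stableNorm v) hε.le
  nlinarith

end IsCoarseNorm

end StableNorm

/-! ### The asymptotic norm of a map with coarsely transitive translations -/

section Coarse

variable {X V Y : Type*} [MetricSpace X] [NormedAddCommGroup V] [NormedSpace ℝ V]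
  [MetricSpace Y] [NormedAddTorsor V Y]

/-- `f` is coarsely onto, and the distance of `X` is asymptotic to `N (f x -ᵥ f x')`, which
exceeds it by at most a constant. -/
structure IsAsymptoticIsometry (f : X → Y) (N : Seminorm ℝ V) : Prop where
  definite : ∃ c > 0, ∀ v, c * ‖v‖ ≤ N v
  le_norm : ∃ M, 0 ≤ M ∧ ∀ v, N v ≤ M * ‖v‖
  dense : ∃ R, ∀ y, ∃ x, dist (f x) y ≤ R
  upper : ∃ C, ∀ x x', N (f x -ᵥ f x') ≤ dist x x' + C
  lower : ∀ ε > 0, ∃ C, ∀ x x', dist x x' ≤ (1 + ε) * N (f x -ᵥ f x') + C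

theorem isCompact_closedBall_torsor [FiniteDimensional ℝ V] (y : Y) (r : ℝ) :
    IsCompact (Metric.closedBall y r) := by
  have : ProperSpace V := FiniteDimensional.proper_real V
  have h : Metric.closedBall y r = (IsometryEquiv.vaddConst y) '' Metric.closedBall (0 : V) r := by
    rw [IsometryEquiv.image_closedBall]; simp
  rw [h]
  exact (isCompact_closedBall _ _).image (IsometryEquiv.vaddConst y).continuous

theorem exists_dist_smul_le {Γ : Type*} [Group Γ] [MulAction Γ Y] [ContinuousConstSMul Γ Y]
    [CompactSpace (Quotient (MulAction.orbitRel Γ Y))] (y₀ : Y) :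
    ∃ r : ℝ, ∀ y : Y, ∃ γ : Γ, dist (γ • y) y₀ ≤ r := by
  let π : Y → Quotient (MulAction.orbitRel Γ Y) := Quotient.mk _
  have hπ : IsOpenMap π := isOpenMap_quotient_mk'_mul
  obtain ⟨m, hm⟩ := isCompact_univ.elim_directed_cover (fun m : ℕ => π '' Metric.ball y₀ m)
    (fun m => hπ _ Metric.isOpen_ball)
    (fun q _ => by
      obtain ⟨y, rfl⟩ := Quotient.exists_rep q
      obtain ⟨m, hm⟩ := exists_nat_gt (dist y y₀)
      exact Set.mem_iUnion.2 ⟨m, y, hm, rfl⟩)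
    (directed_of_isDirected_le fun a b hab =>
      Set.image_mono (Metric.ball_subset_ball (by exact_mod_cast hab)))
  refine ⟨m, fun y => ?_⟩
  obtain ⟨z, hz, hzy⟩ := hm (Set.mem_univ (π y))
  obtain ⟨γ, hγ⟩ := Quotient.exact hzy
  refine ⟨γ, ?_⟩
  have : γ • y = z := hγ
  rw [this]
  exact (Metric.mem_ball.1 hz).le

/-- Finitely many interiors of compact neighbourhoods already cover the compact quotient `Γ ⧸ H`. -/
theorem exists_isCompact_mul_subgroup {Γ : Type*} [Group Γ] [TopologicalSpace Γ]
    [IsTopologicalGroup Γ] [LocallyCompactSpace Γ] (H : Subgroup Γ) [CompactSpace (Γ ⧸ H)] :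
    ∃ Q : Set Γ, IsCompact Q ∧ ∀ γ : Γ, ∃ q ∈ Q, q⁻¹ * γ ∈ H := by
  choose K hK hKn using fun γ : Γ => exists_compact_mem_nhds γ
  obtain ⟨t, ht⟩ := isCompact_univ.elim_finite_subcover
    (fun γ : Γ => ((↑) : Γ → Γ ⧸ H) '' interior (K γ))
    (fun γ => QuotientGroup.isOpenMap_coe _ isOpen_interior)
    (fun q _ => by
      obtain ⟨γ, rfl⟩ := QuotientGroup.mk_surjective q
      exact Set.mem_iUnion.2 ⟨γ, γ, mem_interior_iff_mem_nhds.2 (hKn γ), rfl⟩)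
  refine ⟨⋃ γ ∈ t, K γ, t.isCompact_biUnion fun γ _ => hK γ, fun γ => ?_⟩
  obtain ⟨δ, hδ, q, hq, hqγ⟩ := Set.mem_iUnion₂.1 (ht (Set.mem_univ (γ : Γ ⧸ H)))
  exact ⟨q, Set.mem_biUnion hδ (interior_subset hq), QuotientGroup.eq.1 hqγ⟩

/-- In a cocompact quasi-translational action, the orbits of the elements that act by
translations are coarsely dense. -/
theorem IsCocompactQuasiTranslational.exists_translation_dist_le {Γ : Type*} [Group Γ]
    [TopologicalSpace Γ] [IsTopologicalGroup Γ] [LocallyCompactSpace Γ] [FiniteDimensional ℝ V]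
    [MulAction Γ Y] [ContinuousSMul Γ Y] (hY : IsCocompactQuasiTranslational Γ V Y) :
    ∃ R : ℝ, ∀ y y' : Y, ∃ γ : Γ, (∃ v : V, ∀ z : Y, γ • z = v +ᵥ z) ∧ dist (γ • y) y' ≤ R := by
  obtain ⟨-, hc, H, hH, htr⟩ := hY
  obtain ⟨y₀⟩ : Nonempty Y := inferInstance
  obtain ⟨r, hr⟩ := exists_dist_smul_le (Γ := Γ) y₀
  obtain ⟨Q, hQ, hQH⟩ := exists_isCompact_mul_subgroup H
  -- If `γ` moves `y` into the ball and `γ = q h` with `q ∈ Q`, `h ∈ H`, then `h • y = q⁻¹ • (γ •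
  -- y)` lies in this compact set.
  have hK : IsCompact ((fun p : Γ × Y => p.1⁻¹ • p.2) '' (Q ×ˢ Metric.closedBall y₀ r)) :=
    (hQ.prod (isCompact_closedBall_torsor y₀ r)).image
      (continuous_fst.inv.smul continuous_snd)
  obtain ⟨R, hR⟩ := hK.isBounded.subset_closedBall y₀
  have key : ∀ y : Y, ∃ γ ∈ H, dist (γ • y) y₀ ≤ R := fun y => by
    obtain ⟨γ, hγ⟩ := hr y
    obtain ⟨q, hq, hqγ⟩ := hQH γ
    refine ⟨_, hqγ, hR ⟨(q, γ • y), ⟨hq, hγ⟩, ?_⟩⟩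
    simp [mul_smul]
  refine ⟨R + R, fun y y' => ?_⟩
  obtain ⟨γ, hγ, h1⟩ := key y
  obtain ⟨γ', hγ', h2⟩ := key y'
  -- `Γ` need not preserve the metric of `Y`, but the translation `γ'` does, so `γ'⁻¹ γ y` is as
  -- close to `y'` as `γ y` is to `γ' y'`.
  refine ⟨γ'⁻¹ * γ, htr _ (H.mul_mem (H.inv_mem hγ') hγ), ?_⟩
  obtain ⟨v, hv⟩ := htr γ' hγ'
  have : dist ((γ'⁻¹ * γ) • y) y' = dist (γ • y) (γ' • y') := by
    conv_rhs => rw [show γ • y = γ' • ((γ'⁻¹ * γ) • y) by simp [mul_smul], hv, hv]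
    simp
  rw [this]
  exact (dist_triangle_right _ _ y₀).trans (add_le_add h1 h2)

omit [NormedSpace ℝ V] in
/-- A coarsely dense family of symmetries of `f` that cover translations allows to compare
distances in `X` by means of `f`. -/
theorem exists_dist_le_dist_add {f : X → Y}
    {R : ℝ} (hR : ∀ y y' : Y, ∃ (φ : X → X) (v : V), Isometry φ ∧ (∀ x, f (φ x) = v +ᵥ f x) ∧
      dist (v +ᵥ y) y' ≤ R)
    (hD : ∀ r, ∃ D, ∀ x x', dist (f x) (f x') ≤ r → dist x x' ≤ D) (r : ℝ) :
    ∃ C, ∀ x x' z z' : X, ‖(f x -ᵥ f x') - (f z -ᵥ f z')‖ ≤ r → dist x x' ≤ dist z z' + C := by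
  obtain ⟨D₁, hD₁⟩ := hD R
  obtain ⟨D₂, hD₂⟩ := hD (r + R)
  refine ⟨D₂ + D₁, fun x x' z z' h => ?_⟩
  -- Carry the pair `(z, z')` by a symmetry that brings `f z'` near `f x'`. Then `f z` lands near `f
  -- x`, because the two differences nearly agree.
  obtain ⟨φ, v, hφ, hfφ, hv⟩ := hR (f z') (f x')
  have h1 : dist (φ z') x' ≤ D₁ := hD₁ _ _ (by rwa [hfφ])
  have h2 : dist x (φ z) ≤ D₂ := hD₂ _ _ (by
    rw [dist_eq_norm_vsub V] at hv ⊢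
    rw [hfφ]
    have : f x -ᵥ (v +ᵥ f z) =
        ((f x -ᵥ f x') - (f z -ᵥ f z')) - ((v +ᵥ f z') -ᵥ f x') := by
      rw [vsub_vadd_eq_vsub_sub, vadd_vsub_assoc, ← vsub_sub_vsub_cancel_right (f x) (f z) (f x'),
        ← vsub_sub_vsub_cancel_right (f z) (f z') (f x')]
      abel
    rw [this]
    exact (norm_sub_le _ _).trans (add_le_add h hv))
  have h3 := dist_triangle4 x (φ z) (φ z') x'
  rw [hφ.dist_eq] at h3
  linarith

/-- Existence of the asymptotic norm. -/
theorem exists_isAsymptoticIsometry [FiniteDimensional ℝ V] [Nonempty X] {f : X → Y}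
    {R : ℝ} (hR : ∀ y y' : Y, ∃ (φ : X → X) (v : V), Isometry φ ∧ (∀ x, f (φ x) = v +ᵥ f x) ∧
      dist (v +ᵥ y) y' ≤ R)
    (hD : ∀ r, ∃ D, ∀ x x', dist (f x) (f x') ≤ r → dist x x' ≤ D)
    (hlarge : ∃ C : ℝ, ∀ x x' : X, dist (f x) (f x') ≤ C * dist x x' + C) :
    ∃ N : Seminorm ℝ V, IsAsymptoticIsometry f N := by
  obtain ⟨x₀⟩ : Nonempty X := inferInstance
  have hdense : ∀ y, ∃ x, dist (f x) y ≤ R := fun y => by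
    obtain ⟨φ, v, -, hφ, hv⟩ := hR (f x₀) y
    exact ⟨φ x₀, by rwa [hφ]⟩
  have hs : ∀ v : V, ∃ x, ‖(f x -ᵥ f x₀) - v‖ ≤ R := fun v => by
    obtain ⟨x, hx⟩ := hdense (v +ᵥ f x₀)
    refine ⟨x, ?_⟩
    rwa [dist_eq_norm_vsub V, vsub_vadd_eq_vsub_sub] at hx
  choose s hs using hs
  have hR0 : 0 ≤ R := (norm_nonneg _).trans (hs 0)
  obtain ⟨L, hL⟩ := hlarge
  obtain ⟨C₁, hC₁⟩ := exists_dist_le_dist_add hR hD (4 * R)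
  obtain ⟨D₁, hD₁⟩ := hD (2 * R + 1)
  -- The distance between two points of `X` that `f` sets apart by `v`, up to `2 * R`. By `hC₁`
  -- another choice of such points changes it by a bounded amount; `4 * R` allows for the errors of
  -- two differences.
  let D : V → ℝ := fun v => dist (s v) (s 0)
  have hdiff : ∀ v w, ‖(f (s v) -ᵥ f (s w)) - (v - w)‖ ≤ 2 * R := fun v w => by
    have : (f (s v) -ᵥ f (s w)) - (v - w) =
        ((f (s v) -ᵥ f x₀) - v) - ((f (s w) -ᵥ f x₀) - w) := by
      rw [← vsub_sub_vsub_cancel_right (f (s v)) (f (s w)) (f x₀)]; abel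
    rw [this]
    exact (norm_sub_le _ _).trans (by linarith [hs v, hs w])
  set C := |C₁| + |D₁| + 2 * R + 1 with hC
  have hL1 : 0 < |L| + 1 := by positivity
  have hDn : IsCoarseNorm D (|L| + 1)⁻¹ C :=
    { pos := by positivity
      add_le := fun v w => by
        have h1 := hC₁ (s (v + w)) (s w) (s v) (s 0) (by
          have h1 := hdiff (v + w) w
          have h2 := hdiff v 0
          rw [add_sub_cancel_right] at h1
          rw [sub_zero] at h2
          calc _ = ‖((f (s (v + w)) -ᵥ f (s w)) - v) - ((f (s v) -ᵥ f (s 0)) - v)‖ := by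
                congr 1; abel
            _ ≤ _ := (norm_sub_le _ _).trans (by linarith))
        have h2 := dist_triangle (s (v + w)) (s w) (s 0)
        simp only [D]
        linarith [le_abs_self C₁, abs_nonneg D₁]
      neg_le := fun v => by
        have h1 := hC₁ (s (-v)) (s 0) (s 0) (s v) (by
          have h1 := hdiff (-v) 0
          have h2 := hdiff 0 v
          rw [sub_zero] at h1
          rw [zero_sub] at h2
          calc _ = ‖((f (s (-v)) -ᵥ f (s 0)) - -v) - ((f (s 0) -ᵥ f (s v)) - -v)‖ := by
                congr 1; abel
            _ ≤ _ := (norm_sub_le _ _).trans (by linarith))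
        simp only [D]
        rw [dist_comm (s 0) (s v)] at h1
        linarith [le_abs_self C₁, abs_nonneg D₁]
      le_of_norm_le := fun v hv => by
        have h1 := hD₁ (s v) (s 0) (by
          have := hdiff v 0
          rw [sub_zero] at this
          rw [dist_eq_norm_vsub V]
          have h2 := norm_add_le ((f (s v) -ᵥ f (s 0)) - v) v
          rw [sub_add_cancel] at h2
          linarith)
        simp only [D]
        linarith [le_abs_self D₁, abs_nonneg C₁]
      -- Definiteness of the stable norm is the large-scale Lipschitz property of `f`.
      ge := fun v => by
        have h1 := hL (s v) (s 0)
        have h2 := hdiff v 0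
        rw [sub_zero] at h2
        rw [dist_eq_norm_vsub V] at h1
        have h3 := norm_sub_le (f (s v) -ᵥ f (s 0)) ((f (s v) -ᵥ f (s 0)) - v)
        rw [sub_sub_cancel] at h3
        have h4 : L * dist (s v) (s 0) ≤ |L| * dist (s v) (s 0) :=
          mul_le_mul_of_nonneg_right (le_abs_self L) dist_nonneg
        have h5 : ‖v‖ ≤ (|L| + 1) * (D v + C) := by
          have e1 : (2 * R + 1) * 1 ≤ C * (|L| + 1) := by
            apply mul_le_mul <;> first | positivity | linarith [abs_nonneg C₁, abs_nonneg D₁, abs_nonneg L]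
          have e2 : 0 ≤ |L| * (|C₁| + |D₁| + 2 * R) := by positivity
          have e3 : 0 ≤ dist (s v) (s 0) := dist_nonneg
          simp only [D]
          rw [hC] at *
          nlinarith [le_abs_self L, abs_nonneg C₁, abs_nonneg D₁]
        rw [sub_le_iff_le_add, inv_mul_le_iff₀ hL1]
        exact h5 }
  have hclose : ∀ x x' : X,
      ‖(f x -ᵥ f x') - (f (s (f x -ᵥ f x')) -ᵥ f (s 0))‖ ≤ 4 * R := fun x x' => by
    have := hdiff (f x -ᵥ f x') 0
    rw [sub_zero, norm_sub_rev] at this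
    linarith
  refine ⟨hDn.stableNorm, ⟨_, hDn.pos, hDn.le_stableNorm⟩,
    ⟨_, by positivity, hDn.stableNorm_le_norm⟩, ⟨R, hdense⟩, ?_, fun ε hε => ?_⟩
  · refine ⟨C₁ + C, fun x x' => ?_⟩
    have h1 := hDn.stableNorm_le (f x -ᵥ f x')
    have h2 := hC₁ (s (f x -ᵥ f x')) (s 0) x x' (by rw [norm_sub_rev]; exact hclose x x')
    simp only [D] at h1
    linarith
  · obtain ⟨B, hB⟩ := hDn.le_stableNorm_add hε
    refine ⟨B + C₁, fun x x' => ?_⟩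
    have h1 := hB (f x -ᵥ f x')
    have h2 := hC₁ x x' (s (f x -ᵥ f x')) (s 0) (hclose x x')
    simp only [D] at h1
    linarith

omit [MetricSpace X] in
/-- Norms that are dominated on the differences `f x -ᵥ f x'`, up to `1 + ε` and a constant,
are dominated everywhere. -/
theorem seminorm_le_of_forall_vsub {f : X → Y} {N₁ N₂ : Seminorm ℝ V}
    (hdense : ∃ R, ∀ y, ∃ x, dist (f x) y ≤ R) (h₁ : ∃ M, ∀ v, N₁ v ≤ M * ‖v‖)
    (h₂ : ∃ M, ∀ v, N₂ v ≤ M * ‖v‖)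
    (h : ∀ ε > 0, ∃ C, ∀ x x', N₁ (f x -ᵥ f x') ≤ (1 + ε) * N₂ (f x -ᵥ f x') + C) (v : V) :
    N₁ v ≤ N₂ v := by
  obtain ⟨R, hR⟩ := hdense
  obtain ⟨M₁, h₁⟩ := h₁
  obtain ⟨M₂, h₂⟩ := h₂
  obtain ⟨y⟩ : Nonempty Y := inferInstance
  refine le_of_forall_pos_le_add fun ε hε => ?_
  set δ := ε / (N₂ v + 1) with hδ
  have hN : 0 < N₂ v + 1 := by have := apply_nonneg N₂ v; linarith
  have hδ0 : 0 < δ := by positivity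
  obtain ⟨C, hC⟩ := h δ hδ0
  -- Every `t • v` is within `2 * R` of a difference of values of `f`, so the inequality holds along
  -- the ray with `B` independent of `t`. A large `t` then removes `B`.
  obtain ⟨B, hB⟩ : ∃ B, ∀ t : ℝ, 0 ≤ t → t * N₁ v ≤ (1 + δ) * (t * N₂ v) + B := by
    refine ⟨|M₁| * (2 * R) + (1 + δ) * (|M₂| * (2 * R)) + C, fun t ht => ?_⟩
    obtain ⟨x, hx⟩ := hR (t • v +ᵥ y)
    obtain ⟨x', hx'⟩ := hR y
    have hd : ‖(f x -ᵥ f x') - t • v‖ ≤ 2 * R := by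
      have : (f x -ᵥ f x') - t • v = (f x -ᵥ (t • v +ᵥ y)) - (f x' -ᵥ y) := by
        rw [vsub_vadd_eq_vsub_sub, ← vsub_sub_vsub_cancel_right (f x) (f x') y]; abel
      rw [this]
      rw [dist_eq_norm_vsub V] at hx hx'
      exact (norm_sub_le _ _).trans (by linarith)
    have hM : ∀ (N : Seminorm ℝ V) (M : ℝ), (∀ v, N v ≤ M * ‖v‖) →
        N ((f x -ᵥ f x') - t • v) ≤ |M| * (2 * R) := fun N M hN =>
      (hN _).trans (by
        have := le_abs_self M
        have h0 := norm_nonneg ((f x -ᵥ f x') - t • v)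
        calc M * ‖(f x -ᵥ f x') - t • v‖ ≤ |M| * ‖(f x -ᵥ f x') - t • v‖ := by gcongr
          _ ≤ _ := by gcongr)
    have e1 := hM N₁ M₁ h₁
    have e2 := hM N₂ M₂ h₂
    have e3 := hC x x'
    have e4 : t * N₁ v ≤ N₁ (f x -ᵥ f x') + N₁ ((f x -ᵥ f x') - t • v) := by
      have := map_sub_le_add N₁ (f x -ᵥ f x') ((f x -ᵥ f x') - t • v)
      rwa [sub_sub_cancel, map_smul_eq_mul, Real.norm_of_nonneg ht] at this
    have e5 : N₂ (f x -ᵥ f x') ≤ t * N₂ v + N₂ ((f x -ᵥ f x') - t • v) := by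
      have := map_add_le_add N₂ (t • v) ((f x -ᵥ f x') - t • v)
      rwa [add_sub_cancel, map_smul_eq_mul, Real.norm_of_nonneg ht] at this
    nlinarith
  have h3 : N₁ v ≤ (1 + δ) * N₂ v := by
    by_contra! hlt
    have hd : 0 < N₁ v - (1 + δ) * N₂ v := by linarith
    have := hB ((|B| + 1) / (N₁ v - (1 + δ) * N₂ v)) (by positivity)
    have e : (|B| + 1) / (N₁ v - (1 + δ) * N₂ v) * (N₁ v - (1 + δ) * N₂ v) = |B| + 1 := by
      field_simp
    nlinarith [le_abs_self B]
  have h4 : δ * N₂ v ≤ ε := by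
    have : δ * (N₂ v + 1) = ε := by rw [hδ]; field_simp
    nlinarith
  linarith

end Coarse

/-! ### Constants at infinity as estimates with `1 + ε` and an additive constant -/

section AtInfinity

variable {A B : Type*} {dA : A → A → ℝ} {dB : B → B → ℝ} {f : A → B}

theorem one_add_ofReal {ε : ℝ} (hε : 0 ≤ ε) : (1 : ℝ≥0∞) + ENNReal.ofReal ε = ENNReal.ofReal (1 + ε) := by
  rw [ENNReal.ofReal_add zero_le_one hε, ENNReal.ofReal_one]

theorem le_one_of_forall_le_ofReal {x : ℝ≥0∞} (h : ∀ ε : ℝ, 0 < ε → x ≤ ENNReal.ofReal (1 + ε)) :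
    x ≤ 1 := by
  refine ENNReal.le_of_forall_pos_le_add fun ε hε _ => ?_
  have := h ε hε
  rwa [← one_add_ofReal (NNReal.coe_nonneg _), ENNReal.ofReal_coe_nnreal] at this

theorem lipAtInfty_le_one (h : ∀ ε > 0, ∃ C, ∀ a a', dB (f a) (f a') ≤ (1 + ε) * dA a a' + C) :
    lipAtInfty dA dB f ≤ 1 := by
  refine le_one_of_forall_le_ofReal fun ε hε => ?_
  obtain ⟨C, hC⟩ := h (ε / 2) (half_pos hε)
  refine limsup_le_of_le (h := ?_)
  rw [eventually_comap]
  filter_upwards [eventually_ge_atTop (2 * |C| / ε), eventually_gt_atTop 0] with t ht ht0 q hq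
  refine ENNReal.ofReal_le_ofReal ?_
  subst hq
  rw [div_le_iff₀ ht0]
  have := hC q.1 q.2
  rw [div_le_iff₀ hε] at ht
  nlinarith [le_abs_self C]

theorem one_le_lipAtInfty
    (h : ∀ ε > 0, ∀ K, ∃ a a', K ≤ dA a a' ∧ dA a a' ≤ (1 + ε) * dB (f a) (f a')) :
    1 ≤ lipAtInfty dA dB f := by
  by_contra! hlt
  obtain ⟨c, hc, hc1⟩ := exists_between hlt
  have hev := eventually_lt_of_limsup_lt hc
  rw [eventually_comap] at hev
  obtain ⟨K, hK⟩ := (hev.and (eventually_gt_atTop 0)).exists_forall_of_atTop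
  have hct : c ≠ ⊤ := (hc1.trans ENNReal.one_lt_top).ne
  have hcr : c.toReal < 1 := by
    rw [← ENNReal.toReal_one]
    exact (ENNReal.toReal_lt_toReal hct ENNReal.one_ne_top).2 hc1
  obtain ⟨a, a', h1, h2⟩ := h (1 - c.toReal) (by linarith) K
  have h3 := (hK _ h1).1 (a, a') rfl
  have h4 := (hK _ h1).2
  unfold dil at h3
  rw [← ENNReal.ofReal_toReal hct] at h3
  have h5 := (ENNReal.ofReal_lt_ofReal_iff'.1 h3).1
  rw [div_lt_iff₀ h4] at h5
  simp only at h5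
  have h6 : 0 ≤ c.toReal := ENNReal.toReal_nonneg
  nlinarith [mul_pos h4 (sub_pos.2 hcr)]

theorem le_of_lipAtInfty_le_one (h : lipAtInfty dA dB f ≤ 1) {ε : ℝ} (hε : 0 < ε) :
    ∃ K > 0, ∀ a a', K ≤ dA a a' → dB (f a) (f a') ≤ (1 + ε) * dA a a' := by
  have h1 : (1 : ℝ≥0∞) < ENNReal.ofReal (1 + ε) := by
    rw [← ENNReal.ofReal_one]
    exact (ENNReal.ofReal_lt_ofReal_iff (by linarith)).2 (by linarith)
  have hev := eventually_lt_of_limsup_lt (h.trans_lt h1)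
  rw [eventually_comap] at hev
  obtain ⟨K, hK⟩ := (hev.and (eventually_gt_atTop 0)).exists_forall_of_atTop
  refine ⟨max K 1, by positivity, fun a a' haa => ?_⟩
  obtain ⟨h2, h3⟩ := hK _ ((le_max_left _ _).trans haa)
  have h4 := h2 (a, a') rfl
  unfold dil at h4
  rw [ENNReal.ofReal_lt_ofReal_iff (by linarith), div_lt_iff₀ h3] at h4
  exact h4.le

theorem coLipAtInfty_le_one (h : ∀ ε > 0, ∃ C, ∀ a a', dA a a' ≤ (1 + ε) * dB (f a) (f a') + C) :
    coLipAtInfty dA dB f ≤ 1 := by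
  refine le_one_of_forall_le_ofReal fun ε hε => ?_
  obtain ⟨C, hC⟩ := h (ε / 2) (half_pos hε)
  refine limsup_le_of_le (h := ?_)
  rw [eventually_comap]
  have hlt : ENNReal.ofReal (2 * |C| / ε) < ⊤ := ENNReal.ofReal_lt_top
  filter_upwards [Ioo_mem_nhdsLT hlt, Ioo_mem_nhdsLT ENNReal.zero_lt_top] with t ht ht0 S hS
  subst hS
  obtain ⟨ht1, ht2⟩ := ht
  refine ENNReal.div_le_of_le_mul (iSup₂_le fun a ha => iSup₂_le fun a' ha' => ?_)
  obtain ⟨r, hr0, hr⟩ : ∃ r : ℝ, 0 ≤ r ∧ setDiam dB S = ENNReal.ofReal r :=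
    ⟨_, ENNReal.toReal_nonneg, (ENNReal.ofReal_toReal ht2.ne).symm⟩
  have h1 : dB (f a) (f a') ≤ r := by
    have : ENNReal.ofReal (dB (f a) (f a')) ≤ setDiam dB S :=
      (le_iSup₂ (f := fun b (_ : b ∈ S) => ENNReal.ofReal (dB (f a) b)) (f a') ha').trans
        (le_iSup₂ (f := fun b (_ : b ∈ S) => ⨆ b' ∈ S, ENNReal.ofReal (dB b b')) (f a) ha)
    rw [hr] at this
    exact (ENNReal.ofReal_le_ofReal_iff hr0).1 this
  rw [hr] at ht1 ⊢
  rw [← ENNReal.ofReal_mul (by linarith)]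
  refine ENNReal.ofReal_le_ofReal ?_
  have h2 := (ENNReal.ofReal_lt_ofReal_iff_of_nonneg (by positivity)).1 ht1
  rw [div_lt_iff₀ hε] at h2
  have := hC a a'
  nlinarith [le_abs_self C]

/-- Two-point sets suffice both to bound `coLipAtInfty` from below and to extract pointwise
estimates from a bound above: the preimage of `{f a, f a'}` contains `a` and `a'`. -/
theorem setDiam_pair (h0 : ∀ b, dB b b = 0) (hs : ∀ b b', dB b b' = dB b' b) (b b' : B) :
    setDiam dB {b, b'} = ENNReal.ofReal (dB b b') := by
  unfold setDiam
  rw [iSup_pair, iSup_pair, iSup_pair, h0, h0, hs b' b]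
  simp

theorem one_le_coLipAtInfty (h0 : ∀ b, dB b b = 0) (hs : ∀ b b', dB b b' = dB b' b)
    (h : ∀ ε > 0, ∀ K, ∃ a a', K ≤ dB (f a) (f a') ∧ dB (f a) (f a') ≤ (1 + ε) * dA a a') :
    1 ≤ coLipAtInfty dA dB f := by
  by_contra! hlt
  obtain ⟨c, hc, hc1⟩ := exists_between hlt
  have hev := eventually_lt_of_limsup_lt hc
  rw [eventually_comap, (nhdsLT_basis_of_exists_lt ⟨0, ENNReal.zero_lt_top⟩).eventually_iff] at hev
  obtain ⟨K, hK, hev⟩ := hev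
  have hct : c ≠ ⊤ := (hc1.trans ENNReal.one_lt_top).ne
  have hcr : c.toReal < 1 := by
    rw [← ENNReal.toReal_one]
    exact (ENNReal.toReal_lt_toReal hct ENNReal.one_ne_top).2 hc1
  obtain ⟨a, a', h1, h2⟩ := h (1 - c.toReal) (by linarith) (K.toReal + 1)
  have hpos : 0 < dB (f a) (f a') := by
    have : 0 ≤ K.toReal := ENNReal.toReal_nonneg
    linarith
  have h3 := @hev (ENNReal.ofReal (dB (f a) (f a')))
    ⟨(ENNReal.lt_ofReal_iff_toReal_lt hK.ne).2 (by linarith), ENNReal.ofReal_lt_top⟩ {f a, f a'}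
    (setDiam_pair h0 hs _ _)
  rw [setDiam_pair h0 hs] at h3
  have h4 : ENNReal.ofReal (dA a a') ≤ setDiam dA (f ⁻¹' {f a, f a'}) :=
    (le_iSup₂ (f := fun b (_ : b ∈ f ⁻¹' {f a, f a'}) => ENNReal.ofReal (dA a b)) a' (by simp)).trans
      (le_iSup₂ (f := fun b (_ : b ∈ f ⁻¹' {f a, f a'}) =>
        ⨆ b' ∈ f ⁻¹' {f a, f a'}, ENNReal.ofReal (dA b b')) a (by simp))
  have h5 := (ENNReal.div_le_div_right h4 _).trans_lt h3
  rw [← ENNReal.ofReal_div_of_pos hpos, ← ENNReal.ofReal_toReal hct] at h5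
  replace h5 := (ENNReal.ofReal_lt_ofReal_iff'.1 h5).1
  rw [div_lt_iff₀ hpos] at h5
  have h6 : 0 ≤ c.toReal := ENNReal.toReal_nonneg
  nlinarith [mul_pos hpos (sub_pos.2 hcr)]

theorem le_of_coLipAtInfty_le_one (h0 : ∀ b, dB b b = 0) (hs : ∀ b b', dB b b' = dB b' b)
    (h : coLipAtInfty dA dB f ≤ 1) {ε : ℝ} (hε : 0 < ε) :
    ∃ K > 0, ∀ a a', K ≤ dB (f a) (f a') → dA a a' ≤ (1 + ε) * dB (f a) (f a') := by
  have h1 : (1 : ℝ≥0∞) < ENNReal.ofReal (1 + ε) := by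
    rw [← ENNReal.ofReal_one]
    exact (ENNReal.ofReal_lt_ofReal_iff (by linarith)).2 (by linarith)
  have hev := eventually_lt_of_limsup_lt (h.trans_lt h1)
  rw [eventually_comap, (nhdsLT_basis_of_exists_lt ⟨0, ENNReal.zero_lt_top⟩).eventually_iff] at hev
  obtain ⟨K, hK, hev⟩ := hev
  have hK0 : 0 ≤ K.toReal := ENNReal.toReal_nonneg
  refine ⟨K.toReal + 1, by positivity, fun a a' haa => ?_⟩
  have hpos : 0 < dB (f a) (f a') := by linarith
  have h3 := @hev (ENNReal.ofReal (dB (f a) (f a')))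
    ⟨(ENNReal.lt_ofReal_iff_toReal_lt hK.ne).2 (by linarith), ENNReal.ofReal_lt_top⟩ {f a, f a'}
    (setDiam_pair h0 hs _ _)
  rw [setDiam_pair h0 hs] at h3
  have h4 : ENNReal.ofReal (dA a a') ≤ setDiam dA (f ⁻¹' {f a, f a'}) :=
    (le_iSup₂ (f := fun b (_ : b ∈ f ⁻¹' {f a, f a'}) => ENNReal.ofReal (dA a b)) a' (by simp)).trans
      (le_iSup₂ (f := fun b (_ : b ∈ f ⁻¹' {f a, f a'}) =>
        ⨆ b' ∈ f ⁻¹' {f a, f a'}, ENNReal.ofReal (dA b b')) a (by simp))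
  have h5 := (ENNReal.div_le_div_right h4 _).trans_lt h3
  rw [← ENNReal.ofReal_div_of_pos hpos, ENNReal.ofReal_lt_ofReal_iff (by linarith),
    div_lt_iff₀ hpos] at h5
  exact h5.le

end AtInfinity

/-! ### Seminorms against the ambient norm -/

section FiniteDimensional

variable {V : Type*} [NormedAddCommGroup V] [NormedSpace ℝ V] [FiniteDimensional ℝ V]

theorem Seminorm.continuous_of_finiteDimensional (N : Seminorm ℝ V) : Continuous N :=
  (N.convexOn.locallyLipschitz).continuous

theorem Seminorm.exists_le_norm (N : Seminorm ℝ V) : ∃ M, 0 ≤ M ∧ ∀ v, N v ≤ M * ‖v‖ := by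
  obtain ⟨M, hM, h⟩ := Seminorm.bound_of_continuous_normedSpace N N.continuous_of_finiteDimensional
  exact ⟨M, hM.le, h⟩

theorem Seminorm.exists_norm_le (N : Seminorm ℝ V) (hN : ∀ v, N v = 0 → v = 0) :
    ∃ c > 0, ∀ v, c * ‖v‖ ≤ N v := by
  have : ProperSpace V := FiniteDimensional.proper_real V
  rcases subsingleton_or_nontrivial V with hV | hV
  · exact ⟨1, one_pos, fun v => by simp [Subsingleton.elim v 0]⟩
  obtain ⟨u, hu, hmin⟩ := (isCompact_sphere (0 : V) 1).exists_isMinOn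
    (NormedSpace.sphere_nonempty.2 zero_le_one) N.continuous_of_finiteDimensional.continuousOn
  have hu1 : ‖u‖ = 1 := by simpa using hu
  refine ⟨N u, lt_of_le_of_ne (apply_nonneg N u) fun h => ?_, fun v => ?_⟩
  · rw [hN u h.symm, norm_zero] at hu1
    exact zero_ne_one hu1
  · rcases eq_or_ne v 0 with rfl | hv
    · simp
    have hv0 : 0 < ‖v‖ := norm_pos_iff.2 hv
    have h1 : N u ≤ N (‖v‖⁻¹ • v) := hmin (by simp [norm_smul, hv0.ne'])
    rw [map_smul_eq_mul, norm_inv, norm_norm, inv_mul_eq_div, le_div_iff₀ hv0] at h1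
    exact h1

end FiniteDimensional

/-! ### Existence, uniqueness and invariance of the Federer–Whitney norm -/

section FedererWhitney

variable {X V Y : Type*} [MetricSpace X] [NormedAddCommGroup V] [NormedSpace ℝ V]
  [MetricSpace Y] [NormedAddTorsor V Y]

theorem normDist_self (N : Seminorm ℝ V) (y : Y) : normDist N y y = 0 := by
  simp [normDist]

theorem normDist_comm (N : Seminorm ℝ V) (y y' : Y) : normDist N y y' = normDist N y' y := by
  rw [normDist, ← neg_vsub_eq_vsub_rev, map_neg_eq_map, normDist]

namespace IsAsymptoticIsometry

variable {f : X → Y} {N : Seminorm ℝ V}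

/-- A coarse section of `f`. -/
theorem exists_section (hf : IsAsymptoticIsometry f N) (o : Y) :
    ∃ (s : V → X) (C : ℝ), 0 ≤ C ∧ (∀ v, ‖(f (s v) -ᵥ o) - v‖ ≤ C) ∧
      ∀ v w, N ((f (s v) -ᵥ f (s w)) - (v - w)) ≤ C := by
  obtain ⟨R, hR⟩ := hf.dense
  obtain ⟨M, hM0, hM⟩ := hf.le_norm
  choose s hs using fun v : V => hR (v +ᵥ o)
  have hR0 : 0 ≤ R := dist_nonneg.trans (hs 0)
  have h1 : ∀ v, ‖(f (s v) -ᵥ o) - v‖ ≤ R := fun v => by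
    have := hs v
    rwa [dist_eq_norm_vsub V, vsub_vadd_eq_vsub_sub] at this
  refine ⟨s, R + M * (2 * R), by positivity, fun v => (h1 v).trans (by nlinarith), fun v w => ?_⟩
  refine (hM _).trans ((mul_le_mul_of_nonneg_left ?_ hM0).trans (le_add_of_nonneg_left hR0))
  have : (f (s v) -ᵥ f (s w)) - (v - w) = ((f (s v) -ᵥ o) - v) - ((f (s w) -ᵥ o) - w) := by
    rw [← vsub_sub_vsub_cancel_right (f (s v)) (f (s w)) o]; abel
  rw [this]
  exact (norm_sub_le _ _).trans (by linarith [h1 v, h1 w])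

/-- There are pairs of points of `X` at an arbitrarily large distance along each direction. -/
theorem exists_far [Nontrivial V] (hf : IsAsymptoticIsometry f N) (K : ℝ) :
    ∃ x x', K ≤ N (f x -ᵥ f x') := by
  obtain ⟨y⟩ : Nonempty Y := inferInstance
  obtain ⟨s, C, -, -, hs⟩ := hf.exists_section y
  obtain ⟨c, hc, hcN⟩ := hf.definite
  obtain ⟨v, hv⟩ := exists_ne (0 : V)
  have hNv : 0 < N v := (mul_pos hc (norm_pos_iff.2 hv)).trans_le (hcN v)
  set t := (|K| + |C|) / N v with ht
  refine ⟨s (t • v), s 0, ?_⟩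
  have h1 := hs (t • v) 0
  have h2 := map_sub_le_add N (f (s (t • v)) -ᵥ f (s 0)) ((f (s (t • v)) -ᵥ f (s 0)) - (t • v - 0))
  rw [sub_sub_cancel, sub_zero, map_smul_eq_mul, Real.norm_of_nonneg (by positivity)] at h2
  have h3 : t * N v = |K| + |C| := by rw [ht]; field_simp
  rw [sub_zero] at h1
  linarith [le_abs_self K, le_abs_self C]

/-- `upper` and `lower` give the bounds by 1 for `Lip_∞` and `coLip_∞` respectively. For the
converse bounds their roles are exchanged, on pairs so far apart that the additive constants are
absorbed by `ε`; such pairs exist because `V` is nontrivial. -/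
theorem isFedererWhitney [Nontrivial V] (hf : IsAsymptoticIsometry f N) :
    IsFedererWhitney f N := by
  obtain ⟨c, hc, hcN⟩ := hf.definite
  obtain ⟨M, hM0, hM⟩ := hf.le_norm
  obtain ⟨C, hC⟩ := hf.upper
  refine ⟨fun v hv => ?_, ?_, le_antisymm ?_ ?_, le_antisymm ?_ ?_⟩
  · have := hcN v
    rw [hv] at this
    by_contra hne
    have := mul_pos hc (norm_pos_iff.2 hne)
    linarith
  · obtain ⟨R, hR⟩ := hf.dense
    refine ⟨M * R, fun r hr y => ?_⟩
    obtain ⟨x, hx⟩ := hR y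
    refine ⟨x, le_trans (hM _) (le_trans ?_ hr)⟩
    rw [← dist_eq_norm_vsub V]
    gcongr
  · refine lipAtInfty_le_one fun ε hε => ⟨C, fun x x' => (hC x x').trans ?_⟩
    nlinarith [dist_nonneg (x := x) (y := x')]
  · refine one_le_lipAtInfty fun ε hε K => ?_
    obtain ⟨B, hB⟩ := hf.lower (ε / 2) (half_pos hε)
    obtain ⟨x, x', h⟩ := hf.exists_far (max (K + C) (2 * |B| / ε))
    have h1 := (le_max_left _ _).trans h
    have h2 := (le_max_right _ _).trans h
    rw [div_le_iff₀ hε] at h2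
    refine ⟨x, x', by linarith [hC x x'], (hB x x').trans ?_⟩
    simp only [normDist]
    nlinarith [le_abs_self B]
  · exact coLipAtInfty_le_one fun ε hε => hf.lower ε hε
  · refine one_le_coLipAtInfty (normDist_self N) (normDist_comm N) fun ε hε K => ?_
    obtain ⟨x, x', h⟩ := hf.exists_far (max K ((1 + ε) * |C| / ε))
    have h1 := (le_max_left _ _).trans h
    have h2 := (le_max_right _ _).trans h
    rw [div_le_iff₀ hε] at h2
    refine ⟨x, x', h1, ?_⟩
    have h3 := hC x x'
    simp only [normDist]
    nlinarith [le_abs_self C]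

/-- Uniqueness of the Federer-Whitney norm. -/
theorem eq_of_isFedererWhitney [FiniteDimensional ℝ V] (hf : IsAsymptoticIsometry f N)
    {N' : Seminorm ℝ V} (h : IsFedererWhitney f N') : N' = N := by
  obtain ⟨c, hc, hcN⟩ := hf.definite
  obtain ⟨M, hM0, hM⟩ := hf.le_norm
  obtain ⟨C, hC⟩ := hf.upper
  obtain ⟨hdef, -, hlip, hcolip⟩ := h
  obtain ⟨M', hM'0, hM'⟩ := N'.exists_le_norm
  obtain ⟨c', hc', hcN'⟩ := N'.exists_norm_le hdef
  refine le_antisymm (fun v => ?_) (fun v => ?_)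
  -- `N' ≤ N`: at distances above `K` the bound on `Lip_∞` is composed with `lower`; below `K`,
  -- `upper` bounds `f x -ᵥ f x'` and hence its `N'`.
  · refine seminorm_le_of_forall_vsub hf.dense ⟨M', hM'⟩ ⟨M, hM⟩ (fun ε hε => ?_) v
    obtain ⟨δ, hδ, hδε⟩ : ∃ δ > 0, (1 + δ) * (1 + δ) ≤ 1 + ε := by
      refine ⟨min 1 (ε / 3), by positivity, ?_⟩
      have h1 := min_le_left 1 (ε / 3)
      have h2 := min_le_right 1 (ε / 3)
      have h3 : 0 < min 1 (ε / 3) := by positivity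
      nlinarith
    obtain ⟨K, hK, hK'⟩ := le_of_lipAtInfty_le_one hlip.le hδ
    obtain ⟨B, hB⟩ := hf.lower δ hδ
    refine ⟨M' / c * (K + |C|) + (1 + δ) * |B|, fun x x' => ?_⟩
    have hN0 := apply_nonneg N (f x -ᵥ f x')
    rcases le_total K (dist x x') with hd | hd
    · have h1 := hK' _ _ hd
      have h2 := hB x x'
      simp only [normDist] at h1
      have h3 : 0 ≤ M' / c * (K + |C|) := by positivity
      nlinarith [le_abs_self B, mul_le_mul_of_nonneg_right hδε hN0]
    · have h1 := hC x x'
      have h2 := hM' (f x -ᵥ f x')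
      have h3 := hcN (f x -ᵥ f x')
      have h4 : ‖f x -ᵥ f x'‖ ≤ (K + |C|) / c := by
        rw [le_div_iff₀ hc]
        linarith [le_abs_self C]
      have h5 : M' * ‖f x -ᵥ f x'‖ ≤ M' / c * (K + |C|) := by
        calc _ ≤ M' * ((K + |C|) / c) := by gcongr
          _ = _ := by ring
      have h6 : 0 ≤ (1 + δ) * |B| := by positivity
      nlinarith
  -- `N ≤ N'`: the bound on `coLip_∞` is composed with `upper`, and the small values to be treated
  -- apart are those of `N'`.
  · refine seminorm_le_of_forall_vsub hf.dense ⟨M, hM⟩ ⟨M', hM'⟩ (fun ε hε => ?_) v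
    obtain ⟨K, hK, hK'⟩ := le_of_coLipAtInfty_le_one (normDist_self N') (normDist_comm N')
      hcolip.le hε
    refine ⟨M / c' * K + |C|, fun x x' => ?_⟩
    have hN0 := apply_nonneg N' (f x -ᵥ f x')
    rcases le_total K (N' (f x -ᵥ f x')) with hd | hd
    · have h1 := hK' x x' hd
      have h2 := hC x x'
      simp only [normDist] at h1
      have h3 : 0 ≤ M / c' * K := by positivity
      linarith [le_abs_self C]
    · have h2 := hM (f x -ᵥ f x')
      have h3 := hcN' (f x -ᵥ f x')
      have h4 : ‖f x -ᵥ f x'‖ ≤ K / c' := by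
        rw [le_div_iff₀ hc']
        linarith
      have h5 : M * ‖f x -ᵥ f x'‖ ≤ M / c' * K := by
        calc _ ≤ M * (K / c') := by gcongr
          _ = _ := by ring
      nlinarith [abs_nonneg C]

/-- Invariance of the Federer-Whitney norm under the linear parts of the symmetries of `f`. -/
theorem seminorm_comp_le (hf : IsAsymptoticIsometry f N) {φ : X → X} (hφ : Isometry φ)
    (T : V →ₗ[ℝ] V) (hT : ∃ M, ∀ v, ‖T v‖ ≤ M * ‖v‖)
    (hfφ : ∀ x x', f (φ x) -ᵥ f (φ x') = T (f x -ᵥ f x')) (v : V) : N (T v) ≤ N v := by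
  obtain ⟨M, hM0, hM⟩ := hf.le_norm
  obtain ⟨L, hL⟩ := hT
  obtain ⟨C, hC⟩ := hf.upper
  refine seminorm_le_of_forall_vsub (N₁ := N.comp T) hf.dense ⟨M * L, fun v => ?_⟩ ⟨M, hM⟩
    (fun ε hε => ?_) v
  · rw [Seminorm.comp_apply, mul_assoc]
    exact (hM _).trans (mul_le_mul_of_nonneg_left (hL v) hM0)
  · obtain ⟨B, hB⟩ := hf.lower ε hε
    refine ⟨B + C, fun x x' => ?_⟩
    rw [Seminorm.comp_apply, ← hfφ]
    have := hC (φ x) (φ x')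
    rw [hφ.dist_eq] at this
    linarith [hB x x']

end IsAsymptoticIsometry

end FedererWhitney

/-! ### The Lipschitz constant -/

section LipConst

variable {A B : Type*} {dA : A → A → ℝ} {dB : B → B → ℝ} {f : A → B}

theorem le_lipConst {a a' : A} (h : a ≠ a') :
    ENNReal.ofReal (dB (f a) (f a') / dA a a') ≤ lipConst dA dB f :=
  le_iSup_of_le a (le_iSup_of_le a' (le_iSup_of_le h le_rfl))

theorem lipConst_le {L : ℝ} (hA : ∀ a a', a ≠ a' → 0 < dA a a')
    (h : ∀ a a', dB (f a) (f a') ≤ L * dA a a') : lipConst dA dB f ≤ ENNReal.ofReal L :=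
  iSup_le fun a => iSup_le fun a' => iSup_le fun haa => ENNReal.ofReal_le_ofReal
    ((div_le_iff₀ (hA a a' haa)).2 (h a a'))

theorem le_lipConst_mul (hA : ∀ a a', a ≠ a' → 0 < dA a a') (hA0 : ∀ a, dA a a = 0)
    (hB : ∀ b, dB b b = 0) (h : lipConst dA dB f ≠ ⊤) (a a' : A) :
    dB (f a) (f a') ≤ (lipConst dA dB f).toReal * dA a a' := by
  rcases eq_or_ne a a' with rfl | haa
  · rw [hB, hA0, mul_zero]
  · have := le_lipConst (dA := dA) (dB := dB) (f := f) haa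
    rw [← div_le_iff₀ (hA a a' haa)]
    exact (ENNReal.ofReal_le_iff_le_toReal h).1 this

end LipConst

/-! ### Partitions of unity in Euclidean spaces and uniqueness of John's form -/

section EuclideanForm

open scoped RealInnerProductSpace

variable {V : Type*} [NormedAddCommGroup V] [NormedSpace ℝ V] {n : ℕ}

/-- The quadratic form pulled back from the standard Euclidean space. -/
noncomputable def euclideanForm (e : V ≃L[ℝ] EuclideanSpace ℝ (Fin n)) : QuadraticForm ℝ V :=
  (LinearMap.BilinMap.toQuadraticMap (innerₗ (EuclideanSpace ℝ (Fin n)))).comp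
    (e.toLinearEquiv : V →ₗ[ℝ] EuclideanSpace ℝ (Fin n))

variable (e : V ≃L[ℝ] EuclideanSpace ℝ (Fin n))

theorem euclideanForm_apply (v : V) : euclideanForm e v = ‖e v‖ ^ 2 := by
  rw [← real_inner_self_eq_norm_sq]
  rfl

theorem formNorm_euclideanForm (v : V) : formNorm (euclideanForm e) v = ‖e v‖ := by
  rw [formNorm, euclideanForm_apply, Real.sqrt_sq (norm_nonneg _)]

theorem euclideanForm_posDef : (euclideanForm e).PosDef := fun v hv => by
  rw [euclideanForm_apply]
  have : e v ≠ 0 := by simpa using hv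
  positivity

/-- Sylvester's diagonalization has weights in `{1, 0, -1}`, and positivity leaves only 1. Every
positive definite form can thus be handled through an isomorphism `e`. -/
theorem exists_eq_euclideanForm [FiniteDimensional ℝ V] {h : QuadraticForm ℝ V} (hh : h.PosDef) :
    ∃ e : V ≃L[ℝ] EuclideanSpace ℝ (Fin (Module.finrank ℝ V)), h = euclideanForm e := by
  obtain ⟨w, hw, ⟨φ⟩⟩ := QuadraticForm.equivalent_one_zero_neg_one_weighted_sum_squared h
  have hw1 : ∀ i, w i = 1 := fun i => by
    have h1 := φ.symm.map_app (Pi.single i 1)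
    have h2 : 0 < h (φ.symm (Pi.single i 1)) := hh _ (by
      intro h0
      have h3 : (Pi.single i 1 : Fin (Module.finrank ℝ V) → ℝ) = 0 := by
        rw [← φ.apply_symm_apply (Pi.single i 1)]
        rw [h0]
        exact φ.toLinearEquiv.map_zero
      have := congrFun h3 i
      simp at this)
    rw [h1, QuadraticMap.weightedSumSquares_apply] at h2
    simp [Pi.single_apply] at h2
    rcases hw i with h | h | h <;> rw [h] at h2 ⊢ <;> norm_num at h2
  refine ⟨(φ.toLinearEquiv.trans (WithLp.linearEquiv 2 ℝ _).symm).toContinuousLinearEquiv, ?_⟩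
  ext v
  rw [euclideanForm_apply, EuclideanSpace.norm_sq_eq, ← φ.map_app v,
    QuadraticMap.weightedSumSquares_apply]
  refine Finset.sum_congr rfl fun i _ => ?_
  rw [hw1, one_smul, Real.norm_eq_abs, sq_abs, sq]
  rfl

/-- The standard distance of a Euclidean form. -/
theorem normDist_formNorm_euclideanForm (v w : V) :
    normDist (formNorm (euclideanForm e)) v w = ‖e v - e w‖ := by
  rw [normDist, formNorm_euclideanForm, vsub_eq_sub, map_sub]

namespace AxialProjector

variable {e}

theorem norm_vec (p : AxialProjector (formNorm (euclideanForm e))) : ‖e p.vec‖ = 1 := by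
  rw [← formNorm_euclideanForm]; exact p.2.1

theorem form_vec (p : AxialProjector (formNorm (euclideanForm e))) : p.form p.vec = 1 := p.2.2.1

theorem abs_form_le (p : AxialProjector (formNorm (euclideanForm e))) (y : V) :
    |p.form y| ≤ ‖e y‖ := by
  rw [← formNorm_euclideanForm]; exact p.2.2.2 y

/-- Axial projectors in a Euclidean space are orthogonal. -/
theorem form_eq_inner (p : AxialProjector (formNorm (euclideanForm e))) (y : V) :
    p.form y = ⟪e p.vec, e y⟫ := by
  set z := e p.vec with hz
  set w := y - ⟪z, e y⟫ • p.vec with hw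
  have hzz : ⟪z, z⟫ = 1 := by rw [real_inner_self_eq_norm_sq, hz, p.norm_vec, one_pow]
  have hzw : ⟪z, e w⟫ = 0 := by
    rw [hw, map_sub, map_smul, ← hz, inner_sub_right, inner_smul_right, hzz]; ring
  have hlw : p.form w = p.form y - ⟪z, e y⟫ := by
    rw [hw, map_sub, map_smul, p.form_vec, smul_eq_mul, mul_one]
  have key : ∀ t : ℝ, (p.form w + t) ^ 2 ≤ ‖e w‖ ^ 2 + t ^ 2 := fun t => by
    have h1 := p.abs_form_le (w + t • p.vec)
    rw [map_add, map_smul, p.form_vec, smul_eq_mul, mul_one, map_add, map_smul, ← hz] at h1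
    have h2 : ‖e w + t • z‖ ^ 2 = ‖e w‖ ^ 2 + t ^ 2 := by
      rw [norm_add_sq_real, inner_smul_right, real_inner_comm, hzw, norm_smul, hz, p.norm_vec,
        Real.norm_eq_abs, mul_one, sq_abs]; ring
    rw [← h2, ← sq_abs]
    gcongr
  have h0 : p.form w = 0 := by
    by_contra hne
    -- The terms `t ^ 2` cancel in `key`, leaving `l(w)² + 2 t l(w) ≤ ‖e w‖²` for all `t`. This `t`
    -- makes the linear term equal to the right side.
    have h1 := key (‖e w‖ ^ 2 / (2 * p.form w))
    have h2 : 2 * p.form w * (‖e w‖ ^ 2 / (2 * p.form w)) = ‖e w‖ ^ 2 := by field_simp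
    have : 0 < p.form w ^ 2 := by positivity
    nlinarith
  rw [h0] at hlw
  linarith

theorem continuous_vec {N : V → ℝ} : Continuous (vec : AxialProjector N → V) :=
  continuous_fst.comp continuous_subtype_val

theorem continuous_form {N : V → ℝ} : Continuous (form : AxialProjector N → (V →L[ℝ] ℝ)) :=
  continuous_snd.comp continuous_subtype_val

variable (e) in
/-- The orthogonal projector on the axis of a unit vector. -/
noncomputable def ofUnit (z : EuclideanSpace ℝ (Fin n)) (hz : ‖z‖ = 1) :
    AxialProjector (formNorm (euclideanForm e)) :=
  ⟨(e.symm z, (innerSL ℝ z).comp (e : V →L[ℝ] EuclideanSpace ℝ (Fin n))),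
    by simp [formNorm_euclideanForm, hz],
    by simp [hz], fun y => by
      rw [formNorm_euclideanForm]
      simpa [hz] using abs_real_inner_le_norm z (e y)⟩

theorem ofUnit_vec (z : EuclideanSpace ℝ (Fin n)) (hz : ‖z‖ = 1) :
    (ofUnit e z hz).vec = e.symm z := rfl

theorem ofUnit_form (z : EuclideanSpace ℝ (Fin n)) (hz : ‖z‖ = 1) (y : V) :
    (ofUnit e z hz).form y = ⟪z, e y⟫ := rfl

end AxialProjector

variable {e}

/-- The trace formula of a partition of unity. -/
theorem IsPartitionOfUnity.integral_inner [FiniteDimensional ℝ V]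
    {μ : Measure (AxialProjector (formNorm (euclideanForm e)))} (hμ : IsPartitionOfUnity μ)
    (T : EuclideanSpace ℝ (Fin n) →L[ℝ] EuclideanSpace ℝ (Fin n)) :
    Integrable (fun p => ⟪e p.vec, T (e p.vec)⟫) μ ∧
      ∫ p, ⟪e p.vec, T (e p.vec)⟫ ∂μ = LinearMap.trace ℝ _ (T : EuclideanSpace ℝ (Fin n) →ₗ[ℝ] EuclideanSpace ℝ (Fin n)) := by
  have : CompleteSpace V := FiniteDimensional.complete ℝ V
  let b := EuclideanSpace.basisFun (Fin n) ℝ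
  have h1 : ∀ i, Integrable (fun p : AxialProjector (formNorm (euclideanForm e)) =>
      ⟪e p.vec, b i⟫ * ⟪b i, T (e p.vec)⟫) μ ∧
      ∫ p : AxialProjector (formNorm (euclideanForm e)),
        ⟪e p.vec, b i⟫ * ⟪b i, T (e p.vec)⟫ ∂μ = ⟪b i, T (b i)⟫ := fun i => by
    obtain ⟨hi, he⟩ := hμ (e.symm (b i))
    let L : V →L[ℝ] ℝ := (innerSL ℝ (b i)).comp (T.comp (e : V →L[ℝ] EuclideanSpace ℝ (Fin n)))
    have hL : (fun p : AxialProjector (formNorm (euclideanForm e)) =>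
        ⟪e p.vec, b i⟫ * ⟪b i, T (e p.vec)⟫) = fun p => L (p.form (e.symm (b i)) • p.vec) := by
      ext p
      simp [L, AxialProjector.form_eq_inner]
    rw [hL]
    refine ⟨L.integrable_comp hi, ?_⟩
    rw [L.integral_comp_comm hi, he]
    simp [L]
  have h2 : (fun p : AxialProjector (formNorm (euclideanForm e)) => ⟪e p.vec, T (e p.vec)⟫) =
      fun p => ∑ i, ⟪e p.vec, b i⟫ * ⟪b i, T (e p.vec)⟫ := by
    ext p
    rw [b.sum_inner_mul_inner]
  rw [h2]
  refine ⟨integrable_finsetSum _ fun i _ => (h1 i).1, ?_⟩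
  rw [integral_finsetSum _ fun i _ => (h1 i).1, LinearMap.trace_eq_sum_inner _ b]
  exact Finset.sum_congr rfl fun i _ => (h1 i).2

/-- The trace formula for `T = id`, as the axes are spanned by unit vectors. Finiteness of `μ` comes
from the integrability of the constant 1. -/
theorem IsPartitionOfUnity.measure_univ [FiniteDimensional ℝ V]
    {μ : Measure (AxialProjector (formNorm (euclideanForm e)))} (hμ : IsPartitionOfUnity μ) :
    μ Set.univ = n := by
  obtain ⟨h1, h2⟩ := hμ.integral_inner (ContinuousLinearMap.id ℝ _)
  have h3 : ∀ p : AxialProjector (formNorm (euclideanForm e)),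
      ⟪e p.vec, ContinuousLinearMap.id ℝ _ (e p.vec)⟫ = 1 := fun p => by
    rw [ContinuousLinearMap.id_apply, real_inner_self_eq_norm_sq, p.norm_vec, one_pow]
  simp only [h3] at h1 h2
  have hfin : IsFiniteMeasure μ := by
    rcases integrable_const_iff.1 h1 with h | h
    · exact absurd h one_ne_zero
    · exact h
  rw [integral_const, smul_eq_mul, mul_one, measureReal_def] at h2
  have h4 : LinearMap.trace ℝ (EuclideanSpace ℝ (Fin n))
      (ContinuousLinearMap.id ℝ (EuclideanSpace ℝ (Fin n)) :
        EuclideanSpace ℝ (Fin n) →ₗ[ℝ] EuclideanSpace ℝ (Fin n)) = n := by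
    rw [ContinuousLinearMap.coe_id, LinearMap.trace_id, finrank_euclideanSpace_fin]
  rw [h4] at h2
  rw [← ENNReal.ofReal_toReal (measure_ne_top μ Set.univ), h2, ENNReal.ofReal_natCast]

/-- A discrete partition of unity. -/
theorem isPartitionOfUnity_sum_dirac {ι : Type*} [Fintype ι] {z : ι → EuclideanSpace ℝ (Fin n)}
    (hz : ∀ i, ‖z i‖ = 1) {c : ι → ℝ} (hc : ∀ i, 0 ≤ c i)
    (h : ∀ w, ∑ i, (c i * ⟪z i, w⟫) • z i = w) [FiniteDimensional ℝ V] :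
    IsPartitionOfUnity (∑ i, ENNReal.ofReal (c i) •
      Measure.dirac (AxialProjector.ofUnit e (z i) (hz i))) := by
  have : CompleteSpace V := FiniteDimensional.complete ℝ V
  intro y
  have hm : StronglyMeasurable (fun p : AxialProjector (formNorm (euclideanForm e)) =>
      p.form y • p.vec) := by
    have : Continuous (fun p : AxialProjector (formNorm (euclideanForm e)) => p.form y • p.vec) :=
      (AxialProjector.continuous_form.clm_apply continuous_const).smul AxialProjector.continuous_vec
    exact this.stronglyMeasurable
  have hi : ∀ i ∈ Finset.univ, Integrable (fun p => p.form y • p.vec) (ENNReal.ofReal (c i) •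
      Measure.dirac (AxialProjector.ofUnit e (z i) (hz i))) := fun i _ =>
    (integrable_dirac' hm (by simp)).smul_measure ENNReal.ofReal_ne_top
  refine ⟨integrable_finsetSum_measure.2 hi, ?_⟩
  rw [integral_finsetSum_measure hi]
  apply e.injective
  rw [map_sum]
  conv_rhs => rw [← h (e y)]
  refine Finset.sum_congr rfl fun i _ => ?_
  rw [integral_smul_measure, integral_dirac' _ _ hm, ENNReal.toReal_ofReal (hc i),
    AxialProjector.ofUnit_form, AxialProjector.ofUnit_vec, smul_smul, map_smul,
    e.apply_symm_apply]

variable (e) in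
theorem exists_isPartitionOfUnity [FiniteDimensional ℝ V] :
    ∃ μ : Measure (AxialProjector (formNorm (euclideanForm e))), IsPartitionOfUnity μ := by
  let b := EuclideanSpace.basisFun (Fin n) ℝ
  refine ⟨_, isPartitionOfUnity_sum_dirac (z := b) (fun i => b.norm_eq_one i) (c := fun _ => 1)
    (fun _ => zero_le_one) fun w => ?_⟩
  simp only [one_mul]
  exact b.sum_repr' w

theorem lintegral_sq_le_of_ae_le_one [FiniteDimensional ℝ V]
    {μ : Measure (AxialProjector (formNorm (euclideanForm e)))} (hμ : IsPartitionOfUnity μ)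
    {g : AxialProjector (formNorm (euclideanForm e)) → ℝ≥0∞} (hg : ∀ᵐ p ∂μ, g p ≤ 1) :
    (∫⁻ p, g p ^ 2 ∂μ) ^ (1 / 2 : ℝ) ≤ (n : ℝ≥0∞) ^ (1 / 2 : ℝ) := by
  refine ENNReal.rpow_le_rpow ?_ (by norm_num)
  calc ∫⁻ p, g p ^ 2 ∂μ ≤ ∫⁻ _, 1 ∂μ :=
        lintegral_mono_ae (hg.mono fun p hp => pow_le_one₀ (zero_le) hp)
    _ = n := by rw [lintegral_one, hμ.measure_univ]

/-- The forms of axial projectors are 1-Lipschitz for norms that they do not exceed. -/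
theorem lipConst_form_le_one {N : V → ℝ} (hN : ∀ v, v ≠ 0 → 0 < N v) {l : V →L[ℝ] ℝ}
    (hl : ∀ v, |l v| ≤ N v) : lipConst (normDist N) dist (fun a => l (id a)) ≤ 1 := by
  rw [← ENNReal.ofReal_one]
  refine lipConst_le (fun a a' h => hN _ (vsub_ne_zero.2 h)) fun a a' => ?_
  rw [Real.dist_eq, one_mul, id, id, ← map_sub]
  exact hl _

theorem formNorm_euclideanForm_pos (e : V ≃L[ℝ] EuclideanSpace ℝ (Fin n)) (v : V) (hv : v ≠ 0) :
    0 < formNorm (euclideanForm e) v := by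
  rw [formNorm_euclideanForm]
  exact norm_pos_iff.2 (by simpa using hv)

/-- The lower bound of the dilation of the identity by a trace. -/
theorem trace_le_minDilL2 [FiniteDimensional ℝ V] {N : V → ℝ} (hN : ∀ v, v ≠ 0 → 0 < N v)
    {e' : V ≃L[ℝ] EuclideanSpace ℝ (Fin n)} (hNe : ∀ v, N v ≤ ‖e' v‖)
    {B : EuclideanSpace ℝ (Fin n) →L[ℝ] EuclideanSpace ℝ (Fin n)} (hB : ∀ v, B (e' v) = e v) :
    ENNReal.ofReal (LinearMap.trace ℝ _ (B ∘L B.adjoint :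
      EuclideanSpace ℝ (Fin n) →ₗ[ℝ] EuclideanSpace ℝ (Fin n))) ^ (1 / 2 : ℝ) ≤
      minDilL2 (normDist N) (formNorm (euclideanForm e)) (id : V → V) := by
  refine le_iInf₂ fun μ hμ => ENNReal.rpow_le_rpow ?_ (by norm_num)
  obtain ⟨h1, h2⟩ := hμ.integral_inner (B ∘L B.adjoint)
  have h3 : ∀ p : AxialProjector (formNorm (euclideanForm e)),
      ⟪e p.vec, (B ∘L B.adjoint) (e p.vec)⟫ = ‖B.adjoint (e p.vec)‖ ^ 2 := fun p => by
    rw [ContinuousLinearMap.comp_apply, ← ContinuousLinearMap.adjoint_inner_left,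
      real_inner_self_eq_norm_sq]
  rw [← h2, ofReal_integral_eq_lintegral_ofReal h1 (Eventually.of_forall fun p => by
    simp only [h3]; positivity)]
  refine lintegral_mono fun p => ?_
  simp only [h3]
  rw [ENNReal.ofReal_pow (norm_nonneg _)]
  gcongr
  -- Evaluate the dilation at `v = e'⁻¹ (B* u)`: the form takes the value `⟪u, B B* u⟫ = ‖B* u‖²`,
  -- while `N v ≤ ‖B* u‖`. Hence the Lipschitz constant is at least `‖B* u‖`, whose square
  -- integrates to `tr (B B*)`.
  set x := B.adjoint (e p.vec) with hx
  rcases eq_or_ne x 0 with h0 | h0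
  · rw [h0, norm_zero, ENNReal.ofReal_zero]; exact zero_le
  have hv : e'.symm x ≠ 0 := by simpa using h0
  refine le_trans ?_ (le_lipConst hv)
  refine ENNReal.ofReal_le_ofReal ?_
  rw [Real.dist_eq, id, id, map_zero, sub_zero, p.form_eq_inner, ← hB (e'.symm x),
    e'.apply_symm_apply,
    ← ContinuousLinearMap.adjoint_inner_left, ← hx, real_inner_self_eq_norm_sq,
    abs_of_nonneg (by positivity), le_div_iff₀ (by
      simp only [normDist, vsub_eq_sub, sub_zero]; exact hN _ hv), sq]
  gcongr
  have := hNe (e'.symm x)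
  simpa [normDist] using this

/-- The minimal dilation of the identity of a Euclidean space. -/
theorem minDilL2_id [FiniteDimensional ℝ V] :
    minDilL2 (normDist (formNorm (euclideanForm e))) (formNorm (euclideanForm e)) (id : V → V) =
      (n : ℝ≥0∞) ^ (1 / 2 : ℝ) := by
  refine le_antisymm ?_ ?_
  · obtain ⟨μ, hμ⟩ := exists_isPartitionOfUnity e
    refine iInf₂_le_of_le μ hμ (lintegral_sq_le_of_ae_le_one hμ (Eventually.of_forall fun p => ?_))
    exact lipConst_form_le_one (formNorm_euclideanForm_pos e) p.2.2.2
  · have := trace_le_minDilL2 (e := e) (e' := e) (formNorm_euclideanForm_pos e)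
      (fun v => (formNorm_euclideanForm e v).le) (B := ContinuousLinearMap.id ℝ _) (fun v => rfl)
    refine le_trans (le_of_eq ?_) this
    congr 1
    have h4 : LinearMap.trace ℝ (EuclideanSpace ℝ (Fin n))
        (ContinuousLinearMap.id ℝ (EuclideanSpace ℝ (Fin n)) :
        EuclideanSpace ℝ (Fin n) →ₗ[ℝ] EuclideanSpace ℝ (Fin n)) = n := by
      rw [ContinuousLinearMap.coe_id, LinearMap.trace_id, finrank_euclideanSpace_fin]
    rw [ContinuousLinearMap.adjoint_id, ContinuousLinearMap.id_comp, h4, ENNReal.ofReal_natCast]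

/-- Almost every form is 1-Lipschitz for `N`, and the total mass is `n`, so the dilation is at most
`√n`, that of the identity of the Euclidean space. -/
theorem isJohnForm_of_isPartitionOfUnity [FiniteDimensional ℝ V] {N : V → ℝ}
    (hN : ∀ v, v ≠ 0 → 0 < N v) (hNe : ∀ v, N v ≤ ‖e v‖)
    {μ : Measure (AxialProjector (formNorm (euclideanForm e)))} (hμ : IsPartitionOfUnity μ)
    (h : ∀ᵐ p ∂μ, ∀ v, |p.form v| ≤ N v) : IsJohnForm N (euclideanForm e) := by
  refine ⟨euclideanForm_posDef e, fun v => by rw [formNorm_euclideanForm]; exact hNe v, ?_⟩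
  rw [hilb, minDilL2_id]
  refine ENNReal.div_le_of_le_mul ?_
  rw [one_mul]
  exact iInf₂_le_of_le μ hμ (lintegral_sq_le_of_ae_le_one hμ
    (h.mono fun p hp => lipConst_form_le_one hN hp))

theorem trace_le_of_isJohnForm [FiniteDimensional ℝ V] (hn : n ≠ 0) {N : V → ℝ}
    (hN : ∀ v, v ≠ 0 → 0 < N v) (h : IsJohnForm N (euclideanForm e))
    {e' : V ≃L[ℝ] EuclideanSpace ℝ (Fin n)} (hNe : ∀ v, N v ≤ ‖e' v‖)
    {B : EuclideanSpace ℝ (Fin n) →L[ℝ] EuclideanSpace ℝ (Fin n)} (hB : ∀ v, B (e' v) = e v) :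
    LinearMap.trace ℝ _ (B ∘L B.adjoint :
      EuclideanSpace ℝ (Fin n) →ₗ[ℝ] EuclideanSpace ℝ (Fin n)) ≤ n := by
  have h1 := h.2.2
  rw [hilb, minDilL2_id, ENNReal.div_le_iff (by simp [hn]) (by simp), one_mul] at h1
  have h2 := (trace_le_minDilL2 hN hNe hB).trans h1
  rw [ENNReal.rpow_le_rpow_iff (by norm_num), ← ENNReal.ofReal_natCast,
    ENNReal.ofReal_le_ofReal_iff (Nat.cast_nonneg n)] at h2
  exact h2

/-- For `B = e ∘ e'⁻¹` the trace bound applies to `B` and to `B⁻¹`. The squared Hilbert–Schmidt norm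
of `B* - B⁻¹` is the sum of the two traces minus `2 n`, hence is not positive; so `B` is orthogonal.
-/
theorem euclideanForm_eq_of_isJohnForm [FiniteDimensional ℝ V] (hn : n ≠ 0) {N : V → ℝ}
    (hN : ∀ v, v ≠ 0 → 0 < N v) {e e' : V ≃L[ℝ] EuclideanSpace ℝ (Fin n)}
    (hh : IsJohnForm N (euclideanForm e)) (hh' : IsJohnForm N (euclideanForm e')) :
    euclideanForm e = euclideanForm e' := by
  let B : EuclideanSpace ℝ (Fin n) →L[ℝ] EuclideanSpace ℝ (Fin n) := (e'.symm.trans e : _ ≃L[ℝ] _)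
  let B' : EuclideanSpace ℝ (Fin n) →L[ℝ] EuclideanSpace ℝ (Fin n) := (e.symm.trans e' : _ ≃L[ℝ] _)
  have hBB' : B ∘L B' = ContinuousLinearMap.id ℝ _ := by ext1 x; simp [B, B']
  have hB'B : B' ∘L B = ContinuousLinearMap.id ℝ _ := by ext1 x; simp [B, B']
  have t1 := trace_le_of_isJohnForm hn hN hh (e' := e') (B := B)
    (fun v => by rw [← formNorm_euclideanForm]; exact hh'.2.1 v) (fun v => by simp [B])
  have t2 := trace_le_of_isJohnForm hn hN hh' (e' := e) (B := B')
    (fun v => by rw [← formNorm_euclideanForm]; exact hh.2.1 v) (fun v => by simp [B'])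
  let b := EuclideanSpace.basisFun (Fin n) ℝ
  have hb : ∑ i, ⟪b i, b i⟫ = n := by simp
  rw [LinearMap.trace_eq_sum_inner _ b] at t1 t2
  have hC : ∑ i, ‖B.adjoint (b i) - B' (b i)‖ ^ 2 ≤ 0 := by
    have e1 : ∀ i, ‖B.adjoint (b i) - B' (b i)‖ ^ 2 =
        ⟪b i, B (B.adjoint (b i))⟫ - 2 * ⟪b i, b i⟫ + ‖B' (b i)‖ ^ 2 := fun i => by
      rw [norm_sub_sq_real, ← real_inner_self_eq_norm_sq (B.adjoint (b i)),
        ContinuousLinearMap.adjoint_inner_left, ContinuousLinearMap.adjoint_inner_left,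
        show B (B' (b i)) = b i from congrArg (fun T => T (b i)) hBB']
    have e2 : ∑ i, ‖B' (b i)‖ ^ 2 = ∑ i, ⟪b i, B' (B'.adjoint (b i))⟫ := by
      have : ∀ i, ‖B' (b i)‖ ^ 2 = ⟪b i, B'.adjoint (B' (b i))⟫ := fun i => by
        rw [ContinuousLinearMap.adjoint_inner_right, real_inner_self_eq_norm_sq]
      simp only [this]
      have h3 := LinearMap.trace_mul_comm ℝ (B' : EuclideanSpace ℝ (Fin n) →ₗ[ℝ] _)
        (B'.adjoint : EuclideanSpace ℝ (Fin n) →ₗ[ℝ] _)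
      rw [LinearMap.trace_eq_sum_inner _ b, LinearMap.trace_eq_sum_inner _ b] at h3
      exact h3.symm
    simp only [e1]
    rw [Finset.sum_add_distrib, Finset.sum_sub_distrib, ← Finset.mul_sum, hb, e2]
    have t1' : ∑ i, ⟪b i, B (B.adjoint (b i))⟫ ≤ n := t1
    have t2' : ∑ i, ⟪b i, B' (B'.adjoint (b i))⟫ ≤ n := t2
    linarith
  have hC0 : ∀ i, B.adjoint (b i) = B' (b i) := fun i => by
    have := (Finset.sum_eq_zero_iff_of_nonneg (fun i _ => by positivity)).1
      (le_antisymm hC (Finset.sum_nonneg fun i _ => by positivity)) i (Finset.mem_univ i)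
    exact sub_eq_zero.1 (norm_eq_zero.1 (pow_eq_zero_iff two_ne_zero |>.1 this))
  have hadj : B.adjoint = B' := by
    refine ContinuousLinearMap.coe_injective (b.toBasis.ext fun i => ?_)
    rw [b.coe_toBasis]
    exact hC0 i
  ext v
  rw [euclideanForm_apply, euclideanForm_apply]
  have h1 : B (e' v) = e v := by simp [B]
  rw [← h1, ← real_inner_self_eq_norm_sq, ← ContinuousLinearMap.adjoint_inner_left, hadj,
    show B' (B (e' v)) = e' v from congrArg (fun T => T (e' v)) hB'B, real_inner_self_eq_norm_sq]

/-- Uniqueness of John's form. -/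
theorem IsJohnForm.unique [FiniteDimensional ℝ V] [Nontrivial V] {N : V → ℝ}
    (hN : ∀ v, v ≠ 0 → 0 < N v) {h h' : QuadraticForm ℝ V} (hh : IsJohnForm N h)
    (hh' : IsJohnForm N h') : h = h' := by
  obtain ⟨e, rfl⟩ := exists_eq_euclideanForm hh.1
  obtain ⟨e', rfl⟩ := exists_eq_euclideanForm hh'.1
  exact euclideanForm_eq_of_isJohnForm Module.finrank_pos.ne' hN hh hh'

end EuclideanForm

/-! ### Compactness of convex hulls -/

section ConvexHull

/-- The convex hull of a compact set in a finite dimensional space is compact. -/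
theorem IsCompact.convexHull_of_finiteDimensional {F : Type*} [NormedAddCommGroup F]
    [NormedSpace ℝ F] [FiniteDimensional ℝ F] {s : Set F} (hs : IsCompact s) :
    IsCompact (convexHull ℝ s) := by
  classical
  rcases s.eq_empty_or_nonempty with rfl | ⟨x₀, hx₀⟩
  · simp
  -- By Carathéodory `d` points suffice, so the hull is a continuous image of a simplex times `s ^
  -- d`. Shorter combinations are padded with weight 0 at `x₀`.
  set d := Module.finrank ℝ F + 1
  have hK : IsCompact ((fun q : (Fin d → ℝ) × (Fin d → F) => ∑ i, q.1 i • q.2 i) ''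
      (stdSimplex ℝ (Fin d) ×ˢ Set.univ.pi fun _ => s)) := by
    refine ((isCompact_stdSimplex ℝ (Fin d)).prod (isCompact_univ_pi fun _ => hs)).image ?_
    fun_prop
  convert! hK using 1
  refine Set.Subset.antisymm (fun x hx => ?_) ?_
  · obtain ⟨ι, hι, z, w, hz, hind, hw, hw1, rfl⟩ := eq_pos_convex_span_of_mem_convexHull hx
    have hcard : Fintype.card ι ≤ d :=
      hind.card_le_finrank_succ.trans (Nat.succ_le_succ (Submodule.finrank_le _))
    obtain ⟨φ⟩ : Nonempty (ι ↪ Fin d) :=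
      Function.Embedding.nonempty_of_card_le (by simpa using hcard)
    have hoff : ∀ i ∉ Set.range φ, Function.extend φ w 0 i = 0 := fun i hi => by
      rw [Function.extend_apply' _ _ _ hi, Pi.zero_apply]
    refine ⟨(Function.extend φ w 0, Function.extend φ z fun _ => x₀), ⟨⟨fun i => ?_, ?_⟩, ?_⟩, ?_⟩
    · by_cases hi : i ∈ Set.range φ
      · obtain ⟨j, rfl⟩ := hi
        simp only [φ.injective.extend_apply]
        exact (hw j).le
      · exact (hoff i hi).ge
    · rw [← hw1]
      refine (Fintype.sum_of_injective φ φ.injective _ _ hoff fun i => ?_).symm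
      simp [φ.injective.extend_apply]
    · intro i _
      by_cases hi : i ∈ Set.range φ
      · obtain ⟨j, rfl⟩ := hi
        simp only [φ.injective.extend_apply]
        exact hz ⟨j, rfl⟩
      · simp only [Function.extend_apply' _ _ _ hi]
        exact hx₀
    · refine (Fintype.sum_of_injective φ φ.injective _ _ (fun i hi => ?_) fun i => ?_).symm
      · simp [hoff i hi]
      · simp [φ.injective.extend_apply]
  · rintro _ ⟨⟨w, z⟩, ⟨hw, hz⟩, rfl⟩
    exact mem_convexHull_of_exists_fintype w z hw.1 hw.2 (fun i => hz i trivial) rfl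

end ConvexHull

/-! ### John's theorem: the maximal ellipsoid and its contact points -/

section John

open scoped RealInnerProductSpace

variable {n : ℕ}

/-- At a contact point of a norm with the sphere, the supporting hyperplanes coincide. -/
theorem Seminorm.abs_inner_le_of_contact {E : Type*} [NormedAddCommGroup E] [InnerProductSpace ℝ E]
    {N : Seminorm ℝ E} (hN : ∀ x, N x ≤ ‖x‖) {u : E} (hu : ‖u‖ = 1) (hNu : N u = 1) (y : E) :
    |⟪u, y⟫| ≤ N y := by
  have key : ∀ y, ⟪u, y⟫ ≤ N y := fun y => by
    refine le_of_forall_pos_le_add fun ε hε => ?_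
    set t := ε / (‖y‖ ^ 2 + 1) with ht
    have ht0 : 0 < t := by positivity
    -- Since `‖u - t • y‖ = 1 - t ⟪u, y⟫ + O(t²)`, a small `t` gives `⟪u, y⟫ ≤ N y + ε`.
    have h1 : 1 ≤ ‖u - t • y‖ + t * N y := by
      have := map_add_le_add N (u - t • y) (t • y)
      rw [sub_add_cancel, hNu, map_smul_eq_mul, Real.norm_of_nonneg ht0.le] at this
      exact this.trans (by gcongr; exact hN _)
    have h2 : ‖u - t • y‖ ^ 2 = 1 - 2 * (t * ⟪u, y⟫) + t ^ 2 * ‖y‖ ^ 2 := by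
      rw [norm_sub_sq_real, hu, inner_smul_right, norm_smul, Real.norm_of_nonneg ht0.le]; ring
    have h3 : t * (‖y‖ ^ 2 + 1) = ε := by rw [ht]; field_simp
    have h4 : 2 * ‖u - t • y‖ ≤ 1 + ‖u - t • y‖ ^ 2 := by nlinarith [sq_nonneg (‖u - t • y‖ - 1)]
    have h5 : t * ⟪u, y⟫ ≤ t * (N y + ε) := by nlinarith
    exact le_of_mul_le_mul_left h5 ht0
  refine abs_le.2 ⟨?_, key y⟩
  have := key (-y)
  rw [inner_neg_right, map_neg_eq_map] at this
  linarith

/-- A linear map that decreases the norm at the contact points gives rise to linear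
perturbations of the identity that map the ball into the unit ball of `N`. -/
theorem Seminorm.eventually_perturbation_le {E : Type*} [NormedAddCommGroup E]
    [InnerProductSpace ℝ E] [FiniteDimensional ℝ E]
    {N : Seminorm ℝ E} (hN : ∀ x, N x ≤ ‖x‖) {T : E →ₗ[ℝ] E}
    (hT : ∀ u, ‖u‖ = 1 → N u = 1 → ⟪u, T u⟫ < 0) :
    ∀ᶠ t in 𝓝[>] (0 : ℝ), ∀ x, N (x + t • T x) ≤ ‖x‖ := by
  have : ProperSpace E := FiniteDimensional.proper_real E
  have hTc : Continuous T := T.continuous_of_finiteDimensional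
  have hNc := N.continuous_of_finiteDimensional
  have key : ∀ᶠ t in 𝓝 (0 : ℝ), ∀ u ∈ Metric.sphere (0 : E) 1, 0 < t → N (u + t • T u) ≤ ‖u‖ := by
    refine (isCompact_sphere (0 : E) 1).eventually_forall_of_forall_eventually fun u hu => ?_
    have hu1 : ‖u‖ = 1 := by simpa using hu
    -- Off the contact set the strict inequality persists nearby. At a contact point `N` is bounded
    -- by the Euclidean norm, whose square changes by `t (2 ⟪u, T u⟫ + t ‖T u‖²) < 0`.
    rcases (hN u).lt_or_eq with hlt | heq
    · have h1 : ∀ᶠ q : ℝ × E in 𝓝 (0, u), N (q.2 + q.1 • T q.2) < ‖q.2‖ := by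
        refine ContinuousAt.eventually_lt ?_ ?_ (by simpa using hlt)
        · exact (hNc.comp (continuous_snd.add
            (continuous_fst.smul (hTc.comp continuous_snd)))).continuousAt
        · exact continuous_snd.norm.continuousAt
      exact h1.mono fun q hq _ => hq.le
    · have h1 : ∀ᶠ q : ℝ × E in 𝓝 (0, u), 2 * ⟪q.2, T q.2⟫ + q.1 * ‖T q.2‖ ^ 2 < 0 := by
        refine ContinuousAt.eventually_lt ?_ continuousAt_const ?_
        · exact ((continuous_const.mul (continuous_snd.inner (hTc.comp continuous_snd))).add
            (continuous_fst.mul ((hTc.comp continuous_snd).norm.pow 2))).continuousAt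
        · simpa only [zero_mul, add_zero] using mul_neg_of_pos_of_neg two_pos (hT u hu1 (heq.trans hu1))
      refine h1.mono fun q hq hq0 => (hN _).trans ?_
      refine le_of_sq_le_sq ?_ (norm_nonneg _)
      rw [norm_add_sq_real, inner_smul_right, norm_smul, mul_pow, Real.norm_eq_abs, sq_abs]
      nlinarith
  filter_upwards [key.filter_mono nhdsWithin_le_nhds, self_mem_nhdsWithin] with t ht ht0 x
  rcases eq_or_ne x 0 with rfl | hx
  · simp
  have hx0 : 0 < ‖x‖ := norm_pos_iff.2 hx
  have h1 := ht (‖x‖⁻¹ • x) (by simp [norm_smul, hx0.ne']) ht0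
  rw [map_smul, smul_comm, ← smul_add, map_smul_eq_mul, norm_smul, norm_inv, norm_norm] at h1
  exact le_of_mul_le_mul_left h1 (by positivity)

/-- John's theorem: if the Euclidean ball has maximal volume among the ellipsoids in the unit ball
of `N`, the identity is a positive combination of the projectors at contact points. -/
theorem Seminorm.exists_contact_decomposition (hn : n ≠ 0)
    {N : Seminorm ℝ (EuclideanSpace ℝ (Fin n))} (hN : ∀ x, N x ≤ ‖x‖)
    (hmax : ∀ S : EuclideanSpace ℝ (Fin n) →ₗ[ℝ] EuclideanSpace ℝ (Fin n),
      (∀ x, N (S x) ≤ ‖x‖) → LinearMap.det S ≤ 1) :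
    ∃ (ι : Type) (_ : Fintype ι) (z : ι → EuclideanSpace ℝ (Fin n)) (c : ι → ℝ),
      (∀ i, ‖z i‖ = 1) ∧ (∀ i, N (z i) = 1) ∧ (∀ i, 0 ≤ c i) ∧
      ∀ w, ∑ i, (c i * ⟪z i, w⟫) • z i = w := by
  classical
  have hn0 : (0 : ℝ) < n := by exact_mod_cast Nat.pos_of_ne_zero hn
  let P : EuclideanSpace ℝ (Fin n) → (Fin n → Fin n → ℝ) := fun u i j => u i * u j
  have hP : Continuous P := by fun_prop
  set Z : Set (EuclideanSpace ℝ (Fin n)) := {u | ‖u‖ = 1 ∧ N u = 1} with hZ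
  have hZc : IsCompact Z := by
    have : Z = Metric.sphere 0 1 ∩ {u | N u = 1} := by ext; simp [hZ]
    rw [this]
    exact (isCompact_sphere _ _).inter_right
      (isClosed_eq N.continuous_of_finiteDimensional continuous_const)
  let J : Fin n → Fin n → ℝ := fun i j => if i = j then (n : ℝ)⁻¹ else 0
  -- If `I / n` were outside the hull of the `u ⊗ u`, a separating functional shifted by `c` would
  -- give `T` with `⟪u, T u⟫ < 0` at the contact points and positive trace. Then `1 + t T` maps the
  -- ball into the unit ball of `N`, while its determinant `1 + t tr T + O(t²)` exceeds 1.
  have hJ : J ∈ convexHull ℝ (P '' Z) := by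
    by_contra hJ
    obtain ⟨f, c, hfc, hcJ⟩ := geometric_hahn_banach_closed_point (convex_convexHull ℝ (P '' Z))
      (hZc.image hP).convexHull_of_finiteDimensional.isClosed hJ
    let M : Matrix (Fin n) (Fin n) ℝ := fun i j => f (Pi.single i (Pi.single j 1))
    have hfM : ∀ X : Fin n → Fin n → ℝ, f X = ∑ i, ∑ j, X i j * M i j := fun X => by
      have hX : X = ∑ i, ∑ j, X i j • Pi.single i (Pi.single j 1) := by
        ext k l
        simp only [Finset.sum_apply, Pi.smul_apply, smul_eq_mul]
        rw [Finset.sum_eq_single k (fun i _ hi => by simp [Pi.single_eq_of_ne hi.symm]) (by simp),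
          Finset.sum_eq_single l (fun j _ hj => by simp [Pi.single_eq_of_ne hj.symm]) (by simp)]
        simp
      conv_lhs => rw [hX]
      simp [M]
    let b := (EuclideanSpace.basisFun (Fin n) ℝ).toBasis
    let T := Matrix.toLin b b (M - c • 1)
    have hTu : ∀ u, ⟪u, T u⟫ = f (P u) - c * ‖u‖ ^ 2 := fun u => by
      have hb : ∀ v : EuclideanSpace ℝ (Fin n), ⇑(b.repr v) = v.ofLp := fun v => by
        ext i; simp [b]
      have h1 : ∀ i, T u i = ((M - c • 1).mulVec u) i := fun i => by
        rw [← hb (T u), Matrix.repr_toLin, hb]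
      rw [hfM, PiLp.inner_apply, EuclideanSpace.norm_sq_eq, Finset.mul_sum,
        ← Finset.sum_sub_distrib]
      refine Finset.sum_congr rfl fun i _ => ?_
      rw [h1, Matrix.sub_mulVec, Matrix.smul_mulVec, Matrix.one_mulVec]
      simp only [Pi.sub_apply, Pi.smul_apply, smul_eq_mul, Matrix.mulVec, dotProduct, P,
        RCLike.inner_apply, conj_trivial, Real.norm_eq_abs, sq_abs]
      rw [sub_mul, Finset.sum_mul]
      congr 1
      · exact Finset.sum_congr rfl fun j _ => by ring
      · ring
    have hev := N.eventually_perturbation_le hN (T := T) fun u hu hNu => by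
      rw [hTu, hu, one_pow, mul_one]
      linarith [hfc (P u) (subset_convexHull ℝ _ ⟨u, ⟨hu, hNu⟩, rfl⟩)]
    have htr : 0 < Matrix.trace (M - c • 1) := by
      have h1 : f J = (n : ℝ)⁻¹ * Matrix.trace M := by
        rw [hfM, Matrix.trace, Finset.mul_sum]
        refine Finset.sum_congr rfl fun i _ => ?_
        simp [J]
      rw [h1, inv_mul_eq_div, lt_div_iff₀ hn0] at hcJ
      rw [Matrix.trace_sub, Matrix.trace_smul, Matrix.trace_one, Fintype.card_fin, smul_eq_mul]
      linarith
    have hdet : ∀ t : ℝ, LinearMap.det (1 + t • T) = (1 + t • (M - c • 1)).det := fun t => by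
      rw [← LinearMap.det_toLin b, map_add (Matrix.toLin b b), map_smul (Matrix.toLin b b),
        Matrix.toLin_one]
      rfl
    -- The quotient `(det (1 + t T) - 1) / t`, extended continuously by `tr T` at 0.
    set g : ℝ → ℝ := fun t => Matrix.trace (M - c • 1) +
      (Matrix.det (1 + (Polynomial.X : Polynomial ℝ) •
        (M - c • 1).map Polynomial.C)).divX.divX.eval t * t with hg
    have hgc : ∀ᶠ t in 𝓝[>] (0 : ℝ), 0 < g t := by
      have : Continuous g := by
        exact continuous_const.add ((Polynomial.continuous _).mul continuous_id)
      refine Filter.Eventually.filter_mono nhdsWithin_le_nhds ?_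
      exact this.continuousAt.eventually_const_lt (by simpa [hg] using htr)
    obtain ⟨t, ht1, ht2, ht0⟩ := (hev.and (hgc.and self_mem_nhdsWithin)).exists
    have h1 := hmax (1 + t • T) fun x => by simpa using ht1 x
    rw [hdet, Matrix.det_one_add_smul] at h1
    have h2 : 0 < t * g t := mul_pos ht0 ht2
    simp only [hg] at h2
    nlinarith
  obtain ⟨ι, hι, w, q, hw0, hw1, hq, hsum⟩ := mem_convexHull_iff_exists_fintype.1 hJ
  choose z hz hzq using hq
  refine ⟨ι, hι, z, fun i => n * w i, fun i => (hz i).1, fun i => (hz i).2,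
    fun i => by have := hw0 i; positivity, fun v => ?_⟩
  ext j
  have hJk : ∀ k, ∑ i, w i * (z i k * z i j) = J k j := fun k => by
    rw [← hsum]
    simp [Finset.sum_apply, ← hzq, P]
  rw [WithLp.ofLp_sum, Finset.sum_apply]
  simp only [WithLp.ofLp_smul, Pi.smul_apply, smul_eq_mul]
  calc ∑ i, n * w i * ⟪z i, v⟫ * z i j
      = ∑ i, ∑ k, n * v k * (w i * (z i k * z i j)) := by
        refine Finset.sum_congr rfl fun i _ => ?_
        rw [PiLp.inner_apply, Finset.mul_sum, Finset.sum_mul]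
        refine Finset.sum_congr rfl fun k _ => ?_
        simp only [RCLike.inner_apply, conj_trivial]
        ring
    _ = ∑ k, n * v k * J k j := by
        rw [Finset.sum_comm]
        refine Finset.sum_congr rfl fun k _ => ?_
        rw [← Finset.mul_sum, hJk]
    _ = v j := by
        simp only [J, mul_ite, mul_zero, Finset.sum_ite_eq', Finset.mem_univ, if_true]
        field_simp

variable {V : Type*} [NormedAddCommGroup V] [NormedSpace ℝ V]

/-- There is an ellipsoid of maximal volume in the unit ball of a norm. -/
theorem Seminorm.exists_maximal_ellipsoid (N : Seminorm ℝ (EuclideanSpace ℝ (Fin n)))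
    (hN : ∀ v, N v = 0 → v = 0) :
    ∃ T : EuclideanSpace ℝ (Fin n) ≃L[ℝ] EuclideanSpace ℝ (Fin n), (∀ x, N (T x) ≤ ‖x‖) ∧
      ∀ S : EuclideanSpace ℝ (Fin n) →ₗ[ℝ] EuclideanSpace ℝ (Fin n),
        (∀ x, N (T (S x)) ≤ ‖x‖) → LinearMap.det S ≤ 1 := by
  obtain ⟨c, hc, hcN⟩ := N.exists_norm_le hN
  obtain ⟨M, hM0, hM⟩ := N.exists_le_norm
  have : ProperSpace (EuclideanSpace ℝ (Fin n) →L[ℝ] EuclideanSpace ℝ (Fin n)) :=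
    FiniteDimensional.proper_real _
  let K : Set (EuclideanSpace ℝ (Fin n) →L[ℝ] EuclideanSpace ℝ (Fin n)) :=
    {T | ∀ x, N (T x) ≤ ‖x‖}
  have hK : IsCompact K := by
    refine Metric.isCompact_of_isClosed_isBounded ?_ ?_
    · simp only [K, Set.ofPred_forall]
      exact isClosed_iInter fun x => isClosed_le
        (N.continuous_of_finiteDimensional.comp (continuous_id.clm_apply continuous_const))
        continuous_const
    · refine isBounded_iff_forall_norm_le.2 ⟨c⁻¹, fun T hT => ?_⟩
      refine T.opNorm_le_bound (by positivity) fun x => ?_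
      rw [inv_mul_eq_div, le_div_iff₀ hc, mul_comm]
      exact (hcN _).trans (hT x)
  obtain ⟨T, hT, hTmax⟩ := hK.exists_isMaxOn ⟨0, fun x => by simp⟩
    ContinuousLinearMap.continuous_det.continuousOn
  have hdet : 0 < T.det := by
    have h1 : (M + 1)⁻¹ • ContinuousLinearMap.id ℝ (EuclideanSpace ℝ (Fin n)) ∈ K := fun x => by
      rw [_root_.smul_apply, ContinuousLinearMap.id_apply, map_smul_eq_mul,
        Real.norm_of_nonneg (by positivity), inv_mul_le_iff₀ (by positivity)]
      nlinarith [hM x, norm_nonneg x]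
    have h2 : ContinuousLinearMap.det
        ((M + 1)⁻¹ • ContinuousLinearMap.id ℝ (EuclideanSpace ℝ (Fin n))) = (M + 1)⁻¹ ^ n := by
      rw [ContinuousLinearMap.det, ContinuousLinearMap.toLinearMap_smul, LinearMap.det_smul,
        finrank_euclideanSpace_fin, ContinuousLinearMap.coe_id, LinearMap.det_id, mul_one]
    have h3 := hTmax h1
    simp only [Set.mem_ofPred_eq, h2] at h3
    exact lt_of_lt_of_le (by positivity) h3
  refine ⟨T.toContinuousLinearEquivOfDetNeZero hdet.ne', fun x => hT x, fun S hS => ?_⟩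
  have h1 : T ∘L S.toContinuousLinearMap ∈ K := fun x => hS x
  have h2 := hTmax h1
  have h3 : (T ∘L S.toContinuousLinearMap).det = T.det * LinearMap.det S := by
    rw [ContinuousLinearMap.det, ContinuousLinearMap.det, ← LinearMap.det_comp]
    rfl
  simp only [Set.mem_ofPred_eq, h3] at h2
  exact le_of_mul_le_mul_left (by linarith) hdet

/-- Existence of John's decomposition. -/
theorem Seminorm.exists_john_decomposition [FiniteDimensional ℝ V] [Nontrivial V]
    (N : Seminorm ℝ V) (hN : ∀ v, N v = 0 → v = 0) :
    ∃ (n : ℕ) (_ : n ≠ 0) (e : V ≃L[ℝ] EuclideanSpace ℝ (Fin n)), (∀ v, N v ≤ ‖e v‖) ∧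
      ∃ (ι : Type) (_ : Fintype ι) (z : ι → EuclideanSpace ℝ (Fin n)) (c : ι → ℝ),
        (∀ i, ‖z i‖ = 1) ∧ (∀ i v, |⟪z i, e v⟫| ≤ N v) ∧ (∀ i, 0 ≤ c i) ∧
        ∀ w, ∑ i, (c i * ⟪z i, w⟫) • z i = w := by
  obtain ⟨e₀⟩ : Nonempty (V ≃L[ℝ] EuclideanSpace ℝ (Fin (Module.finrank ℝ V))) :=
    ⟨ContinuousLinearEquiv.ofFinrankEq (by rw [finrank_euclideanSpace_fin])⟩
  have hn : Module.finrank ℝ V ≠ 0 := Module.finrank_pos.ne'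
  obtain ⟨T, hT, hmax⟩ := (N.comp
    (e₀.symm.toLinearEquiv : EuclideanSpace ℝ (Fin (Module.finrank ℝ V)) →ₗ[ℝ] V)).exists_maximal_ellipsoid
    (fun v hv => by simpa using hN _ hv)
  let e := e₀.trans T.symm
  have he : ∀ x, (N.comp
    (e.symm.toLinearEquiv : EuclideanSpace ℝ (Fin (Module.finrank ℝ V)) →ₗ[ℝ] V)) x ≤ ‖x‖ := fun x => hT x
  obtain ⟨ι, hι, z, c, hz, hNz, hc, hzc⟩ := Seminorm.exists_contact_decomposition hn he
    fun S hS => hmax S fun x => hS x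
  refine ⟨_, hn, e, fun v => by simpa using he (e v), ι, hι, z, c, hz, fun i v => ?_, hc, hzc⟩
  simpa using Seminorm.abs_inner_le_of_contact he (hz i) (hNz i) (e v)

end John

/-! ### A coarse divergence estimate on the unit ball -/

section Reflection

open scoped RealInnerProductSpace

variable {n : ℕ}

theorem integral_ball_comp_linearIsometryEquiv {G : Type*} [NormedAddCommGroup G] [NormedSpace ℝ G]
    (φ : EuclideanSpace ℝ (Fin n) ≃ₗᵢ[ℝ] EuclideanSpace ℝ (Fin n))
    (g : EuclideanSpace ℝ (Fin n) → G) :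
    ∫ w in Metric.ball 0 1, g (φ w) = ∫ w in Metric.ball 0 1, g w := by
  have h := φ.measurePreserving.setIntegral_preimage_emb φ.toHomeomorph.measurableEmbedding g
    (Metric.ball 0 1)
  rwa [show φ ⁻¹' Metric.ball 0 1 = Metric.ball 0 1 by
    simp] at h

theorem Continuous.integrableOn_unit_ball {G : Type*} [NormedAddCommGroup G]
    {g : EuclideanSpace ℝ (Fin n) → G} (hg : Continuous g) :
    IntegrableOn g (Metric.ball 0 1) :=
  (hg.continuousOn.integrableOn_compact (isCompact_closedBall _ _)).mono_set
    Metric.ball_subset_closedBall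

/-- The second moments of the unit ball. -/
theorem integral_ball_inner_sq {z : EuclideanSpace ℝ (Fin n)} (hz : ‖z‖ = 1) :
    n * ∫ w in Metric.ball (0 : EuclideanSpace ℝ (Fin n)) 1, ⟪z, w⟫ ^ 2 =
      ∫ w in Metric.ball (0 : EuclideanSpace ℝ (Fin n)) 1, ‖w‖ ^ 2 := by
  let b := EuclideanSpace.basisFun (Fin n) ℝ
  have h1 : ∀ i, ∫ w in Metric.ball (0 : EuclideanSpace ℝ (Fin n)) 1, ⟪b i, w⟫ ^ 2 =
      ∫ w in Metric.ball (0 : EuclideanSpace ℝ (Fin n)) 1, ⟪z, w⟫ ^ 2 := fun i => by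
    -- This reflection preserves the ball, so the second moments in the directions `z` and `b i`
    -- agree; the moments in the directions `b i` add up to that of `‖w‖ ^ 2`.
    have hr : (ℝ ∙ (z - b i))ᗮ.reflection z = b i :=
      Submodule.reflection_sub (by rw [hz, b.norm_eq_one])
    rw [← integral_ball_comp_linearIsometryEquiv (ℝ ∙ (z - b i))ᗮ.reflection]
    refine integral_congr_ae (Eventually.of_forall fun w => ?_)
    have h2 := (ℝ ∙ (z - b i))ᗮ.reflection.inner_map_map z w
    rw [hr] at h2
    simp only [h2]
  have h2 : ∀ w : EuclideanSpace ℝ (Fin n), ‖w‖ ^ 2 = ∑ i, ⟪b i, w⟫ ^ 2 := fun w => by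
    rw [← b.sum_sq_norm_inner_right w]
    exact Finset.sum_congr rfl fun i _ => by rw [Real.norm_eq_abs, sq_abs]
  simp_rw [h2]
  rw [integral_finsetSum _ fun i _ =>
    Continuous.integrableOn_unit_ball ((continuous_const.inner continuous_id).pow 2)]
  simp_rw [h1]
  simp

theorem integral_ball_norm_sq_pos (hn : n ≠ 0) :
    0 < ∫ w in Metric.ball (0 : EuclideanSpace ℝ (Fin n)) 1, ‖w‖ ^ 2 := by
  have : Nontrivial (EuclideanSpace ℝ (Fin n)) := by
    have : Nonempty (Fin n) := ⟨⟨0, Nat.pos_of_ne_zero hn⟩⟩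
    infer_instance
  rw [integral_pos_iff_support_of_nonneg (fun _ => by positivity)
    (Continuous.integrableOn_unit_ball (by fun_prop))]
  have h1 : Function.support (fun w : EuclideanSpace ℝ (Fin n) => ‖w‖ ^ 2) = {0}ᶜ := by
    ext w; simp
  rw [h1, Measure.restrict_apply (measurableSet_singleton _).compl, Set.inter_comm,
    ← Set.sdiff_eq, measure_sdiff_null (measure_singleton _)]
  exact Metric.measure_ball_pos _ _ one_pos

/-- The coarse divergence estimate in a direction. -/
theorem integral_ball_mul_inner_le {z : EuclideanSpace ℝ (Fin n)} (hz : ‖z‖ = 1)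
    (G : SimpleFunc (EuclideanSpace ℝ (Fin n)) ℝ) {K₁ K₂ : ℝ} (hK₂ : 0 ≤ K₂)
    (hG : ∀ w ∈ Metric.ball (0 : EuclideanSpace ℝ (Fin n)) 1, ∀ w' ∈ Metric.ball 0 1,
      |G w - G w'| ≤ K₁ * ‖w - w'‖ + K₂) :
    ∫ w in Metric.ball 0 1, G w * ⟪z, w⟫ ≤
      K₁ * (∫ w in Metric.ball 0 1, ⟪z, w⟫ ^ 2) +
        K₂ * volume.real (Metric.ball (0 : EuclideanSpace ℝ (Fin n)) 1) := by
  set B := Metric.ball (0 : EuclideanSpace ℝ (Fin n)) 1 with hB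
  -- As `ρ` changes the sign of `⟪z, w⟫`, twice the integral is that of `(G w - G (ρ w)) ⟪z, w⟫`.
  -- The distance `‖w - ρ w‖ = 2 |⟪z, w⟫|` then bounds it without any differentiation.
  set ρ := (ℝ ∙ z)ᗮ.reflection with hρ
  have hρz : ∀ w, ⟪z, ρ w⟫ = -⟪z, w⟫ := fun w => by
    have h1 : ρ z = -z := by
      rw [hρ]
      exact Submodule.reflection_mem_subspace_orthogonal_precomplement_eq_neg
        (Submodule.mem_span_singleton_self z)
    have h2 := ρ.inner_map_map z w
    rw [h1, inner_neg_left] at h2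
    linarith
  have hρw : ∀ w, ‖w - ρ w‖ = 2 * |⟪z, w⟫| := fun w => by
    have h1 : ρ w = w - (2 * ⟪z, w⟫) • z := by
      rw [hρ, Submodule.reflection_orthogonal_apply, Submodule.reflection_singleton_apply, hz]
      simp [two_smul, add_smul, two_mul]
    rw [h1, sub_sub_cancel, norm_smul, hz, mul_one, Real.norm_eq_abs, abs_mul, abs_two]
  have hint : ∀ H : SimpleFunc (EuclideanSpace ℝ (Fin n)) ℝ,
      IntegrableOn (fun w => H w * ⟪z, w⟫) B := fun H => by
    obtain ⟨c, hc⟩ := H.exists_forall_norm_le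
    exact (Continuous.integrableOn_unit_ball (g := fun w => ⟪z, w⟫)
      (continuous_const.inner continuous_id)).bdd_mul
      H.stronglyMeasurable.aestronglyMeasurable (Eventually.of_forall hc)
  let G' : SimpleFunc (EuclideanSpace ℝ (Fin n)) ℝ := G.comp ρ ρ.continuous.measurable
  have h1 : ∫ w in B, G w * ⟪z, w⟫ = -∫ w in B, G' w * ⟪z, w⟫ := by
    rw [hB, ← integral_ball_comp_linearIsometryEquiv ρ, ← integral_neg]
    refine integral_congr_ae (Eventually.of_forall fun w => ?_)
    simp only [hρz, G', SimpleFunc.coe_comp, Function.comp_apply]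
    ring
  have h2 : 2 * ∫ w in B, G w * ⟪z, w⟫ = ∫ w in B, (G w * ⟪z, w⟫ - G' w * ⟪z, w⟫) := by
    rw [integral_sub (hint G) (hint G')]
    linarith
  have hI : IntegrableOn (fun w => ⟪z, w⟫ ^ 2) B :=
    Continuous.integrableOn_unit_ball ((continuous_const.inner continuous_id).pow 2)
  have hc : IntegrableOn (fun _ => (1 : ℝ)) B :=
    Continuous.integrableOn_unit_ball continuous_const
  have h3 : ∫ w in B, (G w * ⟪z, w⟫ - G' w * ⟪z, w⟫) ≤
      ∫ w in B, (2 * K₁ * ⟪z, w⟫ ^ 2 + K₂ * 1) := by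
    refine setIntegral_mono_on ((hint G).sub (hint G')) ((hI.const_mul _).add (hc.const_mul _))
      measurableSet_ball fun w hw => ?_
    have hw' : ρ w ∈ B := by
      rw [hB, mem_ball_zero_iff] at hw ⊢
      rwa [LinearIsometryEquiv.norm_map]
    have h4 := hG w hw (ρ w) hw'
    rw [hρw] at h4
    have h5 : |⟪z, w⟫| ≤ 1 := by
      refine (abs_real_inner_le_norm z w).trans ?_
      rw [hz, one_mul]
      exact (mem_ball_zero_iff.1 hw).le
    have h6 := le_abs_self ((G w - G (ρ w)) * ⟪z, w⟫)
    rw [abs_mul] at h6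
    have h7 := mul_le_mul_of_nonneg_right h4 (abs_nonneg ⟪z, w⟫)
    have h8 := abs_mul_abs_self ⟪z, w⟫
    have h9 : K₂ * |⟪z, w⟫| ≤ K₂ * 1 := mul_le_mul_of_nonneg_left h5 hK₂
    have h10 : (K₁ * (2 * |⟪z, w⟫|) + K₂) * |⟪z, w⟫| =
        2 * K₁ * ⟪z, w⟫ ^ 2 + K₂ * |⟪z, w⟫| := by
      rw [sq, ← h8]; ring
    simp only [G', SimpleFunc.coe_comp, Function.comp_apply]
    rw [← sub_mul]
    linarith
  rw [integral_add (hI.const_mul _) (hc.const_mul _), integral_const_mul, integral_const_mul,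
    setIntegral_const, smul_eq_mul, mul_one] at h3
  have : 0 ≤ K₂ * volume.real B := by positivity
  linarith

/-- Coarse sections need not be measurable. Composed with a finite-valued approximation of the
identity they become simple functions. -/
theorem exists_simpleFunc_norm_sub_le (R : ℝ) :
    ∃ q : SimpleFunc (EuclideanSpace ℝ (Fin n)) (EuclideanSpace ℝ (Fin n)),
      ∀ w ∈ Metric.ball (0 : EuclideanSpace ℝ (Fin n)) R, ‖q w - w‖ ≤ 1 := by
  obtain ⟨s, hs, hcov⟩ := Metric.totallyBounded_iff.1
    (isCompact_closedBall (0 : EuclideanSpace ℝ (Fin n)) R).totallyBounded 1 one_pos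
  obtain ⟨u, hu⟩ := TopologicalSpace.exists_dense_seq (EuclideanSpace ℝ (Fin n))
  rcases s.eq_empty_or_nonempty with rfl | hne
  · refine ⟨SimpleFunc.const _ 0, fun w hw => ?_⟩
    simpa using hcov (Metric.ball_subset_closedBall hw)
  obtain ⟨m, t, rfl⟩ : ∃ (m : ℕ) (t : ℕ → EuclideanSpace ℝ (Fin n)), s = t '' Set.Iic m := by
    obtain ⟨x₀, hx₀⟩ := hne
    let l := hs.toFinset.toList
    refine ⟨l.length, fun i => l.getD i x₀, ?_⟩
    ext x
    constructor
    · intro hx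
      have : x ∈ l := by simpa [l] using hx
      obtain ⟨i, hi, rfl⟩ := List.getElem_of_mem this
      exact ⟨i, hi.le, by simp [hi]⟩
    · rintro ⟨i, -, rfl⟩
      by_cases hi : i < l.length
      · have : l[i] ∈ l := List.getElem_mem hi
        simp only [List.getD_eq_getElem _ _ hi]
        exact hs.mem_toFinset.1 (Finset.mem_toList.1 this)
      · simp only [List.getD_eq_default _ _ (not_lt.1 hi)]
        exact hx₀
  refine ⟨SimpleFunc.nearestPt t m, fun w hw => ?_⟩
  obtain ⟨_, ⟨k, hk, rfl⟩, hw'⟩ := Set.mem_iUnion₂.1 (hcov (Metric.ball_subset_closedBall hw))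
  have h1 := SimpleFunc.edist_nearestPt_le t w (k := k) (N := m) hk
  rw [edist_dist, edist_dist, ENNReal.ofReal_le_ofReal_iff dist_nonneg] at h1
  rw [← dist_eq_norm]
  rw [Metric.mem_ball, dist_comm] at hw'
  exact h1.trans hw'.le

/-- A finite sum over the values of `σ` can be exchanged with the integral over projectors without
joint measurability of a lift. -/
theorem integral_ball_inner_simpleFunc {A : Type*} (σ : SimpleFunc (EuclideanSpace ℝ (Fin n)) A)
    (g : A → EuclideanSpace ℝ (Fin n)) :
    ∫ w in Metric.ball 0 1, ⟪g (σ w), w⟫ =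
      ∑ x ∈ σ.range, ⟪g x, ∫ w in Metric.ball 0 1 ∩ σ ⁻¹' {x}, w⟫ := by
  classical
  have h1 : ∀ w, ⟪g (σ w), w⟫ = ∑ x ∈ σ.range, (σ ⁻¹' {x}).indicator (fun w => ⟪g x, w⟫) w :=
    fun w => by
      rw [Finset.sum_eq_single (σ w) (fun x _ hx => Set.indicator_of_notMem (fun h => hx h.symm) _)
        (fun h => absurd (σ.mem_range_self w) h)]
      exact (Set.indicator_of_mem (by simp) _).symm
  have h2 : ∀ x, IntegrableOn (fun w : EuclideanSpace ℝ (Fin n) => ⟪g x, w⟫) (Metric.ball 0 1) :=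
    fun x => Continuous.integrableOn_unit_ball (continuous_const.inner continuous_id)
  simp_rw [h1]
  rw [integral_finsetSum _ fun x _ => (h2 x).indicator (σ.measurableSet_preimage {x})]
  refine Finset.sum_congr rfl fun x _ => ?_
  rw [integral_indicator (σ.measurableSet_preimage {x}),
    Measure.restrict_restrict (σ.measurableSet_preimage {x}), Set.inter_comm]
  exact integral_inner ((Continuous.integrableOn_unit_ball continuous_id).mono_set
    Set.inter_subset_left) _

end Reflection

/-! ### The lower bound for lifted dilations -/

section LowerBound

open scoped RealInnerProductSpace

variable {V : Type*} [NormedAddCommGroup V] [NormedSpace ℝ V] [FiniteDimensional ℝ V] {n : ℕ}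
  {e : V ≃L[ℝ] EuclideanSpace ℝ (Fin n)} {A : Type*} {dA : A → A → ℝ}

/-- The coarse divergence theorem for lifts. -/
theorem IsLift.le_integral_lipConst (hn : n ≠ 0) (hA : ∀ a a', a ≠ a' → 0 < dA a a')
    (hA0 : ∀ a, dA a a = 0) {f : A → V} {s : V → A} {C₀ : ℝ} (hs : ∀ v, ‖e (f (s v)) - e v‖ ≤ C₀)
    (hd : ∀ ε > 0, ∃ C, ∀ v w, dA (s v) (s w) ≤ (1 + ε) * ‖e v - e w‖ + C)
    {μ : Measure (AxialProjector (formNorm (euclideanForm e)))}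
    {F : AxialProjector (formNorm (euclideanForm e)) → A → ℝ} (hF : IsLift dA μ f F)
    (hfin : ∀ᵐ p ∂μ, lipConst dA dist (F p) ≠ ⊤)
    (hint : Integrable (fun p => (lipConst dA dist (F p)).toReal) μ) :
    (n : ℝ) ≤ ∫ p, (lipConst dA dist (F p)).toReal ∂μ := by
  have : CompleteSpace V := FiniteDimensional.complete ℝ V
  set I := ∫ p, (lipConst dA dist (F p)).toReal ∂μ with hI
  have hI0 : 0 ≤ I := integral_nonneg fun _ => ENNReal.toReal_nonneg
  set m := ∫ w in Metric.ball (0 : EuclideanSpace ℝ (Fin n)) 1, ‖w‖ ^ 2 with hm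
  have hm0 : 0 < m := integral_ball_norm_sq_pos hn
  have hn0 : (0 : ℝ) < n := by exact_mod_cast Nat.pos_of_ne_zero hn
  set b := volume.real (Metric.ball (0 : EuclideanSpace ℝ (Fin n)) 1) with hb
  have hb0 : 0 ≤ b := measureReal_nonneg
  have hC₀ : 0 ≤ C₀ := (norm_nonneg _).trans (hs 0)
  -- Both sides estimate `∫ ⟪e (f (σ w)), w⟫` over the unit ball, where `f` sends `σ w` to within
  -- `C₀ + 1` of `R w`; this gives the left side. On the right the lift is inserted: `F p ∘ σ` is
  -- coarsely Lipschitz with constant `Lip (F p) (1 + ε) R`, and the reflection estimate applies in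
  -- the direction `u_p`, whose second moment is `m / n`.
  have key : ∀ ε > 0, ∃ C', ∀ R > 0, R * m - (C₀ + 1) * b ≤ I * ((1 + ε) * R * (m / n) + C' * b) := by
    intro ε hε
    obtain ⟨C₁, hC₁⟩ := hd ε hε
    refine ⟨2 * (1 + ε) + |C₁|, fun R hR => ?_⟩
    obtain ⟨q, hq⟩ := exists_simpleFunc_norm_sub_le (n := n) R
    let σ : SimpleFunc (EuclideanSpace ℝ (Fin n)) A :=
      (q.comp (fun w => R • w) (by fun_prop)).map (fun x => s (e.symm x))
    have hσ : ∀ w, σ w = s (e.symm (q (R • w))) := fun w => rfl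
    have hRw : ∀ w ∈ Metric.ball (0 : EuclideanSpace ℝ (Fin n)) 1,
        R • w ∈ Metric.ball (0 : EuclideanSpace ℝ (Fin n)) R := fun w hw => by
      rw [mem_ball_zero_iff] at hw ⊢
      rw [norm_smul, Real.norm_of_nonneg hR.le]
      nlinarith
    let M : A → EuclideanSpace ℝ (Fin n) := fun x => ∫ w in Metric.ball 0 1 ∩ σ ⁻¹' {x}, w
    let L : A → V →L[ℝ] ℝ := fun x =>
      (innerSL ℝ (M x)).comp (e : V →L[ℝ] EuclideanSpace ℝ (Fin n))
    have hL : ∀ x v, L x v = ⟪e v, M x⟫ := fun x v => by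
      simp [L, real_inner_comm]
    have hLi : ∀ x, Integrable (fun p => L x (F p x • p.vec)) μ := fun x =>
      (L x).integrable_comp (hF.integrable x)
    have hLe : ∀ x, ∫ p, L x (F p x • p.vec) ∂μ = ⟪e (f x), M x⟫ := fun x => by
      rw [(L x).integral_comp_comm (hF.integrable x), hF.integral_eq, hL]
    have hΦ : ∀ p : AxialProjector (formNorm (euclideanForm e)),
        ∑ x ∈ σ.range, L x (F p x • p.vec) = ∫ w in Metric.ball 0 1, F p (σ w) * ⟪e p.vec, w⟫ := by
      intro p
      have := integral_ball_inner_simpleFunc σ (fun x => F p x • e p.vec)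
      simp only [real_inner_smul_left] at this
      rw [this]
      refine Finset.sum_congr rfl fun x _ => ?_
      rw [hL, map_smul, real_inner_smul_left]
    have h1 : ∫ p, ∑ x ∈ σ.range, L x (F p x • p.vec) ∂μ =
        ∫ w in Metric.ball 0 1, ⟪e (f (σ w)), w⟫ := by
      rw [integral_finsetSum _ fun x _ => hLi x, integral_ball_inner_simpleFunc σ (fun x => e (f x))]
      exact Finset.sum_congr rfl fun x _ => hLe x
    have h2 : R * m - (C₀ + 1) * b ≤ ∫ w in Metric.ball 0 1, ⟪e (f (σ w)), w⟫ := by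
      have i1 : IntegrableOn (fun w : EuclideanSpace ℝ (Fin n) => ‖w‖ ^ 2) (Metric.ball 0 1) :=
        Continuous.integrableOn_unit_ball (by fun_prop)
      have i2 : IntegrableOn (fun _ : EuclideanSpace ℝ (Fin n) => (1 : ℝ)) (Metric.ball 0 1) :=
        Continuous.integrableOn_unit_ball continuous_const
      have i3 : IntegrableOn (fun w => ⟪e (f (σ w)), w⟫) (Metric.ball 0 1) := by
        obtain ⟨c, hc⟩ := (σ.map fun x => e (f x)).exists_forall_norm_le
        refine (i2.const_mul c).mono' (((σ.map fun x =>
          e (f x)).stronglyMeasurable.aestronglyMeasurable).inner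
          continuous_id.aestronglyMeasurable) ?_
        refine (ae_restrict_iff' measurableSet_ball).2 (Eventually.of_forall fun w hw => ?_)
        rw [mem_ball_zero_iff] at hw
        refine (norm_inner_le_norm _ _).trans ?_
        exact mul_le_mul (hc w) hw.le (norm_nonneg _) ((norm_nonneg _).trans (hc w))
      have h3 : ∫ w in Metric.ball (0 : EuclideanSpace ℝ (Fin n)) 1, (R * ‖w‖ ^ 2 - (C₀ + 1) * 1) ≤
          ∫ w in Metric.ball 0 1, ⟪e (f (σ w)), w⟫ := by
        refine setIntegral_mono_on ((i1.const_mul R).sub (i2.const_mul _)) i3 measurableSet_ball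
          fun w hw => ?_
        have e1 : ‖e (f (σ w)) - R • w‖ ≤ C₀ + 1 := by
          have e2 := hs (e.symm (q (R • w)))
          rw [e.apply_symm_apply] at e2
          have e3 := norm_sub_le_norm_sub_add_norm_sub (e (f (σ w))) (q (R • w)) (R • w)
          have e4 := hq _ (hRw w hw)
          rw [hσ] at e3 ⊢
          linarith
        have e5 : ⟪e (f (σ w)), w⟫ = ⟪e (f (σ w)) - R • w, w⟫ + R * ‖w‖ ^ 2 := by
          rw [inner_sub_left, real_inner_smul_left, real_inner_self_eq_norm_sq]; ring
        have e6 := neg_le_of_abs_le (abs_real_inner_le_norm (e (f (σ w)) - R • w) w)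
        have e7 : ‖e (f (σ w)) - R • w‖ * ‖w‖ ≤ (C₀ + 1) * 1 := by
          rw [mem_ball_zero_iff] at hw
          exact mul_le_mul e1 hw.le (norm_nonneg _) (by positivity)
        linarith
      rw [integral_sub (i1.const_mul R) (i2.const_mul _), integral_const_mul, integral_const_mul,
        setIntegral_const, smul_eq_mul, mul_one] at h3
      exact h3
    rw [← h1] at h2
    refine h2.trans ?_
    rw [hI, ← integral_mul_const]
    refine integral_mono_ae (integrable_finsetSum _ fun x _ => hLi x) (hint.mul_const _) ?_
    filter_upwards [hfin] with p hp
    simp only [hΦ]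
    set l := (lipConst dA dist (F p)).toReal with hl
    have hl0 : 0 ≤ l := ENNReal.toReal_nonneg
    have h5 := integral_ball_mul_inner_le (z := e p.vec) p.norm_vec (σ.map (F p))
      (K₁ := l * ((1 + ε) * R)) (K₂ := l * (2 * (1 + ε) + |C₁|)) (by positivity)
      (fun w hw w' hw' => by
        have e1 := le_lipConst_mul (dB := dist) hA hA0 (fun b => dist_self b) hp (σ w) (σ w')
        rw [Real.dist_eq] at e1
        have e2 := hC₁ (e.symm (q (R • w))) (e.symm (q (R • w')))
        rw [e.apply_symm_apply, e.apply_symm_apply] at e2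
        have e3 : ‖q (R • w) - q (R • w')‖ ≤ R * ‖w - w'‖ + 2 := by
          have e4 : q (R • w) - q (R • w') =
              R • (w - w') + ((q (R • w) - R • w) - (q (R • w') - R • w')) := by
            rw [smul_sub]; abel
          have e5 := hq _ (hRw w hw)
          have e6 := hq _ (hRw w' hw')
          rw [e4]
          refine (norm_add_le _ _).trans ?_
          rw [norm_smul, Real.norm_of_nonneg hR.le]
          have := norm_sub_le (q (R • w) - R • w) (q (R • w') - R • w')
          linarith
        refine e1.trans ?_
        have e7 : dA (σ w) (σ w') ≤ (1 + ε) * (R * ‖w - w'‖ + 2) + |C₁| := by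
          rw [hσ, hσ]
          have := mul_le_mul_of_nonneg_left e3 (by linarith : 0 ≤ 1 + ε)
          linarith [le_abs_self C₁]
        have := mul_le_mul_of_nonneg_left e7 hl0
        linarith)
    have h6 : ∫ w in Metric.ball (0 : EuclideanSpace ℝ (Fin n)) 1, ⟪e p.vec, w⟫ ^ 2 = m / n := by
      rw [eq_div_iff hn0.ne', mul_comm]
      exact integral_ball_inner_sq p.norm_vec
    rw [h6] at h5
    simp only [SimpleFunc.coe_map, Function.comp_apply] at h5
    linarith
  -- Divide `key` by `R` and let `R` grow.
  have key2 : ∀ ε > 0, (n : ℝ) ≤ (1 + ε) * I := by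
    intro ε hε
    obtain ⟨C', hC'⟩ := key ε hε
    by_contra! hlt
    have hδ : 0 < (n - (1 + ε) * I) * (m / n) := mul_pos (by linarith) (div_pos hm0 hn0)
    set δ := (n - (1 + ε) * I) * (m / n) with hδ'
    set K := |I * C' * b| + (C₀ + 1) * b + 1 with hK
    have hK0 : 0 < K := by positivity
    have h1 := hC' (K / δ) (by positivity)
    have h2 : K / δ * δ = K := by field_simp
    have h3 : m = n * (m / n) := by field_simp
    have h4 : K / δ * m - I * ((1 + ε) * (K / δ) * (m / n)) = K := by
      conv_rhs => rw [← h2]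
      conv_lhs => enter [1]; rw [h3]
      rw [hδ']; ring
    have := le_abs_self (I * C' * b)
    nlinarith
  refine le_of_forall_pos_le_add fun ε hε => ?_
  have h1 := key2 (ε / (I + 1)) (by positivity)
  have h2 : ε / (I + 1) * I ≤ ε := by
    rw [div_mul_eq_mul_div, div_le_iff₀ (by positivity)]
    nlinarith
  linarith

/-- The lower bound of the lifted dilation of coarse sections. -/
theorem le_minTildeDilL2 (hn : n ≠ 0) (hA : ∀ a a', a ≠ a' → 0 < dA a a')
    (hA0 : ∀ a, dA a a = 0) {f : A → V} {s : V → A} {C₀ : ℝ} (hs : ∀ v, ‖e (f (s v)) - e v‖ ≤ C₀)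
    (hd : ∀ ε > 0, ∃ C, ∀ v w, dA (s v) (s w) ≤ (1 + ε) * ‖e v - e w‖ + C) :
    (n : ℝ≥0∞) ^ (1 / 2 : ℝ) ≤ minTildeDilL2 dA (formNorm (euclideanForm e)) f := by
  refine le_iInf₂ fun μ hμ => le_iInf₂ fun F hF => ENNReal.rpow_le_rpow ?_ (by norm_num)
  by_cases htop : ∫⁻ p, lipConst dA dist (F p) ^ 2 ∂μ = ⊤
  · rw [htop]; exact le_top
  have hfinm : IsFiniteMeasure μ := ⟨by rw [hμ.measure_univ]; exact ENNReal.natCast_lt_top n⟩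
  have hfin : ∀ᵐ p ∂μ, lipConst dA dist (F p) ≠ ⊤ := by
    filter_upwards [ae_lt_top' (hF.aemeasurable_lip.pow_const 2) htop] with p hp h
    rw [h] at hp
    simp at hp
  set L := fun p => (lipConst dA dist (F p)).toReal with hL
  have hLm : AEMeasurable L μ := hF.aemeasurable_lip.ennreal_toReal
  have hsq : ∀ᵐ p ∂μ, ENNReal.ofReal (L p ^ 2) = lipConst dA dist (F p) ^ 2 := by
    filter_upwards [hfin] with p hp
    rw [ENNReal.ofReal_pow ENNReal.toReal_nonneg, ENNReal.ofReal_toReal hp]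
  have h2 : Integrable (fun p => L p ^ 2) μ := by
    refine ⟨(hLm.pow_const 2).aestronglyMeasurable, ?_⟩
    rw [hasFiniteIntegral_iff_ofReal (Eventually.of_forall fun p => by positivity),
      lintegral_congr_ae hsq]
    exact lt_top_iff_ne_top.2 htop
  have h1 : Integrable L μ := by
    refine (h2.add (integrable_const 1)).mono' hLm.aestronglyMeasurable
      (Eventually.of_forall fun p => ?_)
    rw [Real.norm_of_nonneg ENNReal.toReal_nonneg]
    simp only [Pi.add_apply]
    nlinarith [sq_nonneg (L p - 1)]
  have h3 := hF.le_integral_lipConst hn hA hA0 hs hd hfin h1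
  -- In place of Cauchy–Schwarz: `2 L - 1 ≤ L²`, total mass `n` and `∫ L ≥ n` give `∫ L² ≥ 2 n - n`.
  have h4 : ∫ p, (2 * L p - 1) ∂μ ≤ ∫ p, L p ^ 2 ∂μ :=
    integral_mono ((h1.const_mul 2).sub (integrable_const 1)) h2 fun p => by
      nlinarith [sq_nonneg (L p - 1)]
  rw [integral_sub (h1.const_mul 2) (integrable_const 1), integral_const_mul, integral_const,
    smul_eq_mul, mul_one, measureReal_def, hμ.measure_univ, ENNReal.toReal_natCast] at h4
  rw [← lintegral_congr_ae hsq, ← ofReal_integral_eq_lintegral_ofReal h2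
    (Eventually.of_forall fun p => by positivity), ← ENNReal.ofReal_natCast]
  exact ENNReal.ofReal_le_ofReal (by linarith)

omit [FiniteDimensional ℝ V] in
theorem normDist_formNorm_pos (a a' : V) (h : a ≠ a') :
    0 < normDist (formNorm (euclideanForm e)) a a' :=
  formNorm_euclideanForm_pos e _ (vsub_ne_zero.2 h)

/-- The forms of the projectors are a lift of the identity with Lipschitz constants 1, and the
identity is its own coarse section. -/
theorem minTildeDilL2_id (hn : n ≠ 0) :
    minTildeDilL2 (normDist (formNorm (euclideanForm e))) (formNorm (euclideanForm e))
      (id : V → V) = (n : ℝ≥0∞) ^ (1 / 2 : ℝ) := by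
  refine le_antisymm ?_ ?_
  · obtain ⟨μ, hμ⟩ := exists_isPartitionOfUnity e
    have hfinm : IsFiniteMeasure μ := ⟨by rw [hμ.measure_univ]; exact ENNReal.natCast_lt_top n⟩
    have hlip : ∀ p : AxialProjector (formNorm (euclideanForm e)),
        lipConst (normDist (formNorm (euclideanForm e))) dist (fun a => p.form a) = 1 := fun p => by
      refine le_antisymm (lipConst_form_le_one (formNorm_euclideanForm_pos e) p.2.2.2) ?_
      have hv : p.vec ≠ 0 := fun h => by simpa [h] using p.form_vec
      refine le_trans (le_of_eq ?_) (le_lipConst hv)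
      rw [normDist_formNorm_euclideanForm, map_zero, map_zero, sub_zero, p.norm_vec, p.form_vec]
      simp
    refine iInf₂_le_of_le μ hμ (iInf₂_le_of_le (fun p a => p.form a) ⟨fun a => ?_, ?_, fun a =>
      (hμ a).1, fun a => (hμ a).2⟩ (lintegral_sq_le_of_ae_le_one hμ
        (Eventually.of_forall fun p => (hlip p).le)))
    · exact MemLp.of_bound ((AxialProjector.continuous_form.clm_apply
        continuous_const).aestronglyMeasurable) ‖e a‖ (Eventually.of_forall fun p => p.abs_form_le a)
    · simp only [hlip]
      exact aemeasurable_const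
  · refine le_minTildeDilL2 (s := id) (C₀ := 0) hn normDist_formNorm_pos (fun a => ?_)
      (fun v => by simp) fun ε hε => ⟨0, fun v w => ?_⟩
    · exact (normDist_formNorm_euclideanForm e a a).trans (by simp)
    · refine (normDist_formNorm_euclideanForm e v w).trans_le ?_
      nlinarith [norm_nonneg (e v - e w)]

end LowerBound

/-! ### Averaging over the isometries of the contact set -/

section InvariantMeasure

open scoped RealInnerProductSpace

variable {E : Type*} [NormedAddCommGroup E] [InnerProductSpace ℝ E]

/-- The linear isometries that preserve a set. -/
def isometricEndomorphisms (Z : Set E) : Set (E →L[ℝ] E) :=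
  {A | (∀ x, ‖A x‖ = ‖x‖) ∧ ∀ z ∈ Z, A z ∈ Z}

/-- The group of the linear isometries that preserve a set. -/
def isometryGroup (Z : Set E) : Subgroup (E →L[ℝ] E)ˣ where
  carrier := {A | (A : E →L[ℝ] E) ∈ isometricEndomorphisms Z ∧
    ((A⁻¹ : (E →L[ℝ] E)ˣ) : E →L[ℝ] E) ∈ isometricEndomorphisms Z}
  mul_mem' := by
    rintro A B ⟨hA, hA'⟩ ⟨hB, hB'⟩
    refine ⟨⟨fun x => ?_, fun z hz => ?_⟩, ⟨fun x => ?_, fun z hz => ?_⟩⟩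
    · simp [hA.1, hB.1]
    · simpa using hA.2 _ (hB.2 z hz)
    · simp [hA'.1, hB'.1]
    · simpa using hB'.2 _ (hA'.2 z hz)
  one_mem' := by simp [isometricEndomorphisms]
  inv_mem' := by
    rintro A ⟨hA, hA'⟩
    exact ⟨hA', by simpa using hA⟩

variable [FiniteDimensional ℝ E] {Z : Set E}

theorem isCompact_isometricEndomorphisms (hZ : IsClosed Z) :
    IsCompact (isometricEndomorphisms Z) := by
  have : ProperSpace (E →L[ℝ] E) := FiniteDimensional.proper_real _
  have hev : ∀ x : E, Continuous fun A : E →L[ℝ] E => A x := fun x =>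
    continuous_id.clm_apply continuous_const
  refine Metric.isCompact_of_isClosed_isBounded ?_ (isBounded_iff_forall_norm_le.2 ⟨1, ?_⟩)
  · have : isometricEndomorphisms Z =
        (⋂ x, {A : E →L[ℝ] E | ‖A x‖ = ‖x‖}) ∩ ⋂ z ∈ Z, {A : E →L[ℝ] E | A z ∈ Z} := by
      ext A; simp [isometricEndomorphisms]
    rw [this]
    exact (isClosed_iInter fun x => isClosed_eq (hev x).norm continuous_const).inter
      (isClosed_biInter fun z _ => hZ.preimage (hev z))
  · intro A hA
    exact A.opNorm_le_bound zero_le_one fun x => by rw [hA.1, one_mul]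

/-- The condition bears on `g` and `g⁻¹` alike, so the group is the preimage of a compact product
under the closed embedding of the units by `g ↦ (g, g⁻¹)`. -/
theorem compactSpace_isometryGroup (hZ : IsClosed Z) : CompactSpace (isometryGroup Z) := by
  have hC := isCompact_isometricEndomorphisms hZ
  have : ((isometryGroup Z : Subgroup (E →L[ℝ] E)ˣ) : Set (E →L[ℝ] E)ˣ) =
      Units.embedProduct (E →L[ℝ] E) ⁻¹' (isometricEndomorphisms Z ×ˢ
        (MulOpposite.opHomeomorph '' isometricEndomorphisms Z)) := by
    ext A
    simp only [Set.mem_preimage, Set.mem_prod, Set.mem_image]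
    refine ⟨fun h => ⟨h.1, _, h.2, rfl⟩, ?_⟩
    rintro ⟨h1, B, hB, hBA⟩
    refine ⟨h1, ?_⟩
    have : B = ((A⁻¹ : (E →L[ℝ] E)ˣ) : E →L[ℝ] E) := MulOpposite.op_injective hBA
    rwa [← this]
  refine isCompact_iff_compactSpace.1 ?_
  rw [this]
  exact Units.isClosedEmbedding_embedProduct.isCompact_preimage
    (hC.prod (hC.image MulOpposite.opHomeomorph.continuous))

variable [MeasurableSpace E] [BorelSpace E]

/-- Averaging of a decomposition of the identity. -/
theorem exists_invariant_measure (hZ : IsClosed Z) {ι : Type*} [Fintype ι] {z : ι → E} {c : ι → ℝ}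
    (hz : ∀ i, z i ∈ Z) (hZ1 : ∀ z ∈ Z, ‖z‖ = 1) (hc : ∀ i, 0 ≤ c i)
    (h : ∀ w, ∑ i, (c i * ⟪z i, w⟫) • z i = w) :
    ∃ m : Measure Z, IsFiniteMeasure m ∧ (∀ w : E, ∫ ζ : Z, ⟪(ζ : E), w⟫ • (ζ : E) ∂m = w) ∧
      ∀ (O : E ≃ₗᵢ[ℝ] E) (hO : ∀ ζ : Z, O ζ ∈ Z), (∀ ζ : Z, O.symm ζ ∈ Z) →
        m.map (fun ζ : Z => (⟨O ζ, hO ζ⟩ : Z)) = m := by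
  have := compactSpace_isometryGroup hZ
  let : MeasurableSpace (isometryGroup Z) := borel _
  have : BorelSpace (isometryGroup Z) := ⟨rfl⟩
  let ν : Measure (isometryGroup Z) := Measure.haarMeasure ⊤
  have hν1 : ν Set.univ = 1 := Measure.haarMeasure_self (K₀ := ⊤)
  have hνp : IsProbabilityMeasure ν := ⟨hν1⟩
  -- The measure is the sum of the images of Haar probability under `g ↦ g (z i)`, weighted by `c
  -- i`. For each fixed `g` the vectors `g (z i)` still decompose the identity; invariance is left
  -- invariance of Haar measure.
  let φ : ι → isometryGroup Z → Z := fun i g => ⟨(g : (E →L[ℝ] E)ˣ).val (z i), g.2.1.2 _ (hz i)⟩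
  have hφ : ∀ i, Continuous (φ i) := fun i => by
    refine Continuous.subtype_mk ?_ _
    exact (Units.continuous_val.comp continuous_subtype_val).clm_apply continuous_const
  have hpow : ∀ (i) (w : E), ∫ ζ : Z, ⟪(ζ : E), w⟫ • (ζ : E) ∂(ν.map (φ i)) =
      ∫ g, ⟪(φ i g : E), w⟫ • (φ i g : E) ∂ν := fun i w =>
    integral_map (hφ i).measurable.aemeasurable (by
      have : Continuous fun ζ : Z => ⟪(ζ : E), w⟫ • (ζ : E) := by fun_prop
      exact this.aestronglyMeasurable)
  have hint : ∀ (i) (w : E), Integrable (fun g => ⟪(φ i g : E), w⟫ • (φ i g : E)) ν := fun i w => by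
    have hc : Continuous fun g => ⟪(φ i g : E), w⟫ • (φ i g : E) := by
      have := hφ i
      fun_prop
    refine Integrable.of_bound hc.aestronglyMeasurable ‖w‖ (Eventually.of_forall fun g => ?_)
    have h1 := hZ1 _ (φ i g).2
    rw [norm_smul, h1, mul_one]
    refine (norm_inner_le_norm _ _).trans ?_
    rw [h1, one_mul]
  refine ⟨∑ i, ENNReal.ofReal (c i) • ν.map (φ i), ?_, fun w => ?_, fun O hO hO' => ?_⟩
  · have : ∀ i, IsFiniteMeasure (ENNReal.ofReal (c i) • ν.map (φ i)) := fun i =>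
      Measure.smul_finite _ ENNReal.ofReal_ne_top
    infer_instance
  · have hi : ∀ i ∈ Finset.univ, Integrable (fun ζ : Z => ⟪(ζ : E), w⟫ • (ζ : E))
        (ENNReal.ofReal (c i) • ν.map (φ i)) := fun i _ => by
      refine Integrable.smul_measure ?_ ENNReal.ofReal_ne_top
      have hcZ : Continuous fun ζ : Z => ⟪(ζ : E), w⟫ • (ζ : E) := by fun_prop
      exact (integrable_map_measure hcZ.aestronglyMeasurable (hφ i).measurable.aemeasurable).2
        (hint i w)
    rw [integral_finsetSum_measure hi]
    have h1 : ∀ i, ∫ ζ : Z, ⟪(ζ : E), w⟫ • (ζ : E) ∂(ENNReal.ofReal (c i) • ν.map (φ i)) =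
        ∫ g, c i • (⟪(φ i g : E), w⟫ • (φ i g : E)) ∂ν := fun i => by
      rw [integral_smul_measure, hpow, ENNReal.toReal_ofReal (hc i), integral_smul]
    simp_rw [h1]
    rw [← integral_finsetSum (f := fun i g => c i • (⟪(φ i g : E), w⟫ • (φ i g : E))) _
      fun i _ => (hint i w).smul (c i)]
    have h2 : ∀ g : isometryGroup Z, ∑ i, c i • (⟪(φ i g : E), w⟫ • (φ i g : E)) = w := fun g => by
      let A : (E →L[ℝ] E)ˣ := g
      have hA : ∀ x, (A : E →L[ℝ] E) (((A⁻¹ : (E →L[ℝ] E)ˣ) : E →L[ℝ] E) x) = x := fun x => by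
        rw [← mul_apply_eq_comp, ← Units.val_mul, mul_inv_cancel]; rfl
      have hin : ∀ x y, ⟪(A : E →L[ℝ] E) x, (A : E →L[ℝ] E) y⟫ = ⟪x, y⟫ :=
        (LinearMap.norm_map_iff_inner_map_map (A : E →L[ℝ] E)).1 g.2.1.1
      have h3 := congrArg (A : E →L[ℝ] E) (h (((A⁻¹ : (E →L[ℝ] E)ˣ) : E →L[ℝ] E) w))
      rw [hA, map_sum] at h3
      refine Eq.trans (Finset.sum_congr rfl fun i _ => ?_) h3
      rw [map_smul, smul_smul, ← hin (z i), hA]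
    simp_rw [h2]
    simp
  · let k : isometryGroup Z := ⟨⟨O.toContinuousLinearEquiv, O.symm.toContinuousLinearEquiv,
      by ext x; simp, by ext x; simp⟩, ⟨fun x => O.norm_map x, fun ζ hζ => hO ⟨ζ, hζ⟩⟩,
      ⟨fun x => O.symm.norm_map x, fun ζ hζ => hO' ⟨ζ, hζ⟩⟩⟩
    have hOm : Measurable fun ζ : Z => (⟨O ζ, hO ζ⟩ : Z) :=
      ((O.continuous.comp continuous_subtype_val).subtype_mk _).measurable
    rw [Measure.map_finset_sum hOm.aemeasurable]
    refine Finset.sum_congr rfl fun i _ => ?_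
    rw [Measure.map_smul, Measure.map_map hOm (hφ i).measurable]
    congr 1
    have h1 : (fun ζ : Z => (⟨O ζ, hO ζ⟩ : Z)) ∘ φ i = φ i ∘ fun g => k * g := by
      ext g
      rfl
    rw [h1, ← Measure.map_map (hφ i).measurable (measurable_const_mul k), map_mul_left_eq_self]

end InvariantMeasure

/-! ### Contact directions as axial projectors -/

section ContactSet

open scoped RealInnerProductSpace

variable {V : Type*} [NormedAddCommGroup V] [NormedSpace ℝ V] {n : ℕ}

/-- The unit vectors whose orthogonal projectors are dominated by the norm `N`. -/
def contactSet (e : V ≃L[ℝ] EuclideanSpace ℝ (Fin n)) (N : Seminorm ℝ V) :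
    Set (EuclideanSpace ℝ (Fin n)) :=
  {z | ‖z‖ = 1 ∧ ∀ y, |⟪z, e y⟫| ≤ N y}

theorem isCompact_contactSet (e : V ≃L[ℝ] EuclideanSpace ℝ (Fin n)) (N : Seminorm ℝ V) :
    IsCompact (contactSet e N) := by
  have : contactSet e N = Metric.sphere 0 1 ∩ ⋂ y, {z | |⟪z, e y⟫| ≤ N y} := by
    ext z; simp [contactSet]
  rw [this]
  exact (isCompact_sphere _ _).inter_right (isClosed_iInter fun y =>
    isClosed_le (continuous_id.inner continuous_const).abs continuous_const)

instance {N : V → ℝ} : T2Space (AxialProjector N) :=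
  inferInstanceAs (T2Space
    {q : V × (V →L[ℝ] ℝ) // N q.1 = 1 ∧ q.2 q.1 = 1 ∧ ∀ y, |q.2 y| ≤ N y})

variable (e : V ≃L[ℝ] EuclideanSpace ℝ (Fin n)) {Z : Set (EuclideanSpace ℝ (Fin n))}

/-- The axial projectors of a set of unit vectors. -/
noncomputable def axialOfSet (hZ : ∀ z ∈ Z, ‖z‖ = 1) (ζ : Z) :
    AxialProjector (formNorm (euclideanForm e)) :=
  AxialProjector.ofUnit e ζ (hZ ζ ζ.2)

theorem axialOfSet_vec (hZ : ∀ z ∈ Z, ‖z‖ = 1) (ζ : Z) :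
    (axialOfSet e hZ ζ).vec = e.symm ζ := rfl

/-- A continuous injection of a compact space into a Hausdorff one. With an embedding, integrals and
almost everywhere statements pass to the image measure with no measurability conditions on the
functions. -/
theorem measurableEmbedding_axialOfSet (hZc : IsCompact Z) (hZ : ∀ z ∈ Z, ‖z‖ = 1) :
    MeasurableEmbedding (axialOfSet e hZ) := by
  have : CompactSpace Z := isCompact_iff_compactSpace.1 hZc
  have hc : Continuous (axialOfSet e hZ) := by
    refine Continuous.subtype_mk (Continuous.prodMk ?_ ?_) _
    · exact e.symm.continuous.comp continuous_subtype_val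
    · exact ((innerSL ℝ).continuous.comp continuous_subtype_val).clm_comp continuous_const
  refine (hc.isClosedEmbedding fun ζ ζ' h => Subtype.ext (e.symm.injective ?_)).measurableEmbedding
  rw [← axialOfSet_vec e hZ, ← axialOfSet_vec e hZ, h]

variable {e} [FiniteDimensional ℝ V] {m : Measure Z} [IsFiniteMeasure m]

theorem isPartitionOfUnity_map_axialOfSet (hZc : IsCompact Z) (hZ : ∀ z ∈ Z, ‖z‖ = 1)
    (hm : ∀ w, ∫ ζ : Z, ⟪(ζ : EuclideanSpace ℝ (Fin n)), w⟫ • (ζ : EuclideanSpace ℝ (Fin n)) ∂m = w) :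
    IsPartitionOfUnity (m.map (axialOfSet e hZ)) := by
  have : CompactSpace Z := isCompact_iff_compactSpace.1 hZc
  intro y
  have hψ := measurableEmbedding_axialOfSet e hZc hZ
  have hc : Continuous fun ζ : Z => ⟪(ζ : EuclideanSpace ℝ (Fin n)), e y⟫ •
    (ζ : EuclideanSpace ℝ (Fin n)) := by fun_prop
  have hi : Integrable (fun ζ : Z => ⟪(ζ : EuclideanSpace ℝ (Fin n)), e y⟫ •
    (ζ : EuclideanSpace ℝ (Fin n))) m :=
    hc.integrable_of_hasCompactSupport (HasCompactSupport.of_compactSpace _)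
  have hfun : (fun p : AxialProjector (formNorm (euclideanForm e)) => p.form y • p.vec) ∘
      axialOfSet e hZ = fun ζ : Z => (e.symm : EuclideanSpace ℝ (Fin n) →L[ℝ] V)
        (⟪(ζ : EuclideanSpace ℝ (Fin n)), e y⟫ • (ζ : EuclideanSpace ℝ (Fin n))) := by
    ext ζ
    simp [axialOfSet, AxialProjector.ofUnit, AxialProjector.form, AxialProjector.vec]
  refine ⟨hψ.integrable_map_iff.2 ?_, ?_⟩
  · rw [hfun]
    exact ContinuousLinearMap.integrable_comp _ hi
  · rw [hψ.integral_map]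
    have : CompleteSpace V := FiniteDimensional.complete ℝ V
    refine (congrArg (fun g => ∫ ζ, g ζ ∂m) hfun).trans ?_
    rw [ContinuousLinearMap.integral_comp_comm _ hi, hm]
    simp

theorem isJohnForm_of_measure {N : V → ℝ} (hN : ∀ v, v ≠ 0 → 0 < N v) (hNe : ∀ v, N v ≤ ‖e v‖)
    (hZc : IsCompact Z) (hZ : ∀ z ∈ Z, ‖z‖ = 1) (hZN : ∀ z ∈ Z, ∀ v, |⟪z, e v⟫| ≤ N v)
    (hm : ∀ w, ∫ ζ : Z, ⟪(ζ : EuclideanSpace ℝ (Fin n)), w⟫ • (ζ : EuclideanSpace ℝ (Fin n)) ∂m = w) :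
    IsJohnForm N (euclideanForm e) := by
  refine isJohnForm_of_isPartitionOfUnity hN hNe (isPartitionOfUnity_map_axialOfSet hZc hZ hm) ?_
  exact (measurableEmbedding_axialOfSet e hZc hZ).ae_map_iff.2
    (Eventually.of_forall fun ζ v => hZN ζ ζ.2 v)

end ContactSet

/-! ### The straightened map -/

section Straightening

open scoped RealInnerProductSpace

variable {X V Y : Type*} [MetricSpace X] [NormedAddCommGroup V] [NormedSpace ℝ V]
  [MetricSpace Y] [NormedAddTorsor V Y] {n : ℕ}

/-- The largest 1-Lipschitz function below `x ↦ ⟪z, e (f x -ᵥ o)⟫`. -/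
noncomputable def lipMinorant (f : X → Y) (e : V ≃L[ℝ] EuclideanSpace ℝ (Fin n)) (o : Y)
    (z : EuclideanSpace ℝ (Fin n)) (x : X) : ℝ :=
  ⨅ x', (⟪z, e (f x' -ᵥ o)⟫ + dist x x')

variable {f : X → Y} {N : Seminorm ℝ V} {e : V ≃L[ℝ] EuclideanSpace ℝ (Fin n)} {o : Y} {C : ℝ}
  {z : EuclideanSpace ℝ (Fin n)}

/-- A contact form is dominated by `N`, so the function is 1-Lipschitz up to `C`. Hence the infimum
in `lipMinorant` is finite and loses at most `C`. -/
theorem inner_sub_le_of_mem_contactSet (hC : ∀ x x', N (f x -ᵥ f x') ≤ dist x x' + C)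
    (hz : z ∈ contactSet e N) (x x' : X) :
    ⟪z, e (f x -ᵥ o)⟫ - C ≤ ⟪z, e (f x' -ᵥ o)⟫ + dist x x' := by
  have h1 := (le_abs_self _).trans (hz.2 (f x -ᵥ f x'))
  rw [← vsub_sub_vsub_cancel_right (f x) (f x') o, map_sub, inner_sub_right,
    vsub_sub_vsub_cancel_right] at h1
  linarith [hC x x']

theorem bddBelow_lipMinorant (hC : ∀ x x', N (f x -ᵥ f x') ≤ dist x x' + C)
    (hz : z ∈ contactSet e N) (x : X) :
    BddBelow (Set.range fun x' => ⟪z, e (f x' -ᵥ o)⟫ + dist x x') :=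
  ⟨_, by rintro _ ⟨x', rfl⟩; exact inner_sub_le_of_mem_contactSet hC hz x x'⟩

theorem lipMinorant_le (hC : ∀ x x', N (f x -ᵥ f x') ≤ dist x x' + C)
    (hz : z ∈ contactSet e N) (x : X) : lipMinorant f e o z x ≤ ⟪z, e (f x -ᵥ o)⟫ :=
  (ciInf_le (bddBelow_lipMinorant hC hz x) x).trans (by simp)

theorem le_lipMinorant (hC : ∀ x x', N (f x -ᵥ f x') ≤ dist x x' + C)
    (hz : z ∈ contactSet e N) (x : X) : ⟪z, e (f x -ᵥ o)⟫ - C ≤ lipMinorant f e o z x := by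
  have : Nonempty X := ⟨x⟩
  exact le_ciInf (inner_sub_le_of_mem_contactSet hC hz x)

theorem abs_lipMinorant_sub_le (hC : ∀ x x', N (f x -ᵥ f x') ≤ dist x x' + C)
    (hz : z ∈ contactSet e N) (x x' : X) :
    |lipMinorant f e o z x - lipMinorant f e o z x'| ≤ dist x x' := by
  have : Nonempty X := ⟨x⟩
  have key : ∀ x x', lipMinorant f e o z x - dist x x' ≤ lipMinorant f e o z x' := fun x x' => by
    refine le_ciInf fun x'' => ?_
    have h1 : lipMinorant f e o z x ≤ ⟪z, e (f x'' -ᵥ o)⟫ + dist x x'' :=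
      ciInf_le (bddBelow_lipMinorant hC hz x) x''
    linarith [dist_triangle x x' x'']
  refine abs_le.2 ⟨?_, ?_⟩
  · have := key x' x
    rw [dist_comm] at this
    linarith
  · linarith [key x x']

/-- The minorants are equivariant. -/
theorem lipMinorant_comp (hC : ∀ x x', N (f x -ᵥ f x') ≤ dist x x' + C)
    (hz : z ∈ contactSet e N) (φ : X ≃ X) (hφ : Isometry φ)
    (O : EuclideanSpace ℝ (Fin n) ≃ₗᵢ[ℝ] EuclideanSpace ℝ (Fin n)) (b : EuclideanSpace ℝ (Fin n))
    (hf : ∀ x, e (f (φ x) -ᵥ o) = O (e (f x -ᵥ o)) + b) (x : X) :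
    lipMinorant f e o (O z) (φ x) = lipMinorant f e o z x + ⟪O z, b⟫ := by
  have : Nonempty X := ⟨x⟩
  rw [lipMinorant, lipMinorant, ciInf_add (bddBelow_lipMinorant hC hz x),
    ← φ.surjective.iInf_comp]
  refine iInf_congr fun x' => ?_
  rw [hf, inner_add_right, O.inner_map_map, hφ.dist_eq]
  ring

theorem abs_lipMinorant_sub_inner_le (hC : ∀ x x', N (f x -ᵥ f x') ≤ dist x x' + C)
    (hz : z ∈ contactSet e N) (x : X) :
    |lipMinorant f e o z x - ⟪z, e (f x -ᵥ o)⟫| ≤ C :=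
  abs_le.2 ⟨by linarith [le_lipMinorant (o := o) hC hz x], by
    have h1 := lipMinorant_le (o := o) hC hz x
    have h2 := le_lipMinorant (o := o) hC hz x
    linarith⟩

/-- An infimum of continuous functions of `ζ`, even over an uncountable family, is upper
semicontinuous. -/
theorem measurable_lipMinorant (hC : ∀ x x', N (f x -ᵥ f x') ≤ dist x x' + C) (x : X) :
    Measurable fun ζ : contactSet e N => lipMinorant f e o ζ x := by
  refine UpperSemicontinuous.measurable (upperSemicontinuous_ciInf
    (fun ζ => bddBelow_lipMinorant hC ζ.2 x) fun x' => Continuous.upperSemicontinuous ?_)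
  fun_prop

theorem nonneg_of_le_dist_add [Nonempty X]
    (hC : ∀ x x', N (f x -ᵥ f x') ≤ dist x x' + C) : 0 ≤ C := by
  obtain ⟨x⟩ : Nonempty X := inferInstance
  simpa using hC x x

/-- The Lipschitz constants of the minorants are equal to 1. -/
theorem lipConst_lipMinorant (hf : IsAsymptoticIsometry f N) (hNe : ∀ v, N v ≤ ‖e v‖)
    (hC : ∀ x x', N (f x -ᵥ f x') ≤ dist x x' + C) (hz : z ∈ contactSet e N) (t : ℝ) :
    lipConst dist dist (fun x => lipMinorant f e o z x + t) = 1 := by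
  refine le_antisymm ?_ ?_
  · rw [← ENNReal.ofReal_one]
    refine lipConst_le (fun a a' h => dist_pos.2 h) fun a a' => ?_
    rw [Real.dist_eq, add_sub_add_right_eq_sub, one_mul]
    exact abs_lipMinorant_sub_le hC hz a a'
  · refine le_of_forall_lt fun c hc => ?_
    have hct : c ≠ ⊤ := (hc.trans ENNReal.one_lt_top).ne
    have hcr : c.toReal < 1 := by
      rw [← ENNReal.toReal_one]
      exact (ENNReal.toReal_lt_toReal hct ENNReal.one_ne_top).2 hc
    have hcr0 : 0 ≤ c.toReal := ENNReal.toReal_nonneg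
    obtain ⟨s, B, hB0, -, hs⟩ := hf.exists_section o
    obtain ⟨D, hD⟩ := hf.lower (1 - c.toReal) (by linarith)
    set v := e.symm z with hv
    have hNv : N v ≤ 1 := by
      refine (hNe v).trans ?_
      rw [hv, e.apply_symm_apply, hz.1]
    have hzv : ⟪z, e v⟫ = 1 := by
      rw [hv, e.apply_symm_apply, real_inner_self_eq_norm_sq, hz.1, one_pow]
    -- To exceed the slope `c < 1`, go from `s 0` to `s (r • v)`. The distance is at most `(2 - c)(r
    -- + B) + |D|`, and `c (2 - c) = 1 - (1 - c)²`, so `r (1 - c)²` must outweigh the accumulated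
    -- constants.
    obtain ⟨r, hr⟩ : ∃ r : ℝ, r = (|C| * 2 + B + (2 * B + |D|) + 1) / (1 - c.toReal) ^ 2 :=
      ⟨_, rfl⟩
    have hr0 : 0 < r := by
      rw [hr]
      have : 0 < 1 - c.toReal := by linarith
      positivity
    have hr' : r * (1 - c.toReal) ^ 2 = |C| * 2 + B + (2 * B + |D|) + 1 := by
      have : 0 < 1 - c.toReal := by linarith
      rw [hr]; field_simp
    have h1 := hs (r • v) 0
    rw [sub_zero] at h1
    set w := (f (s (r • v)) -ᵥ f (s 0)) - r • v with hw
    have h2 : f (s (r • v)) -ᵥ f (s 0) = r • v + w := by rw [hw]; abel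
    have h3 : N (f (s (r • v)) -ᵥ f (s 0)) ≤ r + B := by
      rw [h2]
      refine (map_add_le_add N _ _).trans (add_le_add ?_ h1)
      rw [map_smul_eq_mul, Real.norm_of_nonneg hr0.le]
      nlinarith
    have h4 : r - B ≤ ⟪z, e (f (s (r • v)) -ᵥ f (s 0))⟫ := by
      rw [h2, map_add, map_smul, inner_add_right, inner_smul_right, hzv]
      have := (neg_abs_le _).trans' (neg_le_neg ((hz.2 w).trans h1))
      linarith
    have h5 := abs_le.1 (abs_lipMinorant_sub_inner_le (o := o) hC hz (s (r • v)))
    have h6 := abs_le.1 (abs_lipMinorant_sub_inner_le (o := o) hC hz (s 0))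
    have h7 : ⟪z, e (f (s (r • v)) -ᵥ f (s 0))⟫ =
        ⟪z, e (f (s (r • v)) -ᵥ o)⟫ - ⟪z, e (f (s 0) -ᵥ o)⟫ := by
      rw [← inner_sub_right, ← map_sub, vsub_sub_vsub_cancel_right]
    have h8 := hD (s (r • v)) (s 0)
    have h9 : r - B - 2 * |C| ≤ lipMinorant f e o z (s (r • v)) - lipMinorant f e o z (s 0) := by
      linarith [le_abs_self C]
    have h10 : c.toReal * dist (s (r • v)) (s 0) < r - B - 2 * |C| := by
      have e1 : dist (s (r • v)) (s 0) ≤ (1 + (1 - c.toReal)) * (r + B) + |D| :=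
        h8.trans (add_le_add (mul_le_mul_of_nonneg_left h3 (by linarith)) (le_abs_self D))
      have e2 : c.toReal * dist (s (r • v)) (s 0) ≤
          c.toReal * ((1 + (1 - c.toReal)) * (r + B) + |D|) := by gcongr
      have e3 : c.toReal * ((1 + (1 - c.toReal)) * (r + B) + |D|) =
          r - r * (1 - c.toReal) ^ 2 + (c.toReal * (2 - c.toReal)) * B + c.toReal * |D| := by ring
      have e4 : c.toReal * |D| ≤ |D| := by nlinarith [abs_nonneg D]
      have e5 : (c.toReal * (2 - c.toReal)) * B ≤ 2 * B := by
        apply mul_le_mul_of_nonneg_right _ hB0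
        nlinarith
      linarith
    have h11 : s (r • v) ≠ s 0 := by
      intro h
      rw [h] at h9 h10
      simp only [dist_self, sub_self, mul_zero] at h9 h10
      linarith
    refine lt_of_lt_of_le ?_ (le_lipConst h11)
    rw [ENNReal.lt_ofReal_iff_toReal_lt hct, lt_div_iff₀ (dist_pos.2 h11), Real.dist_eq,
      add_sub_add_right_eq_sub]
    exact h10.trans_le (h9.trans (le_abs_self _))

variable {m : Measure (contactSet e N)} [IsFiniteMeasure m]

theorem integrable_lipMinorant (hC : ∀ x x', N (f x -ᵥ f x') ≤ dist x x' + C) (x : X) :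
    Integrable (fun ζ : contactSet e N =>
      lipMinorant f e o ζ x • (ζ : EuclideanSpace ℝ (Fin n))) m := by
  refine Integrable.of_bound ((measurable_lipMinorant hC x).stronglyMeasurable.smul
    continuous_subtype_val.stronglyMeasurable).aestronglyMeasurable
    (‖e (f x -ᵥ o)‖ + C) (Eventually.of_forall fun ζ => ?_)
  rw [norm_smul, ζ.2.1, mul_one, Real.norm_eq_abs]
  have h1 := abs_lipMinorant_sub_inner_le (o := o) hC ζ.2 x
  have h2 := abs_real_inner_le_norm (ζ : EuclideanSpace ℝ (Fin n)) (e (f x -ᵥ o))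
  rw [ζ.2.1, one_mul] at h2
  have h3 := abs_add_le (lipMinorant f e o ζ x - ⟪(ζ : EuclideanSpace ℝ (Fin n)), e (f x -ᵥ o)⟫)
    ⟪(ζ : EuclideanSpace ℝ (Fin n)), e (f x -ᵥ o)⟫
  rw [sub_add_cancel] at h3
  linarith

/-- The straightening of a map. -/
noncomputable def straighten (f : X → Y) (o : Y) (m : Measure (contactSet e N)) (x : X) : Y :=
  e.symm (∫ ζ : contactSet e N, lipMinorant f e o ζ x • (ζ : EuclideanSpace ℝ (Fin n)) ∂m) +ᵥ o

omit [IsFiniteMeasure m] in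
theorem apply_straighten (x : X) : e (straighten f o m x -ᵥ o) =
    ∫ ζ : contactSet e N, lipMinorant f e o ζ x • (ζ : EuclideanSpace ℝ (Fin n)) ∂m := by
  rw [straighten, vadd_vsub, e.apply_symm_apply]

theorem norm_straighten_sub_le (hC : ∀ x x', N (f x -ᵥ f x') ≤ dist x x' + C) (x x' : X) :
    ‖e (straighten f o m x -ᵥ straighten f o m x')‖ ≤ m.real Set.univ * dist x x' := by
  rw [← vsub_sub_vsub_cancel_right _ _ o, map_sub, apply_straighten, apply_straighten,
    ← integral_sub (integrable_lipMinorant hC x) (integrable_lipMinorant hC x')]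
  refine (norm_integral_le_of_norm_le_const (Eventually.of_forall fun ζ => ?_)).trans
    (mul_comm _ _).le
  rw [← sub_smul, norm_smul, ζ.2.1, mul_one]
  exact abs_lipMinorant_sub_le hC ζ.2 x x'

variable (hm : ∀ w, ∫ ζ : contactSet e N, ⟪(ζ : EuclideanSpace ℝ (Fin n)), w⟫ •
  (ζ : EuclideanSpace ℝ (Fin n)) ∂m = w)

theorem integrable_inner_smul (w : EuclideanSpace ℝ (Fin n)) :
    Integrable (fun ζ : contactSet e N => ⟪(ζ : EuclideanSpace ℝ (Fin n)), w⟫ •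
      (ζ : EuclideanSpace ℝ (Fin n))) m := by
  have : CompactSpace (contactSet e N) := isCompact_iff_compactSpace.1 (isCompact_contactSet e N)
  have hc : Continuous fun ζ : contactSet e N => ⟪(ζ : EuclideanSpace ℝ (Fin n)), w⟫ •
    (ζ : EuclideanSpace ℝ (Fin n)) := by fun_prop
  exact hc.integrable_of_hasCompactSupport (HasCompactSupport.of_compactSpace _)

include hm

/-- By `hm` the vector `e (f x -ᵥ o)` is itself the integral of `⟪ζ, e (f x -ᵥ o)⟫ • ζ`, and the
integrands differ by at most `C`. -/
theorem norm_straighten_sub_self_le (hC : ∀ x x', N (f x -ᵥ f x') ≤ dist x x' + C) (x : X) :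
    ‖e (straighten f o m x -ᵥ f x)‖ ≤ C * m.real Set.univ := by
  rw [← vsub_sub_vsub_cancel_right _ _ o, map_sub, apply_straighten]
  conv_lhs => enter [1, 2]; rw [← hm (e (f x -ᵥ o))]
  rw [← integral_sub (integrable_lipMinorant hC x) (integrable_inner_smul _)]
  refine norm_integral_le_of_norm_le_const (Eventually.of_forall fun ζ => ?_)
  rw [← sub_smul, norm_smul, ζ.2.1, mul_one]
  exact abs_lipMinorant_sub_inner_le hC ζ.2 x

/-- The straightening is equivariant. -/
theorem straighten_comp (hC : ∀ x x', N (f x -ᵥ f x') ≤ dist x x' + C) (φ : X ≃ X)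
    (hφ : Isometry φ) (O : EuclideanSpace ℝ (Fin n) ≃ₗᵢ[ℝ] EuclideanSpace ℝ (Fin n))
    (hO : ∀ ζ : contactSet e N, O ζ ∈ contactSet e N)
    (hmO : m.map (fun ζ : contactSet e N => (⟨O ζ, hO ζ⟩ : contactSet e N)) = m)
    (b : EuclideanSpace ℝ (Fin n))
    (hf : ∀ x, e (f (φ x) -ᵥ o) = O (e (f x -ᵥ o)) + b) (x : X) :
    e (straighten f o m (φ x) -ᵥ o) = O (e (straighten f o m x -ᵥ o)) + b := by
  have hOm : Measurable fun ζ : contactSet e N => (⟨O ζ, hO ζ⟩ : contactSet e N) :=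
    ((O.continuous.comp continuous_subtype_val).subtype_mk _).measurable
  have hi := integrable_lipMinorant (m := m) (o := o) hC (φ x)
  rw [apply_straighten, apply_straighten]
  -- Substitute `O ζ` for `ζ`. The translation `b` contributes `⟪ζ, O⁻¹ b⟫ • ζ`, which integrates to
  -- `O⁻¹ b`.
  conv_lhs => rw [← hmO]
  rw [integral_map hOm.aemeasurable (by rw [hmO]; exact hi.aestronglyMeasurable)]
  have h1 : ∀ ζ : contactSet e N, lipMinorant f e o (O ζ) (φ x) • O (ζ : EuclideanSpace ℝ (Fin n)) =
      (O : EuclideanSpace ℝ (Fin n) →L[ℝ] EuclideanSpace ℝ (Fin n))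
        (lipMinorant f e o ζ x • (ζ : EuclideanSpace ℝ (Fin n)) +
          ⟪(ζ : EuclideanSpace ℝ (Fin n)), O.symm b⟫ • (ζ : EuclideanSpace ℝ (Fin n))) := fun ζ => by
    rw [lipMinorant_comp hC ζ.2 φ hφ O b hf, add_smul]
    have : ⟪O (ζ : EuclideanSpace ℝ (Fin n)), b⟫ =
        ⟪(ζ : EuclideanSpace ℝ (Fin n)), O.symm b⟫ := by
      conv_lhs => rw [← O.apply_symm_apply b, O.inner_map_map]
    rw [this]
    simp
  have hint : Integrable (fun ζ : contactSet e N =>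
      lipMinorant f e o ζ x • (ζ : EuclideanSpace ℝ (Fin n)) +
        ⟪(ζ : EuclideanSpace ℝ (Fin n)), O.symm b⟫ • (ζ : EuclideanSpace ℝ (Fin n))) m :=
    (integrable_lipMinorant hC x).add (integrable_inner_smul _)
  simp only [h1]
  rw [ContinuousLinearMap.integral_comp_comm _ hint,
    integral_add (integrable_lipMinorant hC x) (integrable_inner_smul _), hm]
  simp

/-- The Hilbert constant of the straightening. -/
theorem tildeHilb_straighten [FiniteDimensional ℝ V] [Nonempty X] (hn : n ≠ 0)
    (hf : IsAsymptoticIsometry f N) (hNe : ∀ v, N v ≤ ‖e v‖)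
    (hC : ∀ x x', N (f x -ᵥ f x') ≤ dist x x' + C) (o' : Y) :
    tildeHilb dist (formNorm (euclideanForm e)) (fun x => straighten f o m x -ᵥ o') = 1 := by
  have : CompleteSpace V := FiniteDimensional.complete ℝ V
  have hC0 := nonneg_of_le_dist_add hC
  have hZ : ∀ z ∈ contactSet e N, ‖z‖ = 1 := fun z hz => hz.1
  have hψ := measurableEmbedding_axialOfSet e (isCompact_contactSet e N) hZ
  have hμ := isPartitionOfUnity_map_axialOfSet (e := e) (isCompact_contactSet e N) hZ hm
  have hfin : IsFiniteMeasure (m.map (axialOfSet e hZ)) := inferInstance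
  suffices h : minTildeDilL2 dist (formNorm (euclideanForm e))
      (fun x => straighten f o m x -ᵥ o') = (n : ℝ≥0∞) ^ (1 / 2 : ℝ) by
    rw [tildeHilb, h, minTildeDilL2_id hn, ENNReal.div_self (by simp [hn]) (by simp)]
  refine le_antisymm ?_ ?_
  -- The minorants are the lift; the constant added accounts for the change of origin from `o` to
  -- `o'`.
  · let F : AxialProjector (formNorm (euclideanForm e)) → X → ℝ := fun p x =>
      lipMinorant f e o (e p.vec) x + ⟪e p.vec, e (o -ᵥ o')⟫
    have hFψ : ∀ ζ x, F (axialOfSet e hZ ζ) x =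
        lipMinorant f e o ζ x + ⟪(ζ : EuclideanSpace ℝ (Fin n)), e (o -ᵥ o')⟫ := fun ζ x => by
      simp only [F, axialOfSet_vec, e.apply_symm_apply]
    have hlip : ∀ᵐ p ∂(m.map (axialOfSet e hZ)), lipConst dist dist (F p) = 1 := by
      refine hψ.ae_map_iff.2 (Eventually.of_forall fun ζ => ?_)
      simp only [funext (hFψ ζ)]
      exact lipConst_lipMinorant hf hNe hC ζ.2 _
    have hsum : ∀ x, (fun p => F p x • p.vec) ∘ axialOfSet e hZ = fun ζ : contactSet e N =>
        (e.symm : EuclideanSpace ℝ (Fin n) →L[ℝ] V)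
          (lipMinorant f e o ζ x • (ζ : EuclideanSpace ℝ (Fin n)) +
            ⟪(ζ : EuclideanSpace ℝ (Fin n)), e (o -ᵥ o')⟫ • (ζ : EuclideanSpace ℝ (Fin n))) :=
      fun x => by
        ext ζ
        simp only [Function.comp_apply, hFψ, axialOfSet_vec, add_smul, map_add, map_smul,
          ContinuousLinearEquiv.coe_coe]
    have hint : ∀ x, Integrable (fun ζ : contactSet e N =>
        lipMinorant f e o ζ x • (ζ : EuclideanSpace ℝ (Fin n)) +
          ⟪(ζ : EuclideanSpace ℝ (Fin n)), e (o -ᵥ o')⟫ • (ζ : EuclideanSpace ℝ (Fin n))) m :=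
      fun x => (integrable_lipMinorant hC x).add (integrable_inner_smul _)
    refine iInf₂_le_of_le _ hμ (iInf₂_le_of_le F ⟨fun x => ?_, ?_, fun x => ?_, fun x => ?_⟩
      (lintegral_sq_le_of_ae_le_one hμ (hlip.mono fun p hp => hp.le)))
    · refine MemLp.of_bound (hψ.aestronglyMeasurable_map_iff.2 ?_)
        (‖e (f x -ᵥ o)‖ + C + ‖e (o -ᵥ o')‖) (hψ.ae_map_iff.2 (Eventually.of_forall fun ζ => ?_))
      · have : Measurable fun ζ : contactSet e N =>
            lipMinorant f e o ζ x + ⟪(ζ : EuclideanSpace ℝ (Fin n)), e (o -ᵥ o')⟫ :=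
          (measurable_lipMinorant hC x).add (Continuous.measurable (by fun_prop))
        refine (this.aestronglyMeasurable).congr (Eventually.of_forall fun ζ => ?_)
        exact (hFψ ζ x).symm
      · rw [hFψ, Real.norm_eq_abs]
        have h1 := abs_lipMinorant_sub_inner_le (o := o) hC ζ.2 x
        have h2 := abs_real_inner_le_norm (ζ : EuclideanSpace ℝ (Fin n)) (e (f x -ᵥ o))
        have h3 := abs_real_inner_le_norm (ζ : EuclideanSpace ℝ (Fin n)) (e (o -ᵥ o'))
        rw [ζ.2.1, one_mul] at h2 h3
        rw [abs_le] at *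
        constructor <;> linarith
    -- Measurability of the Lipschitz constants in `p` is where their exact value 1, rather than the
    -- bound, is needed.
    · exact (aemeasurable_const (b := (1 : ℝ≥0∞))).congr (hlip.mono fun p hp => hp.symm)
    · rw [hψ.integrable_map_iff, hsum]
      exact ContinuousLinearMap.integrable_comp _ (hint x)
    · rw [hψ.integral_map]
      refine (congrArg (fun g => ∫ ζ, g ζ ∂m) (hsum x)).trans ?_
      rw [ContinuousLinearMap.integral_comp_comm _ (hint x),
        integral_add (integrable_lipMinorant hC x) (integrable_inner_smul _), hm,
        ← apply_straighten, ← map_add, vsub_add_vsub_cancel]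
      simp
  -- A coarse section of `f` is one of the straightening too, since the two maps are at bounded
  -- distance.
  · obtain ⟨s, B, hB0, hs, hs'⟩ := hf.exists_section o'
    refine le_minTildeDilL2 (s := s)
      (C₀ := C * m.real Set.univ + ‖(e : V →L[ℝ] EuclideanSpace ℝ (Fin n))‖ * B) hn
      (fun a a' h => dist_pos.2 h) dist_self (fun v => ?_) fun ε hε => ?_
    · have h1 := norm_straighten_sub_self_le (o := o) hm hC (s v)
      have h2 : ‖e ((f (s v) -ᵥ o') - v)‖ ≤ ‖(e : V →L[ℝ] EuclideanSpace ℝ (Fin n))‖ * B :=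
        (ContinuousLinearMap.le_opNorm (e : V →L[ℝ] EuclideanSpace ℝ (Fin n)) _).trans
          (mul_le_mul_of_nonneg_left (hs v) (norm_nonneg _))
      have h3 : e (straighten f o m (s v) -ᵥ o') - e v =
          e (straighten f o m (s v) -ᵥ f (s v)) + e ((f (s v) -ᵥ o') - v) := by
        rw [← map_sub, ← map_add, ← vsub_add_vsub_cancel _ (f (s v)) o']
        congr 1; abel
      rw [h3]
      exact (norm_add_le _ _).trans (add_le_add h1 h2)
    · obtain ⟨D, hD⟩ := hf.lower ε hε
      refine ⟨(1 + ε) * B + D, fun v w => (hD _ _).trans ?_⟩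
      have h1 := hs' v w
      have h2 := map_add_le_add N (v - w) ((f (s v) -ᵥ f (s w)) - (v - w))
      rw [add_sub_cancel] at h2
      have h3 := hNe (v - w)
      rw [map_sub e] at h3
      have h4 : N (f (s v) -ᵥ f (s w)) ≤ ‖e v - e w‖ + B := by linarith
      nlinarith

end Straightening

/-! ### Consequences of the group action -/

section Equivariance

variable {Γ X V Y : Type*} [Group Γ] [TopologicalSpace Γ] [MetricSpace X]
  [MulAction Γ X] [IsIsometricSMul Γ X] [NormedAddCommGroup V] [NormedSpace ℝ V]
  [FiniteDimensional ℝ V] [MetricSpace Y] [NormedAddTorsor V Y] [MulAction Γ Y]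

theorem IsCocompactQuasiTranslational.exists_linearPart
    (hY : IsCocompactQuasiTranslational Γ V Y) (γ : Γ) :
    ∃ A : V ≃L[ℝ] V, ∀ y y' : Y, γ • y -ᵥ γ • y' = A (y -ᵥ y') := by
  obtain ⟨T, hT⟩ := hY.affine γ
  have hb : Function.Bijective T := by
    rw [← funext hT]
    exact MulAction.bijective γ
  refine ⟨(LinearEquiv.ofBijective T.linear
    (T.linear_bijective_iff.2 hb)).toContinuousLinearEquiv, fun y y' => ?_⟩
  rw [hT, hT, ← T.linearMap_vsub]
  rfl

omit [TopologicalSpace Γ] [FiniteDimensional ℝ V] in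
/-- A seminorm for which an equivariant map is an asymptotic isometry is invariant. -/
theorem IsAsymptoticIsometry.map_linearPart {f : X → Y} {N : Seminorm ℝ V}
    (hf : IsAsymptoticIsometry f N) (hequiv : ∀ (γ : Γ) (x : X), f (γ • x) = γ • f x)
    {γ : Γ} {A : V ≃L[ℝ] V} (hA : ∀ y y' : Y, γ • y -ᵥ γ • y' = A (y -ᵥ y')) (v : V) :
    N (A v) = N v := by
  refine le_antisymm ?_ ?_
  · refine hf.seminorm_comp_le (isometry_smul X γ) (A : V →ₗ[ℝ] V)
      ⟨_, (A : V →L[ℝ] V).le_opNorm⟩ (fun x x' => ?_) v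
    rw [hequiv, hequiv, hA]
    rfl
  · have h := hf.seminorm_comp_le (isometry_smul X γ⁻¹) (A.symm : V →ₗ[ℝ] V)
      ⟨_, (A.symm : V →L[ℝ] V).le_opNorm⟩ (fun x x' => ?_) (A v)
    · exact (congrArg N (A.symm_apply_apply v)).symm.trans_le h
    · rw [hequiv, hequiv]
      refine A.injective ((hA _ _).symm.trans ?_)
      rw [smul_inv_smul, smul_inv_smul]
      exact (A.apply_symm_apply _).symm

/-- Elements acting by translations preserve distances in `X` and in `Y`. They carry a pair with
nearby images into the preimage of one fixed ball, which is compact by properness; so nearby images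
have nearby preimages. -/
theorem IsCocompactQuasiTranslational.exists_isAsymptoticIsometry [Nonempty X]
    [IsTopologicalGroup Γ] [LocallyCompactSpace Γ] [ContinuousSMul Γ Y]
    (hY : IsCocompactQuasiTranslational Γ V Y) {f : X → Y}
    (hproper : ∀ K : Set Y, IsCompact K → IsCompact (f ⁻¹' K))
    (hequiv : ∀ (γ : Γ) (x : X), f (γ • x) = γ • f x)
    (hlarge : ∃ C : ℝ, ∀ x x' : X, dist (f x) (f x') ≤ C * dist x x' + C) :
    ∃ N : Seminorm ℝ V, IsAsymptoticIsometry f N := by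
  obtain ⟨R, hR⟩ := hY.exists_translation_dist_le
  refine _root_.exists_isAsymptoticIsometry (R := R) (fun y y' => ?_) (fun r => ?_) hlarge
  · obtain ⟨γ, ⟨v, hv⟩, h⟩ := hR y y'
    exact ⟨fun x => γ • x, v, isometry_smul X γ, fun x => (hequiv γ x).trans (hv _), hv y ▸ h⟩
  · obtain ⟨y₀⟩ : Nonempty Y := inferInstance
    obtain ⟨D, hD⟩ := Metric.isBounded_iff.1
      (hproper _ (isCompact_closedBall_torsor y₀ (R + r))).isBounded
    refine ⟨D, fun x x' hx => ?_⟩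
    obtain ⟨γ, ⟨v, hv⟩, h⟩ := hR (f x) y₀
    have h1 : dist (γ • f x) (γ • f x') = dist (f x) (f x') := by
      rw [hv, hv, dist_vadd_cancel_left]
    rw [← dist_smul γ]
    refine hD ?_ ?_ <;> rw [Set.mem_preimage, Metric.mem_closedBall, hequiv]
    · linarith [dist_nonneg (x := f x) (y := f x')]
    · linarith [dist_triangle_left (γ • f x') y₀ (γ • f x)]

end Equivariance

/-! ### The straightening theorem -/

theorem mainTheorem3
    {Γ : Type*} [Group Γ] [TopologicalSpace Γ] [IsTopologicalGroup Γ] [LocallyCompactSpace Γ]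
    {X : Type*} [MetricSpace X] [LocallyCompactSpace X] [Nonempty X]
    [MulAction Γ X] [IsIsometricSMul Γ X] [ContinuousSMul Γ X]
    {V : Type*} [NormedAddCommGroup V] [NormedSpace ℝ V] [FiniteDimensional ℝ V] [Nontrivial V]
    {Y : Type*} [MetricSpace Y] [NormedAddTorsor V Y]
    [MulAction Γ Y] [ContinuousSMul Γ Y]
    (hY : IsCocompactQuasiTranslational Γ V Y)
    (f₀ : X → Y) (hcont : Continuous f₀) (hproper : ∀ K : Set Y, IsCompact K → IsCompact (f₀ ⁻¹' K))
    (hequiv : ∀ (γ : Γ) (x : X), f₀ (γ • x) = γ • f₀ x)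
    (hlarge : ∃ C : ℝ, ∀ x x' : X, dist (f₀ x) (f₀ x') ≤ C * dist x x' + C) :
    ∃ h : QuadraticForm ℝ V,
      IsFedererWhitneyJohn f₀ h ∧
      (∀ h' : QuadraticForm ℝ V, IsFedererWhitneyJohn f₀ h' → h' = h) ∧
      (∀ (γ : Γ) (y y' : Y), h (γ • y -ᵥ γ • y') = h (y -ᵥ y')) ∧
      ∃ f : X → Y,
        (∀ (γ : Γ) (x : X), f (γ • x) = γ • f x) ∧
        lipConst dist (normDist (formNorm h)) f < ⊤ ∧
        (∃ r : ℝ, ∀ x : X, normDist (formNorm h) (f x) (f₀ x) ≤ r) ∧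
        (∀ o : Y, tildeHilb dist (formNorm h) (fun x => f x -ᵥ o) = 1) ∧
        coLipAtInfty dist (normDist (formNorm h)) f ≤ 1 := by
  obtain ⟨N, hf⟩ := hY.exists_isAsymptoticIsometry hproper hequiv hlarge
  obtain ⟨C, hC⟩ := hf.upper
  have hFW := hf.isFedererWhitney
  have hN : ∀ v, v ≠ 0 → 0 < N v := fun v hv =>
    lt_of_le_of_ne (apply_nonneg N v) fun h => hv (hFW.1 v h.symm)
  obtain ⟨n, hn, e, hNe, ι, _, z, c, hz1, hzN, hc, hzc⟩ := N.exists_john_decomposition hFW.1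
  have hZc := isCompact_contactSet e N
  have hZ : ∀ ζ ∈ contactSet e N, ‖ζ‖ = 1 := fun ζ hζ => hζ.1
  obtain ⟨m, _, hm, hinv⟩ := exists_invariant_measure hZc.isClosed
    (fun i => show z i ∈ contactSet e N from ⟨hz1 i, hzN i⟩) hZ hc hzc
  have hJ : IsJohnForm N (euclideanForm e) :=
    isJohnForm_of_measure hN hNe hZc hZ (fun ζ hζ => hζ.2) hm
  choose A hA using hY.exists_linearPart
  have hNA : ∀ γ v, N (A γ v) = N v := fun γ => hf.map_linearPart hequiv (hA γ)
  -- Since `A γ` preserves `N`, the same contact set and measure show that `e ∘ A γ` also gives a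
  -- John form of `N`; uniqueness identifies it with that of `e`.
  have heA : ∀ γ v, ‖e (A γ v)‖ = ‖e v‖ := fun γ v => by
    have h1 : IsJohnForm N (euclideanForm ((A γ).trans e)) :=
      isJohnForm_of_measure hN (fun v => (hNA γ v).symm.trans_le (hNe _)) hZc hZ
        (fun ζ hζ v => (hζ.2 _).trans_eq (hNA γ v)) hm
    have h2 := congrArg (fun h => formNorm h v) (h1.unique hN hJ)
    simp only [formNorm_euclideanForm] at h2
    exact h2
  have hdist : ∀ y y' : Y, normDist (formNorm (euclideanForm e)) y y' = ‖e (y -ᵥ y')‖ :=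
    fun y y' => formNorm_euclideanForm e _
  have hclose := norm_straighten_sub_self_le (o := Classical.arbitrary Y) hm hC
  refine ⟨euclideanForm e, ⟨N, hFW, hJ⟩, ?_, fun γ y y' => ?_,
    straighten f₀ (Classical.arbitrary Y) m, fun γ x => ?_, ?_, ⟨C * m.real Set.univ, fun x => ?_⟩,
    tildeHilb_straighten hm hn hf hNe hC, ?_⟩
  · rintro h' ⟨N', hN', hJ'⟩
    rw [hf.eq_of_isFedererWhitney hN'] at hJ'
    exact hJ'.unique hN hJ
  · rw [hA, euclideanForm_apply, euclideanForm_apply, heA]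
  · set o := Classical.arbitrary Y
    let O : EuclideanSpace ℝ (Fin n) ≃ₗᵢ[ℝ] EuclideanSpace ℝ (Fin n) :=
      ⟨(e.symm.trans ((A γ).trans e)).toLinearEquiv, fun w =>
        (heA γ (e.symm w)).trans (congrArg norm (e.apply_symm_apply w))⟩
    have hOe : ∀ v, O (e v) = e (A γ v) := fun v =>
      congrArg (fun w => e (A γ w)) (e.symm_apply_apply v)
    have hO : ∀ ζ : contactSet e N, O ζ ∈ contactSet e N := fun ζ =>
      ⟨(O.norm_map _).trans ζ.2.1, fun v => by
        rw [← (A γ).apply_symm_apply v, ← hOe, O.inner_map_map, hNA]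
        exact ζ.2.2 _⟩
    have hO' : ∀ ζ : contactSet e N, O.symm ζ ∈ contactSet e N := fun ζ =>
      ⟨(O.symm.norm_map _).trans ζ.2.1, fun v => by
        rw [← O.inner_map_map, O.apply_symm_apply, hOe, ← hNA γ]
        exact ζ.2.2 _⟩
    have h1 := straighten_comp hm hC (MulAction.toPerm γ) (isometry_smul X γ) O hO
      (hinv O hO hO') (e (γ • o -ᵥ o)) (fun x => by
        rw [MulAction.toPerm_apply, hequiv, hOe, ← hA, ← map_add, vsub_add_vsub_cancel]) x
    rw [MulAction.toPerm_apply, hOe, ← hA, ← map_add, vsub_add_vsub_cancel] at h1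
    exact vsub_left_cancel (e.injective h1)
  · refine (lipConst_le (L := m.real Set.univ) (fun a a' h => dist_pos.2 h) fun a a' => ?_).trans_lt ENNReal.ofReal_lt_top
    rw [hdist]
    exact norm_straighten_sub_le hC a a'
  · rw [hdist]
    exact hclose x
  -- Combine `lower` for `f₀` with `N ≤ ‖e ·‖`; replacing `f₀` by the straightened map costs only a
  -- constant.
  · refine coLipAtInfty_le_one fun ε hε => ?_
    obtain ⟨D, hD⟩ := hf.lower ε hε
    refine ⟨(1 + ε) * (2 * (C * m.real Set.univ)) + D, fun x x' => (hD x x').trans ?_⟩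
    rw [hdist]
    set g := straighten f₀ (Classical.arbitrary Y) m
    have h1 : e (f₀ x -ᵥ f₀ x') =
        e (g x -ᵥ g x') - e (g x -ᵥ f₀ x) + e (g x' -ᵥ f₀ x') := by
      rw [← map_sub, ← map_add, ← vsub_sub_vsub_cancel_right (f₀ x) (f₀ x') (g x'),
        ← vsub_add_vsub_cancel (f₀ x) (g x) (g x'), ← neg_vsub_eq_vsub_rev (g x) (f₀ x),
        ← neg_vsub_eq_vsub_rev (g x') (f₀ x')]
      congr 1; abel
    have h2 : N (f₀ x -ᵥ f₀ x') ≤ ‖e (g x -ᵥ g x')‖ + 2 * (C * m.real Set.univ) := by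
      refine (hNe _).trans ?_
      rw [h1]
      have h3 := norm_add_le (e (g x -ᵥ g x') - e (g x -ᵥ f₀ x)) (e (g x' -ᵥ f₀ x'))
      have h4 := norm_sub_le (e (g x -ᵥ g x')) (e (g x -ᵥ f₀ x))
      linarith [hclose x, hclose x']
    nlinarith
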